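/- Notation. For an open interval $I=(\alpha,\beta)$ let $S_0(I)$ denote a region $\{x\in\mathbb C:\arg x\in I,\ 0<|x|<\rho(\arg x)\}$, where $\rho$ is some positive continuous function on $I$ (the same notation is used for various $\rho$). For $\kappa>0$ and $\beta-\alpha>\pi/\kappa$, a holomorphic function $f$ on $S_0(I)$ is called $\kappa$-Borel summable on $S_0(I)$, written $f\in\mathscr O_{\{1/\kappa\}}(S_0(I))$, if for some region $S_0(I)$ there are constants $M,C>0$ and a sequence $(a_m)_{m\ge0}$ in $\mathbb C$ with $$\Big|f(x)-\sum_{m=0}^{N-1}a_mx^m\Big|\le M C^N|x|^N\,\Gamma\!\Big(\frac N\kappa+1\Big)\qquad\text{for all } N\ge0,\ x\in S_0(I);$$ one then puts $f(0)=a_0$. Let $\gamma\ge1$ be an integer, $\theta_*\in\mathbb R$, and let $A(x)=(a_{i,j}(x))$ be an $n\times n$ matrix of functions that are $\gamma$-Borel summable in the direction $\theta_*$, that is, $a_{i,j}\in\mathscr O_{\{1/\gamma\}}(S_0(\theta_*-\delta,\theta_*+\delta))$ for some $\delta>\pi/(2\gamma)$ (for example, $a_{i,j}$ holomorphic near $0$).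 Assume that $A(0)=\mathrm{diag}(\lambda_1,\dots,\lambda_n)$ is diagonal with distinct eigenvalues, and that $\theta_*$ is not a singular direction, i.e. $$\theta_*\notin\Theta_1=\Big\{\frac{\arg(\lambda_i-\lambda_j)+2\pi\ell}{\gamma}:\ i\ne j,\ \ell\in\mathbb Z\Big\}.$$ Then there is $\epsilon_*>0$ with $\pi/(2\gamma)+\epsilon_*\le\delta$ and $(\theta_*-\epsilon_*,\theta_*+\epsilon_*)\cap\Theta_1=\emptyset$. For every such $\epsilon_*$, put $I=(\theta_*-\frac{\pi}{2\gamma}-\epsilon_*,\ \theta_*+\frac{\pi}{2\gamma}+\epsilon_*)$. There exist polynomials $\lambda_1(x),\dots,\lambda_n(x)$ of degree $\le\gamma$ with $\lambda_i(0)=\lambda_i$, and a holomorphic $n\times n$ matrix $P(x)$, invertible at each point of a region $S_0(I)$, such that * for every $0<\epsilon<\epsilon_*$ the entries of $P$ belong to $\mathscr O_{\{1/\gamma\}}\big(S_0(\theta_*-\frac{\pi}{2\gamma}-\epsilon,\ \theta_*+\frac{\pi}{2\gamma}+\epsilon)\big)$, with asymptotic expansions that do not depend on $\epsilon$, and $P(0)=\mathrm{Id}$;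 * $Y=P(x)Z$ transforms $x^{1+\gamma}Y'=A(x)Y$ into $x^{1+\gamma}Z'=\Lambda(x)Z$ with $\Lambda(x)=\mathrm{diag}(\lambda_1(x),\dots,\lambda_n(x))$: on every open subset of $S_0(I)$, $Z$ is a solution of the second system if and only if $PZ$ is a solution of the first. -/

import Mathlib

open Matrix

/-- `ρ` is positive and continuous on the open interval `(α, β)`. -/
def IsRadius (α β : ℝ) (ρ : ℝ → ℝ) : Prop :=
  ContinuousOn ρ (Set.Ioo α β) ∧ ∀ t ∈ Set.Ioo α β, 0 < ρ t

/-- The sectorial region `S₀(α, β) = {x ∈ ℂ : arg x ∈ (α, β), 0 < |x| < ρ(arg x)}`,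
where `arg` denotes any determination of the argument. -/
def sector (α β : ℝ) (ρ : ℝ → ℝ) : Set ℂ :=
  {x | ∃ t ∈ Set.Ioo α β, ∃ r : ℝ, 0 < r ∧ r < ρ t ∧
    x = (r : ℂ) * Complex.exp ((t : ℂ) * Complex.I)}

/-- `f` is a `κ`-Borel summable function on `S₀(α, β)`, for some radius function `ρ`, with
asymptotic expansion `∑ aₘ xᵐ` at the origin. The value of `f` at `x = 0` is, by convention,
the leading coefficient `a 0`; the estimate for `N = 1` says that `f(x) → a 0` as `x → 0`. -/
def IsBorelSummable (κ α β : ℝ) (f : ℂ → ℂ) (a : ℕ → ℂ) : Prop :=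
  0 < κ ∧ Real.pi / κ < β - α ∧
    ∃ ρ : ℝ → ℝ, IsRadius α β ρ ∧ DifferentiableOn ℂ f (sector α β ρ) ∧
      ∃ M C : ℝ, 0 < M ∧ 0 < C ∧ ∀ N : ℕ, ∀ x ∈ sector α β ρ,
        ‖f x - ∑ m ∈ Finset.range N, a m * x ^ m‖ ≤
          M * C ^ N * ‖x‖ ^ N * Real.Gamma ((N : ℝ) / κ + 1)

/-- The set `Θ₁` of singular directions `(arg(λᵢ - λⱼ) + 2πℓ)/γ` with `i ≠ j` and `ℓ ∈ ℤ`.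
As `ℓ` runs over `ℤ`, the set does not depend on the determination of the argument. -/
def singularDirections {n : ℕ} (γ : ℕ) (lam : Fin n → ℂ) : Set ℝ :=
  {θ | ∃ i j : Fin n, i ≠ j ∧ ∃ l : ℤ,
    θ = (Complex.arg (lam i - lam j) + 2 * Real.pi * (l : ℝ)) / (γ : ℝ)}

/-- `Y` is a (holomorphic) solution of `x^(1+γ) Y' = A(x) Y` on the open set `U`. -/
def IsSolutionOn {n : ℕ} (γ : ℕ) (A : ℂ → Matrix (Fin n) (Fin n) ℂ) (U : Set ℂ)
    (Y : ℂ → Fin n → ℂ) : Prop :=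
  ∀ x ∈ U, ∃ Y' : Fin n → ℂ, HasDerivAt Y Y' x ∧ x ^ (1 + γ) • Y' = A x *ᵥ Y x

/-- On `S`, the invertible linear substitution `Y = P(x) Z` transforms the system
`x^(1+γ) Y' = A(x) Y` into `x^(1+γ) Z' = B(x) Z`. -/
def TransformsOn {n : ℕ} (γ : ℕ) (A B P : ℂ → Matrix (Fin n) (Fin n) ℂ) (S : Set ℂ) : Prop :=
  (∀ x ∈ S, IsUnit (P x)) ∧
    ∀ U : Set ℂ, IsOpen U → U ⊆ S → ∀ Z : ℂ → Fin n → ℂ,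
      IsSolutionOn γ A U (fun x => P x *ᵥ Z x) ↔ IsSolutionOn γ B U Z

/-! The system is diagonalized column by column. Column `j` of `P` is sought as `(e_j + q) exp B`
with `q_j = 0`. Elimination of the scalar factor leaves for `q` the Riccati system `x^(γ+1) v' = A v
- (A v)_j v`, `v = e_j + q`, whose linear part is `λ_i - λ_j` and whose remaining coefficients `A -
diag λ` vanish at the origin. Once `v` is known, `b = (A v)_j` has a Gevrey expansion. Its terms of
degree at most `γ` form the polynomial `Λ_j`, and `B` is the primitive of `(b - Λ_j) / x^(γ+1)`
vanishing at `0`, so that `x^(γ+1) P' = A P - P Λ` (`IsColumn.hasDerivAt_add_single`,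
`LocalGevrey.exists_primitive`).

The Riccati system is solved in the variable `u = exp(iγθ) / x^γ`, where it reads `q_i' = -ν_i q_i -
(nonlinear part)` with constant `ν_i`. The sector of half opening `π/(2γ) + ε` corresponds to a
neighbourhood of infinity in a union of two half planes, and each linear equation is solved by
integrating along a ray parallel to one of the two boundary lines. The integral converges if
`exp(ν_i u)` decays along the ray. That one of the two rays has this property is exactly what the
absence of singular directions within `ε₀` of `θ` provides (`le_abs_arg_rotatedCoeff`,
`exists_direction`).

Functions are carried together with their formal series. `GevreyBound` plays the part of a Banach
algebra norm on such pairs: it controls products (`GevreyBound.mul`), is complete (`exists_limit`),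
and is preserved up to a constant by the linear equations (`of_solution`). Rescaling the variable
makes `A - diag λ` small, so the Riccati system becomes a contraction (`exists_riccati_solution`),
and its fixed point has a Gevrey expansion by construction. No Borel transform is needed.

For each `ε < ε₀` this gives a column on one sector. Bounded solutions are unique
(`riccati_unique`), so the columns agree near the origin and are glued as `ε` tends to `ε₀`
(`exists_column`). The translation between `IsBorelSummable` and these estimates is
`IsBorelSummable.localGevrey` and `isBorelSummable_of_series`. -/

open PowerSeries in
/-- The partial sum of order `N` of a formal power series at the point `z`. -/
noncomputable def partialSum (A : PowerSeries ℂ) (z : ℂ) (N : ℕ) : ℂ :=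
  ∑ m ∈ Finset.range N, coeff m A * z ^ m

/-- `T` is open, and `g ≤ 1` is a majorant of `|X| ^ γ` there. -/
structure IsGauge (γ : ℕ) (T : Set ℂ) (X : ℂ → ℂ) (g : ℂ → ℝ) : Prop where
  pos : 0 < γ
  isOpen : IsOpen T
  pow_le : ∀ u ∈ T, ‖X u‖ ^ γ ≤ g u
  le_one : ∀ u ∈ T, g u ≤ 1

/-- The function `e.1`, holomorphic on `T`, has the Gevrey expansion `e.2` of order `1 / γ` in the
variable `X`, with constant `M`, the remainders of orders `γ * K` being measured by `g ^ K`. -/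
structure GevreyBound (γ : ℕ) (T : Set ℂ) (X : ℂ → ℂ) (g : ℂ → ℝ)
    (e : (ℂ → ℂ) × PowerSeries ℂ) (M : ℝ) : Prop where
  diff : DifferentiableOn ℂ e.1 T
  coeff : ∀ m, ‖PowerSeries.coeff m e.2‖ ≤ M * (m / γ).factorial
  rem : ∀ K, ∀ u ∈ T, ‖e.1 u - partialSum e.2 (X u) (γ * K)‖ ≤ M * K.factorial * g u ^ K

/-! ### Convolution estimates for factorials. -/

section Factorials

/-- Equivalent to `K ≤ K.choose k` for `0 < k < K`: only the two end terms of the convolution are as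
large as `K!`. -/
theorem factorial_mul_factorial_le_pred {K k : ℕ} (h1 : 1 ≤ k) (h2 : k + 1 ≤ K) :
    k.factorial * (K - k).factorial ≤ (K - 1).factorial := by
  obtain ⟨l, rfl⟩ : ∃ l, K = k + l + 1 := ⟨K - k - 1, by omega⟩
  obtain ⟨i, rfl⟩ : ∃ i, k = i + 1 := ⟨k - 1, by omega⟩
  have e1 : i + 1 + l + 1 - (i + 1) = l + 1 := by omega
  have e2 : i + 1 + l + 1 - 1 = i + (l + 1) := by omega
  rw [e1, e2]
  clear h1 h2 e1 e2
  induction i with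
  | zero => simp
  | succ i ih =>
    have : i + 1 + (l + 1) = (i + (l + 1)) + 1 := by ring
    rw [this, Nat.factorial_succ, Nat.factorial_succ (i + (l + 1)), mul_assoc]
    exact Nat.mul_le_mul (by omega) ih

/-- The end terms give `2 K!` and all the interior ones together at most `K!`. This is what makes
the Gevrey norms submultiplicative up to a constant. -/
theorem sum_factorial_mul_factorial_le (K : ℕ) :
    ∑ k ∈ Finset.range (K + 1), k.factorial * (K - k).factorial ≤ 3 * K.factorial := by
  rcases K with _ | K
  · simp
  rw [Finset.sum_range_succ, Finset.sum_range_succ']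
  have : ∑ k ∈ Finset.range K, (k + 1).factorial * (K + 1 - (k + 1)).factorial
      ≤ ∑ k ∈ Finset.range K, K.factorial :=
    Finset.sum_le_sum fun k hk => by
      have := Finset.mem_range.1 hk
      exact factorial_mul_factorial_le_pred (K := K + 1) (by omega) (by omega)
  have h2 : K * K.factorial ≤ (K + 1).factorial := by
    rw [Nat.factorial_succ]; exact Nat.mul_le_mul_right _ (by omega)
  simp only [Finset.sum_const, Finset.card_range, smul_eq_mul] at this
  simp only [Nat.factorial_zero, Nat.sub_zero, one_mul, Nat.sub_self, mul_one]
  omega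

theorem sum_range_mul_div {M : Type*} [AddCommMonoid M] {γ : ℕ} (hγ : 0 < γ) (F : ℕ → M) (K : ℕ) :
    ∑ m ∈ Finset.range (γ * K), F (m / γ) = γ • ∑ k ∈ Finset.range K, F k := by
  induction K with
  | zero => simp
  | succ K ih =>
    rw [Nat.mul_succ, Finset.sum_range_add, ih, Finset.sum_range_succ, smul_add]
    congr 1
    rw [Finset.sum_congr rfl (g := fun _ => F K)]
    · simp
    · intro x hx
      rw [Nat.mul_add_div hγ, Nat.div_eq_of_lt (Finset.mem_range.1 hx), add_zero]

theorem sum_block_factorial_le {γ : ℕ} (hγ : 0 < γ) (K : ℕ) :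
    ∑ m ∈ Finset.range (γ * (K + 1)), (m / γ).factorial * (K - m / γ).factorial
      ≤ 3 * γ * K.factorial := by
  rw [sum_range_mul_div hγ (fun k => k.factorial * (K - k).factorial), smul_eq_mul]
  calc _ ≤ γ * (3 * K.factorial) := Nat.mul_le_mul_left _ (sum_factorial_mul_factorial_le K)
    _ = _ := by ring

end Factorials

/-! ### The algebra of pairs (function, formal series) with Gevrey bounds. -/

namespace GevreyBound

variable {γ : ℕ} {T : Set ℂ} {X : ℂ → ℂ} {g : ℂ → ℝ} {e e' : (ℂ → ℂ) × PowerSeries ℂ} {M M' : ℝ}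

theorem nonneg (h : GevreyBound γ T X g e M) : 0 ≤ M := by
  have := (norm_nonneg _).trans (h.coeff 0)
  simpa using this

theorem bound (h : GevreyBound γ T X g e M) {u : ℂ} (hu : u ∈ T) : ‖e.1 u‖ ≤ M := by
  simpa [partialSum] using h.rem 0 u hu

theorem mono_const (h : GevreyBound γ T X g e M) (hG : IsGauge γ T X g) (hM : M ≤ M') :
    GevreyBound γ T X g e M' where
  diff := h.diff
  coeff m := (h.coeff m).trans (by gcongr)
  rem K u hu := (h.rem K u hu).trans (by
    have := (pow_nonneg (norm_nonneg _) _).trans (hG.pow_le u hu)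
    gcongr)

theorem mono_set (h : GevreyBound γ T X g e M) {T' : Set ℂ} (hT : T' ⊆ T) :
    GevreyBound γ T' X g e M where
  diff := h.diff.mono hT
  coeff := h.coeff
  rem K u hu := h.rem K u (hT hu)

theorem partialSum_add (A B : PowerSeries ℂ) (z : ℂ) (N : ℕ) :
    partialSum (A + B) z N = partialSum A z N + partialSum B z N := by
  simp [partialSum, add_mul, Finset.sum_add_distrib]

theorem partialSum_smul (c : ℂ) (A : PowerSeries ℂ) (z : ℂ) (N : ℕ) :
    partialSum (c • A) z N = c * partialSum A z N := by
  simp [partialSum, Finset.mul_sum, mul_assoc]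

theorem add (h : GevreyBound γ T X g e M) (h' : GevreyBound γ T X g e' M') :
    GevreyBound γ T X g (e + e') (M + M') where
  diff := h.diff.add h'.diff
  coeff m := by
    have := norm_add_le_of_le (h.coeff m) (h'.coeff m)
    simpa [add_mul] using this
  rem K u hu := by
    have := norm_add_le_of_le (h.rem K u hu) (h'.rem K u hu)
    rw [Prod.fst_add, Prod.snd_add, partialSum_add, Pi.add_apply, add_sub_add_comm]
    linarith

theorem smul (h : GevreyBound γ T X g e M) (c : ℂ) :
    GevreyBound γ T X g (c • e) (‖c‖ * M) where
  diff := h.diff.const_smul c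
  coeff m := by
    have := mul_le_mul_of_nonneg_left (h.coeff m) (norm_nonneg c)
    simpa [mul_assoc] using this
  rem K u hu := by
    have := mul_le_mul_of_nonneg_left (h.rem K u hu) (norm_nonneg c)
    rw [← norm_mul] at this
    rw [Prod.smul_fst, Prod.smul_snd, partialSum_smul, Pi.smul_apply, smul_eq_mul, ← mul_sub]
    linarith

theorem neg (h : GevreyBound γ T X g e M) : GevreyBound γ T X g (-e) M := by
  simpa using h.smul (-1)

theorem sub (h : GevreyBound γ T X g e M) (h' : GevreyBound γ T X g e' M') :
    GevreyBound γ T X g (e - e') (M + M') := by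
  simpa [sub_eq_add_neg] using h.add h'.neg

theorem zero (hG : IsGauge γ T X g) (hM : 0 ≤ M) : GevreyBound γ T X g 0 M where
  diff := differentiableOn_const 0
  coeff m := by simpa using by positivity
  rem K u hu := by
    have := (pow_nonneg (norm_nonneg _) _).trans (hG.pow_le u hu)
    simpa [partialSum] using by positivity

theorem one (hG : IsGauge γ T X g) : GevreyBound γ T X g 1 1 where
  diff := differentiableOn_const 1
  coeff m := by
    have : (1 : ℝ) ≤ (m / γ).factorial := by exact_mod_cast Nat.factorial_pos _
    simp only [Prod.snd_one, PowerSeries.coeff_one]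
    split_ifs <;> simp [this]
  rem K u hu := by
    have := (pow_nonneg (norm_nonneg _) _).trans (hG.pow_le u hu)
    rcases Nat.eq_zero_or_pos K with rfl | hK
    · simp [partialSum]
    · have h1 : partialSum 1 (X u) (γ * K) = 1 := by
        rw [partialSum, Finset.sum_eq_single 0]
        · simp
        · intro b _ hb; simp [PowerSeries.coeff_one, hb]
        · intro h0; exact absurd (Finset.mem_range.2 (Nat.mul_pos hG.pos hK)) h0
      simp only [Prod.fst_one, Prod.snd_one, h1]
      simpa using by positivity

theorem sum {ι : Type*} (hG : IsGauge γ T X g) (s : Finset ι) {F : ι → (ℂ → ℂ) × PowerSeries ℂ}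
    {B : ι → ℝ} (h : ∀ i ∈ s, GevreyBound γ T X g (F i) (B i)) :
    GevreyBound γ T X g (∑ i ∈ s, F i) (∑ i ∈ s, B i) := by
  classical
  induction s using Finset.induction_on with
  | empty => simpa using zero hG le_rfl
  | insert i s hi ih =>
    rw [Finset.sum_insert hi, Finset.sum_insert hi]
    exact (h i (by simp)).add (ih fun j hj => h j (by simp [hj]))

theorem partialSum_mul (A B : PowerSeries ℂ) (z : ℂ) (N : ℕ) :
    partialSum (A * B) z N =
      ∑ m ∈ Finset.range N, PowerSeries.coeff m A * z ^ m * partialSum B z (N - m) := by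
  induction N with
  | zero => simp [partialSum]
  | succ N ih =>
    have h1 : partialSum (A * B) z (N + 1) = partialSum (A * B) z N +
        ∑ m ∈ Finset.range (N + 1), PowerSeries.coeff m A * z ^ m *
          (PowerSeries.coeff (N - m) B * z ^ (N - m)) := by
      rw [partialSum, Finset.sum_range_succ, ← partialSum, PowerSeries.coeff_mul,
        Finset.Nat.sum_antidiagonal_eq_sum_range_succ_mk, Finset.sum_mul]
      congr 1
      refine Finset.sum_congr rfl fun m hm => ?_
      have : m + (N - m) = N := by have := Finset.mem_range.1 hm; omega
      conv_lhs => rw [← this, pow_add]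
      simp only [this]
      ring
    have h2 : ∑ m ∈ Finset.range N, PowerSeries.coeff m A * z ^ m * partialSum B z (N - m) =
        ∑ m ∈ Finset.range (N + 1), PowerSeries.coeff m A * z ^ m * partialSum B z (N - m) := by
      rw [Finset.sum_range_succ]; simp [partialSum]
    rw [h1, ih, h2, ← Finset.sum_add_distrib]
    refine Finset.sum_congr rfl fun m hm => ?_
    have : N + 1 - m = N - m + 1 := by have := Finset.mem_range.1 hm; omega
    rw [this, ← mul_add]
    congr 1
    simp [partialSum, Finset.sum_range_succ]

theorem norm_X_le_one (hG : IsGauge γ T X g) {u : ℂ} (hu : u ∈ T) : ‖X u‖ ≤ 1 :=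
  (pow_le_one_iff_of_nonneg (norm_nonneg _) hG.pos.ne').1 ((hG.pow_le u hu).trans (hG.le_one u hu))

theorem gauge_nonneg (hG : IsGauge γ T X g) {u : ℂ} (hu : u ∈ T) : 0 ≤ g u :=
  (pow_nonneg (norm_nonneg _) _).trans (hG.pow_le u hu)

theorem norm_X_pow_le (hG : IsGauge γ T X g) {u : ℂ} (hu : u ∈ T) {m k : ℕ} (h : γ * k ≤ m) :
    ‖X u‖ ^ m ≤ g u ^ k := by
  calc ‖X u‖ ^ m ≤ ‖X u‖ ^ (γ * k) :=
        pow_le_pow_of_le_one (norm_nonneg _) (norm_X_le_one hG hu) h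
    _ = (‖X u‖ ^ γ) ^ k := pow_mul _ _ _
    _ ≤ _ := pow_le_pow_left₀ (by positivity) (hG.pow_le u hu) k

/-- The remainders of an order `γ * K - m`, multiplied by `X ^ m`. -/
theorem norm_pow_mul_rem_le (hG : IsGauge γ T X g) (h : GevreyBound γ T X g e M) {u : ℂ}
    (hu : u ∈ T) {m K : ℕ} (hm : m ≤ γ * K) :
    ‖X u ^ m * (e.1 u - partialSum e.2 (X u) (γ * K - m))‖ ≤
      (1 + γ) * M * (K - m / γ).factorial * g u ^ K := by
  have hγ := hG.pos
  have hM := h.nonneg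
  have hg := gauge_nonneg hG hu
  set k := m / γ with hk
  have hkm : γ * k ≤ m := Nat.mul_div_le m γ
  have hkK : k ≤ K := by
    have : γ * k ≤ γ * K := hkm.trans hm
    exact Nat.le_of_mul_le_mul_left this hγ
  have hmk : m < γ * k + γ := by
    have := Nat.lt_mul_div_succ m hγ
    rw [← hk] at this; linarith [Nat.mul_succ γ k]
  have hle : γ * K - m ≤ γ * (K - k) := by rw [Nat.mul_sub]; omega
  have hcard : γ * (K - k) - (γ * K - m) ≤ γ := by
    rw [Nat.mul_sub]
    have : γ * k ≤ γ * K := hkm.trans hm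
    omega
  -- Only orders that are multiples of `γ` are controlled. The order `γ K - m` is replaced by the
  -- next one, `γ (K - k)` with `k = m / γ`, at the price of at most `γ` extra terms, each as small
  -- as the remainder. Hence the factor `1 + γ`.
  have hsplit : partialSum e.2 (X u) (γ * (K - k)) = partialSum e.2 (X u) (γ * K - m) +
      ∑ l ∈ Finset.Ico (γ * K - m) (γ * (K - k)), PowerSeries.coeff l e.2 * X u ^ l := by
    rw [partialSum, partialSum, Finset.sum_range_add_sum_Ico _ hle]
  have e1 : X u ^ m * (e.1 u - partialSum e.2 (X u) (γ * K - m)) =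
      X u ^ m * (e.1 u - partialSum e.2 (X u) (γ * (K - k))) +
      ∑ l ∈ Finset.Ico (γ * K - m) (γ * (K - k)), PowerSeries.coeff l e.2 * X u ^ (m + l) := by
    rw [hsplit]
    have : ∑ l ∈ Finset.Ico (γ * K - m) (γ * (K - k)), PowerSeries.coeff l e.2 * X u ^ (m + l) =
      X u ^ m * ∑ l ∈ Finset.Ico (γ * K - m) (γ * (K - k)), PowerSeries.coeff l e.2 * X u ^ l := by
      rw [Finset.mul_sum]
      exact Finset.sum_congr rfl fun l _ => by rw [pow_add]; ring
    rw [this]; ring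
  have b1 : ‖X u ^ m * (e.1 u - partialSum e.2 (X u) (γ * (K - k)))‖ ≤
      M * (K - k).factorial * g u ^ K := by
    rw [norm_mul, norm_pow]
    calc _ ≤ g u ^ k * (M * (K - k).factorial * g u ^ (K - k)) := by
          gcongr
          · exact norm_X_pow_le hG hu hkm
          · exact h.rem _ u hu
      _ = M * (K - k).factorial * (g u ^ k * g u ^ (K - k)) := by ring
      _ = _ := by rw [← pow_add, Nat.add_sub_cancel' hkK]
  have b2 : ‖∑ l ∈ Finset.Ico (γ * K - m) (γ * (K - k)), PowerSeries.coeff l e.2 * X u ^ (m + l)‖ ≤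
      γ * (M * (K - k).factorial * g u ^ K) := by
    calc _ ≤ ∑ l ∈ Finset.Ico (γ * K - m) (γ * (K - k)), M * (K - k).factorial * g u ^ K := by
          refine norm_sum_le_of_le _ fun l hl => ?_
          obtain ⟨hl1, hl2⟩ := Finset.mem_Ico.1 hl
          rw [norm_mul, norm_pow]
          have : l / γ ≤ K - k := Nat.div_le_of_le_mul hl2.le
          have hf : ((l / γ).factorial : ℝ) ≤ (K - k).factorial := by
            exact_mod_cast Nat.factorial_le this
          have := norm_X_pow_le hG hu (m := m + l) (k := K) (by omega)
          calc _ ≤ (M * (l / γ).factorial) * g u ^ K := by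
                gcongr
                exact h.coeff l
            _ ≤ _ := by gcongr
      _ ≤ _ := by
          rw [Finset.sum_const, Nat.card_Ico, nsmul_eq_mul]
          gcongr
  rw [e1]
  calc _ ≤ M * (K - k).factorial * g u ^ K + γ * (M * (K - k).factorial * g u ^ K) :=
        norm_add_le_of_le b1 b2
    _ = _ := by ring

/-- A constant for the continuity of the product. -/
def mulConst (γ : ℕ) : ℝ := 3 * γ * (1 + γ) + 1

theorem mulConst_nonneg (γ : ℕ) : 0 ≤ mulConst γ := by unfold mulConst; positivity

/-- The remainder of a product is (remainder of `e`) times `e'` plus the sum over `m` of `a_m X^m`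
times the remainder of `e'` of order `γ K - m`. The first term accounts for the `1` in `mulConst`,
the sum for `3 γ (1 + γ)` by `sum_block_factorial_le`. -/
theorem mul (hG : IsGauge γ T X g) (h : GevreyBound γ T X g e M)
    (h' : GevreyBound γ T X g e' M') : GevreyBound γ T X g (e * e') (mulConst γ * M * M') := by
  have hγ := hG.pos
  have hM := h.nonneg
  have hM' := h'.nonneg
  refine ⟨h.diff.mul h'.diff, fun m => ?_, fun K u hu => ?_⟩
  · rw [Prod.snd_mul, PowerSeries.coeff_mul, Finset.Nat.sum_antidiagonal_eq_sum_range_succ_mk]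
    have hsum : ∑ i ∈ Finset.range (m + 1), (i / γ).factorial * ((m - i) / γ).factorial ≤
        3 * γ * (m / γ).factorial := by
      refine le_trans ?_ (sum_block_factorial_le hγ (m / γ))
      have hmk : m + 1 ≤ γ * (m / γ + 1) := Nat.lt_mul_div_succ m hγ
      refine le_trans (Finset.sum_le_sum fun i hi => ?_)
        (Finset.sum_le_sum_of_subset (Finset.range_mono hmk))
      refine Nat.mul_le_mul_left _ (Nat.factorial_le ?_)
      have hi' := Finset.mem_range.1 hi
      have : m / γ = (i + (m - i)) / γ := by congr 1; omega
      have := Nat.div_add_div_le_add_div (x := i) (y := m - i) (z := γ)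
      omega
    have hsum' : (∑ i ∈ Finset.range (m + 1),
        ((i / γ).factorial : ℝ) * ((m - i) / γ).factorial) ≤ 3 * γ * (m / γ).factorial := by
      exact_mod_cast hsum
    calc _ ≤ ∑ i ∈ Finset.range (m + 1), M * M' *
          (((i / γ).factorial : ℝ) * ((m - i) / γ).factorial) := by
          refine norm_sum_le_of_le _ fun i _ => ?_
          rw [norm_mul]
          calc _ ≤ (M * (i / γ).factorial) * (M' * ((m - i) / γ).factorial) := by
                gcongr
                · exact h.coeff i
                · exact h'.coeff _
            _ = _ := by ring
      _ ≤ M * M' * (3 * γ * (m / γ).factorial) := by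
          rw [← Finset.mul_sum]; gcongr
      _ ≤ M * M' * (mulConst γ * (m / γ).factorial) := by
          have : (3 : ℝ) * γ ≤ mulConst γ := by
            unfold mulConst; nlinarith [(Nat.cast_nonneg γ : (0:ℝ) ≤ γ)]
          gcongr
      _ = _ := by ring
  · have hg := gauge_nonneg hG hu
    have key : (e * e').1 u - partialSum (e * e').2 (X u) (γ * K) =
        (e.1 u - partialSum e.2 (X u) (γ * K)) * e'.1 u +
        ∑ m ∈ Finset.range (γ * K), PowerSeries.coeff m e.2 *
          (X u ^ m * (e'.1 u - partialSum e'.2 (X u) (γ * K - m))) := by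
      rw [Prod.fst_mul, Prod.snd_mul, partialSum_mul, Pi.mul_apply]
      have : ∑ m ∈ Finset.range (γ * K), PowerSeries.coeff m e.2 *
          (X u ^ m * (e'.1 u - partialSum e'.2 (X u) (γ * K - m))) =
          partialSum e.2 (X u) (γ * K) * e'.1 u - ∑ m ∈ Finset.range (γ * K),
            PowerSeries.coeff m e.2 * X u ^ m * partialSum e'.2 (X u) (γ * K - m) := by
        rw [partialSum, Finset.sum_mul, ← Finset.sum_sub_distrib]
        exact Finset.sum_congr rfl fun m _ => by ring
      rw [this]; ring
    have b1 : ‖(e.1 u - partialSum e.2 (X u) (γ * K)) * e'.1 u‖ ≤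
        M * K.factorial * g u ^ K * M' := by
      rw [norm_mul]
      gcongr
      · exact h.rem K u hu
      · exact h'.bound hu
    have b2 : ‖∑ m ∈ Finset.range (γ * K), PowerSeries.coeff m e.2 *
          (X u ^ m * (e'.1 u - partialSum e'.2 (X u) (γ * K - m)))‖ ≤
        (1 + γ) * M * M' * g u ^ K * (3 * γ * K.factorial) := by
      have hs : (∑ m ∈ Finset.range (γ * (K + 1)),
          ((m / γ).factorial : ℝ) * (K - m / γ).factorial) ≤ 3 * γ * K.factorial := by
        exact_mod_cast sum_block_factorial_le hγ K
      calc _ ≤ ∑ m ∈ Finset.range (γ * K), (1 + γ) * M * M' * g u ^ K *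
            (((m / γ).factorial : ℝ) * (K - m / γ).factorial) := by
            refine norm_sum_le_of_le _ fun m hm => ?_
            rw [norm_mul]
            calc _ ≤ (M * (m / γ).factorial) *
                  ((1 + γ) * M' * (K - m / γ).factorial * g u ^ K) := by
                  gcongr
                  · exact h.coeff m
                  · exact norm_pow_mul_rem_le hG h' hu (Finset.mem_range.1 hm).le
              _ = _ := by ring
        _ ≤ ∑ m ∈ Finset.range (γ * (K + 1)), (1 + γ) * M * M' * g u ^ K *
            (((m / γ).factorial : ℝ) * (K - m / γ).factorial) := by
            refine Finset.sum_le_sum_of_subset_of_nonneg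
              (Finset.range_mono (Nat.mul_le_mul_left _ (by omega))) fun i _ _ => by positivity
        _ ≤ _ := by rw [← Finset.mul_sum]; gcongr
    rw [key]
    calc _ ≤ _ := norm_add_le_of_le b1 b2
      _ = _ := by unfold mulConst; ring

/-- Two pairs at distance zero coincide. -/
theorem eq_of_forall_pos (h : ∀ M > 0, GevreyBound γ T X g e M) :
    (∀ u ∈ T, e.1 u = 0) ∧ e.2 = 0 := by
  refine ⟨fun u hu => ?_, ?_⟩
  · rw [← norm_le_zero_iff]
    exact le_of_forall_pos_le_add fun M hM => by simpa using (h M hM).bound hu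
  · ext m
    rw [map_zero, ← norm_le_zero_iff]
    refine le_of_forall_pos_le_add fun M hM => ?_
    have hf : (0 : ℝ) < (m / γ).factorial := by exact_mod_cast Nat.factorial_pos _
    have := (h (M / (m / γ).factorial) (by positivity)).coeff m
    rw [div_mul_cancel₀ _ hf.ne'] at this
    simpa using this

end GevreyBound

/-! ### Completeness, exponentials and rescaling. -/

namespace GevreyBound

variable {γ : ℕ} {T : Set ℂ} {X : ℂ → ℂ} {g : ℂ → ℝ} {e e' : (ℂ → ℂ) × PowerSeries ℂ} {M M' : ℝ}

/-- Completeness: a sequence whose increments are summable for the Gevrey norms converges. -/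
theorem exists_limit (hG : IsGauge γ T X g) {F : ℕ → (ℂ → ℂ) × PowerSeries ℂ} {b : ℕ → ℝ}
    (hF0 : ∃ M, GevreyBound γ T X g (F 0) M) (hb : Summable b)
    (h : ∀ k, GevreyBound γ T X g (F (k + 1) - F k) (b k)) :
    ∃ e, (∀ k, GevreyBound γ T X g (F k - e) (∑' i, b (i + k))) ∧
      (∀ u ∈ T, Filter.Tendsto (fun k => (F k).1 u) Filter.atTop (nhds (e.1 u))) := by
  classical
  have hb0 : ∀ k, 0 ≤ b k := fun k => (h k).nonneg
  have hbk : ∀ k, Summable fun i => b (i + k) := fun k => (summable_nat_add_iff k).2 hb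
  have hdiff : ∀ k l, GevreyBound γ T X g (F k - F (k + l)) (∑' i, b (i + k)) := by
    intro k l
    have : GevreyBound γ T X g (F k - F (k + l)) (∑ i ∈ Finset.range l, b (i + k)) := by
      induction l with
      | zero => simpa using zero hG le_rfl
      | succ l ih =>
        have h1 := ih.sub (h (k + l))
        rw [Finset.sum_range_succ, add_comm l k]
        convert h1 using 1
        rw [← add_assoc]; abel
    exact this.mono_const hG ((hbk k).sum_le_tsum _ fun i _ => hb0 _)
  have hc1 : ∀ u ∈ T, CauchySeq fun k => (F k).1 u := fun u hu => by
    refine cauchySeq_of_dist_le_of_summable b (fun k => ?_) hb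
    rw [dist_comm, dist_eq_norm]
    exact (h k).bound hu
  have hc2 : ∀ m, CauchySeq fun k => PowerSeries.coeff m (F k).2 := fun m => by
    refine cauchySeq_of_dist_le_of_summable (fun k => b k * (m / γ).factorial)
      (fun k => ?_) (hb.mul_right _)
    rw [dist_comm, dist_eq_norm]
    simpa using (h k).coeff m
  have hl1 : ∀ u, ∃ l, u ∈ T → Filter.Tendsto (fun k => (F k).1 u) Filter.atTop (nhds l) := by
    intro u
    by_cases hu : u ∈ T
    · obtain ⟨l, hl⟩ := cauchySeq_tendsto_of_complete (hc1 u hu)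
      exact ⟨l, fun _ => hl⟩
    · exact ⟨0, fun h => absurd h hu⟩
  have hl2 := fun m => cauchySeq_tendsto_of_complete (hc2 m)
  choose f hf using hl1
  choose a ha using hl2
  have hFd : ∀ k, DifferentiableOn ℂ (F k).1 T := fun k => by
    obtain ⟨M, hM⟩ := hF0
    have := hM.diff.sub (hdiff 0 k).diff
    simpa using this
  have hfb : ∀ k, ∀ u ∈ T, ‖(F k).1 u - f u‖ ≤ ∑' i, b (i + k) := fun k u hu => by
    have ht : Filter.Tendsto (fun l => (F k).1 u - (F (l + k)).1 u) Filter.atTop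
        (nhds ((F k).1 u - f u)) :=
      tendsto_const_nhds.sub ((Filter.tendsto_add_atTop_iff_nat k).2 (hf u hu))
    refine le_of_tendsto ht.norm (Filter.Eventually.of_forall fun l => ?_)
    have := (hdiff k l).bound hu
    rwa [add_comm k l] at this
  have hfd : DifferentiableOn ℂ f T := by
    have htail : Filter.Tendsto (fun k => ∑' i, b (i + k)) Filter.atTop (nhds 0) :=
      tendsto_sum_nat_add b
    have hu : TendstoUniformlyOn (fun k => (F k).1) f Filter.atTop T := by
      rw [Metric.tendstoUniformlyOn_iff]
      intro ε hε
      filter_upwards [htail.eventually (gt_mem_nhds hε)] with k hk u hu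
      rw [dist_comm, dist_eq_norm]
      exact (hfb k u hu).trans_lt hk
    exact hu.tendstoLocallyUniformlyOn.differentiableOn
      (Filter.Eventually.of_forall hFd) hG.isOpen
  -- Each estimate involves one coefficient, or one point and a finite partial sum, so it passes to
  -- the limit in `l` from the bounds on `F k - F (l + k)`.
  refine ⟨(f, PowerSeries.mk a), fun k => ⟨(hFd k).sub hfd, fun m => ?_, fun K u hu => ?_⟩,
    fun u hu => hf u hu⟩
  · have ht : Filter.Tendsto (fun l => PowerSeries.coeff m (F k - F (l + k)).2) Filter.atTop
        (nhds (PowerSeries.coeff m (F k - (f, PowerSeries.mk a)).2)) := by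
      simp only [Prod.snd_sub, map_sub, PowerSeries.coeff_mk]
      exact tendsto_const_nhds.sub
        ((Filter.tendsto_add_atTop_iff_nat (f := fun k => PowerSeries.coeff m (F k).2) k).2 (ha m))
    refine le_of_tendsto ht.norm (Filter.Eventually.of_forall fun l => ?_)
    have := (hdiff k l).coeff m
    rwa [add_comm k l] at this
  · have ht : Filter.Tendsto (fun l => (F k - F (l + k)).1 u -
        partialSum (F k - F (l + k)).2 (X u) (γ * K)) Filter.atTop
        (nhds ((F k - (f, PowerSeries.mk a)).1 u -
          partialSum (F k - (f, PowerSeries.mk a)).2 (X u) (γ * K))) := by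
      refine Filter.Tendsto.sub ?_ ?_
      · exact tendsto_const_nhds.sub
          ((Filter.tendsto_add_atTop_iff_nat (f := fun k => (F k).1 u) k).2 (hf u hu))
      · refine tendsto_finsetSum _ fun m _ => Filter.Tendsto.mul_const _ ?_
        simp only [Prod.snd_sub, map_sub, PowerSeries.coeff_mk]
        exact tendsto_const_nhds.sub
          ((Filter.tendsto_add_atTop_iff_nat (f := fun k => PowerSeries.coeff m (F k).2) k).2
            (ha m))
    refine le_of_tendsto ht.norm (Filter.Eventually.of_forall fun l => ?_)
    have := (hdiff k l).rem K u hu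
    rwa [add_comm k l] at this

/-- The exponential of a function with a Gevrey expansion has one. -/
theorem exp (hG : IsGauge γ T X g) (h : GevreyBound γ T X g e M) :
    ∃ A M', GevreyBound γ T X g (fun u => Complex.exp (e.1 u), A) M' := by
  set κ := mulConst γ with hκ
  have hκ0 : 0 ≤ κ := mulConst_nonneg γ
  have hM := h.nonneg
  have hpow : ∀ k : ℕ, GevreyBound γ T X g (e ^ k) ((κ * M) ^ k) := by
    intro k
    induction k with
    | zero => simpa using one hG
    | succ k ih =>
      rw [pow_succ, pow_succ]
      convert mul hG ih h using 1
      ring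
  set F : ℕ → (ℂ → ℂ) × PowerSeries ℂ :=
    fun N => ∑ k ∈ Finset.range N, ((k.factorial : ℂ)⁻¹) • e ^ k with hF
  have hstep : ∀ k, GevreyBound γ T X g (F (k + 1) - F k) ((κ * M) ^ k / k.factorial) := by
    intro k
    have : F (k + 1) - F k = ((k.factorial : ℂ)⁻¹) • e ^ k := by
      simp [hF, Finset.sum_range_succ]
    rw [this]
    convert (hpow k).smul ((k.factorial : ℂ)⁻¹) using 1
    rw [norm_inv, Complex.norm_natCast]; ring
  obtain ⟨E, hE, hlim⟩ := exists_limit hG (F := F) ⟨0, by simpa [hF] using zero hG le_rfl⟩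
    (Real.summable_pow_div_factorial (κ * M)) hstep
  have h0 := (hE 0).neg
  have hF0 : F 0 = 0 := by simp [hF]
  rw [hF0, zero_sub, neg_neg] at h0
  have hEexp : ∀ u ∈ T, E.1 u = Complex.exp (e.1 u) := by
    intro u hu
    refine tendsto_nhds_unique (hlim u hu) ?_
    have := (NormedSpace.expSeries_div_hasSum_exp (e.1 u)).tendsto_sum_nat
    rw [← Complex.exp_eq_exp_ℂ] at this
    refine this.congr fun N => ?_
    simp only [hF, Prod.fst_sum, Finset.sum_apply, Prod.smul_fst, Prod.pow_fst, Pi.smul_apply,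
      Pi.pow_apply, smul_eq_mul]
    exact Finset.sum_congr rfl fun k _ => by rw [div_eq_inv_mul]
  refine ⟨E.2, _, ⟨?_, h0.coeff, fun K u hu => ?_⟩⟩
  · exact h0.diff.congr fun u hu => (hEexp u hu).symm
  · have := h0.rem K u hu
    rwa [hEexp u hu] at this

theorem partialSum_rescale (s : ℂ) (A : PowerSeries ℂ) (z : ℂ) (N : ℕ) :
    partialSum (PowerSeries.rescale s A) z N = partialSum A (s * z) N := by
  simp only [partialSum, PowerSeries.coeff_rescale]
  exact Finset.sum_congr rfl fun m _ => by rw [mul_pow]; ring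

/-- Change of the variable `u` and rescaling of `X`. -/
theorem comp (h : GevreyBound γ T X g e M) {s : ℝ} (hs : 0 < s) (hs1 : s ≤ 1)
    {T' : Set ℂ} {φ : ℂ → ℂ} (hφ : DifferentiableOn ℂ φ T') (hT : ∀ u ∈ T', φ u ∈ T)
    {X' : ℂ → ℂ} {g' : ℂ → ℝ} (hX : ∀ u ∈ T', X (φ u) = s * X' u)
    (hg0 : ∀ u ∈ T', 0 ≤ g (φ u)) (hg : ∀ u ∈ T', g (φ u) ≤ g' u) :
    GevreyBound γ T' X' g' (fun u => e.1 (φ u), PowerSeries.rescale (s : ℂ) e.2) M where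
  diff := h.diff.comp hφ hT
  coeff m := by
    have hM := h.nonneg
    rw [PowerSeries.coeff_rescale, norm_mul, norm_pow, Complex.norm_real, Real.norm_of_nonneg hs.le]
    calc _ ≤ 1 * (M * (m / γ).factorial) := by
          gcongr
          · exact pow_le_one₀ hs.le hs1
          · exact h.coeff m
      _ = _ := one_mul _
  rem K u hu := by
    have hM := h.nonneg
    rw [partialSum_rescale, ← hX u hu]
    refine (h.rem K _ (hT u hu)).trans ?_
    have := hg0 u hu
    gcongr
    exact hg u hu

/-- A function with a Gevrey expansion tends to the constant term. -/
theorem norm_sub_coeff_zero_le (hG : IsGauge γ T X g) (h : GevreyBound γ T X g e M) {u : ℂ}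
    (hu : u ∈ T) : ‖e.1 u - PowerSeries.coeff 0 e.2‖ ≤ M * g u + γ * M * ‖X u‖ := by
  have hγ := hG.pos
  have hM := h.nonneg
  have h1 := h.rem 1 u hu
  have h2 : ‖partialSum e.2 (X u) (γ * 1) - PowerSeries.coeff 0 e.2‖ ≤ γ * M * ‖X u‖ := by
    obtain ⟨k, rfl⟩ : ∃ k, γ = k + 1 := ⟨γ - 1, by omega⟩
    rw [partialSum, mul_one, Finset.sum_range_succ', pow_zero, mul_one, add_sub_cancel_right]
    calc _ ≤ ∑ m ∈ Finset.range k, M * ‖X u‖ := by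
          refine norm_sum_le_of_le _ fun m hm => ?_
          have hc := h.coeff (m + 1)
          rw [Nat.div_eq_of_lt (by have := Finset.mem_range.1 hm; omega)] at hc
          simp only [Nat.factorial_zero, Nat.cast_one, mul_one] at hc
          rw [norm_mul, norm_pow]
          gcongr
          rw [pow_succ]
          exact mul_le_of_le_one_left (norm_nonneg _)
            (pow_le_one₀ (norm_nonneg _) (norm_X_le_one hG hu))
      _ = k * M * ‖X u‖ := by simp; ring
      _ ≤ _ := by
          gcongr
          omega
  have h3 := norm_add_le_of_le h1 h2
  simpa using h3

/-- Rescaling makes the norm of an expansion without constant term small. -/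
theorem rescale_small (h : GevreyBound γ T X g e M) (hγ : 0 < γ)
    (h0 : PowerSeries.coeff 0 e.2 = 0) {s : ℝ} (hs : 0 < s) (hs1 : s ≤ 1)
    {T' : Set ℂ} (hT : T' ⊆ T) {X' : ℂ → ℂ} {g' : ℂ → ℝ} (hG' : IsGauge γ T' X' g')
    (hX : ∀ u ∈ T', X u = s * X' u) (hg : ∀ u ∈ T', g u = s ^ γ * g' u) :
    GevreyBound γ T' X' g' (e.1, PowerSeries.rescale (s : ℂ) e.2) ((1 + γ) * M * s) := by
  have hM := h.nonneg
  have hcoef : ∀ m, ‖PowerSeries.coeff m (PowerSeries.rescale (s : ℂ) e.2)‖ ≤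
      M * s * (m / γ).factorial := by
    intro m
    rcases Nat.eq_zero_or_pos m with rfl | hm
    · rw [PowerSeries.coeff_rescale, h0]; simp; positivity
    rw [PowerSeries.coeff_rescale, norm_mul, norm_pow, Complex.norm_real, Real.norm_of_nonneg hs.le]
    calc _ ≤ s ^ 1 * (M * (m / γ).factorial) := by
          gcongr ?_ * ?_
          · exact pow_le_pow_of_le_one hs.le hs1 hm
          · exact h.coeff m
      _ = _ := by ring
  have hrem : ∀ K, 0 < K → ∀ u ∈ T', ‖e.1 u - partialSum (PowerSeries.rescale (s : ℂ) e.2) (X' u)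
      (γ * K)‖ ≤ M * s * K.factorial * g' u ^ K := by
    intro K hK u hu
    have hg0 := gauge_nonneg hG' hu
    rw [partialSum_rescale, ← hX u hu]
    refine (h.rem K u (hT hu)).trans ?_
    rw [hg u hu, mul_pow, ← pow_mul]
    calc _ ≤ M * K.factorial * (s ^ 1 * g' u ^ K) := by
          gcongr ?_ * (?_ * ?_)
          exact pow_le_pow_of_le_one hs.le hs1 (Nat.mul_pos hγ hK)
      _ = _ := by ring
  refine ⟨h.diff.mono hT, fun m => (hcoef m).trans ?_, fun K u hu => ?_⟩
  · gcongr
    nlinarith [(Nat.cast_nonneg γ : (0 : ℝ) ≤ γ), mul_nonneg hM hs.le,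
      mul_nonneg (Nat.cast_nonneg γ : (0 : ℝ) ≤ γ) (mul_nonneg hM hs.le)]
  · have hg0 := gauge_nonneg hG' hu
    -- For `K ≥ 1` the gauge supplies the factor `s^(γ K) ≤ s`. For `K = 0` it supplies nothing, and
    -- smallness comes from the case `K = 1` together with the first `γ` coefficients, the constant
    -- one being `0`.
    rcases Nat.eq_zero_or_pos K with rfl | hK
    · have h1 := hrem 1 one_pos u hu
      have h2 : ‖partialSum (PowerSeries.rescale (s : ℂ) e.2) (X' u) (γ * 1)‖ ≤ γ * (M * s) := by
        rw [partialSum, mul_one]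
        calc _ ≤ ∑ m ∈ Finset.range γ, M * s := by
              refine norm_sum_le_of_le _ fun m hm => ?_
              rw [norm_mul, norm_pow]
              have := hcoef m
              rw [Nat.div_eq_of_lt (Finset.mem_range.1 hm)] at this
              simp only [Nat.factorial_zero, Nat.cast_one, mul_one] at this
              calc _ ≤ M * s * 1 := by
                    gcongr
                    exact pow_le_one₀ (norm_nonneg _) (norm_X_le_one hG' hu)
                _ = _ := mul_one _
          _ = _ := by simp
      have h3 : g' u ≤ 1 := hG'.le_one u hu
      have h4 := norm_add_le_of_le h1 h2
      rw [sub_add_cancel] at h4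
      simp only [Nat.factorial_one, Nat.cast_one, mul_one, pow_one] at h4
      simp only [mul_zero, partialSum, Finset.range_zero, Finset.sum_empty, sub_zero,
        Nat.factorial_zero, Nat.cast_one, mul_one, pow_zero]
      refine h4.trans ?_
      have : M * s * g' u ≤ M * s * 1 := by gcongr
      linarith
    · refine (hrem K hK u hu).trans ?_
      gcongr
      nlinarith [(Nat.cast_nonneg γ : (0 : ℝ) ≤ γ), mul_nonneg hM hs.le,
        mul_nonneg (Nat.cast_nonneg γ : (0 : ℝ) ≤ γ) (mul_nonneg hM hs.le)]

end GevreyBound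

/-! ### Holomorphic parameter integrals. -/

section Integrals

open MeasureTheory Metric

/-- Differentiation of an integral depending holomorphically on a parameter. -/
theorem hasDerivAt_integral_of_differentiableOn {μ : Measure ℝ} {F : ℂ → ℝ → ℂ} {F' : ℝ → ℂ}
    {z : ℂ} {δ : ℝ} (hδ : 0 < δ) {b : ℝ → ℝ} (hb : Integrable b μ)
    (hmeas : ∀ x ∈ ball z δ, AEStronglyMeasurable (F x) μ)
    (hmeas' : AEStronglyMeasurable F' μ)
    (hF' : ∀ᵐ s ∂μ, HasDerivAt (fun x => F x s) (F' s) z)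
    (hF : ∀ᵐ s ∂μ, DifferentiableOn ℂ (fun x => F x s) (ball z δ))
    (hbound : ∀ᵐ s ∂μ, ∀ x ∈ ball z δ, ‖F x s‖ ≤ b s) :
    Integrable F' μ ∧ HasDerivAt (fun x => ∫ s, F x s ∂μ) (∫ s, F' s ∂μ) z := by
  have hz : z ∈ ball z δ := mem_ball_self hδ
  have hmeas'' : AEStronglyMeasurable (fun s => deriv (fun x => F x s) z) μ :=
    hmeas'.congr (hF'.mono fun s hs => hs.deriv.symm)
  -- Cauchy's estimate on circles of radius `δ / 4` centred in the ball of radius `δ / 2` turns the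
  -- bound on `F` into one on its derivative.
  have key := hasDerivAt_integral_of_dominated_loc_of_deriv_le (μ := μ) (F := F)
    (F' := fun x s => deriv (fun y => F y s) x) (x₀ := z) (s := ball z (δ / 2))
    (bound := fun s => b s / (δ / 4)) (ball_mem_nhds z (by positivity))
    (by filter_upwards [ball_mem_nhds z hδ] with x hx using hmeas x hx)
    (hb.mono' (hmeas z hz) (hbound.mono fun s hs => hs z hz)) hmeas''
    ?_ (hb.div_const _) ?_
  · refine ⟨key.1.congr (hF'.mono fun s hs => hs.deriv), ?_⟩
    have : ∫ s, F' s ∂μ = ∫ s, deriv (fun x => F x s) z ∂μ :=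
      integral_congr_ae (hF'.mono fun s hs => hs.deriv.symm)
    rw [this]
    exact key.2
  · filter_upwards [hF, hbound] with s hs hs' x hx
    have hsub : closedBall x (δ / 4) ⊆ ball z δ := by
      intro y hy
      rw [mem_closedBall] at hy
      rw [mem_ball] at hx ⊢
      linarith [dist_triangle y x z]
    refine Complex.norm_deriv_le_of_forall_mem_sphere_norm_le (by positivity) ?_ fun y hy =>
      hs' y (hsub (sphere_subset_closedBall hy))
    exact (hs.mono (closure_ball_subset_closedBall.trans hsub)).diffContOnCl
  · filter_upwards [hF] with s hs x hx
    exact (hs.differentiableAt (isOpen_ball.mem_nhds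
      (ball_subset_ball (by linarith) hx))).hasDerivAt

end Integrals

/-! ### The linear equation `y' = -ν y - f` along a ray of decay. -/

section Rays

open MeasureTheory Metric Filter

/-- Along the ray, `exp(ν w s) v` has derivative `-exp(ν w s) w h`. Boundedness of `v` only serves
to kill the term at infinity, so `B` is absent from the conclusion. No initial condition is needed,
and the bound serves for Gevrey remainders as well as for uniqueness. -/
theorem ray_bound {v h : ℂ → ℂ} {u w ν : ℂ} {c₀ B H : ℝ} (hc : 0 < c₀)
    (hre : (ν * w).re ≤ -c₀) (hw : ‖w‖ = 1)
    (hv : ∀ s : ℝ, 0 ≤ s → HasDerivAt v (-ν * v (u + s * w) - h (u + s * w)) (u + s * w))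
    (hB : ∀ s : ℝ, 0 ≤ s → ‖v (u + s * w)‖ ≤ B) (hH : ∀ s : ℝ, 0 ≤ s → ‖h (u + s * w)‖ ≤ H) :
    ‖v u‖ ≤ H / c₀ := by
  set φ : ℝ → ℂ := fun s => Complex.exp (ν * w * s) * v (u + s * w) with hφ
  have hH0 : 0 ≤ H := (norm_nonneg _).trans (hH 0 le_rfl)
  have hexp : ∀ s : ℝ, 0 ≤ s → ‖Complex.exp (ν * w * s)‖ ≤ Real.exp (-c₀ * s) := by
    intro s hs
    rw [Complex.norm_exp, Complex.re_mul_ofReal]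
    gcongr
  have hd : ∀ s : ℝ, 0 ≤ s → HasDerivAt φ (-Complex.exp (ν * w * s) * w * h (u + s * w)) s := by
    intro s hs
    have h1 : HasDerivAt (fun s : ℝ => Complex.exp (ν * w * s))
        (Complex.exp (ν * w * s) * (ν * w)) s := by
      have := ((hasDerivAt_id (s : ℂ)).const_mul (ν * w)).cexp.comp_ofReal
      simpa using this
    have h2 : HasDerivAt (fun s : ℝ => v (u + s * w))
        ((-ν * v (u + s * w) - h (u + s * w)) * w) s := by
      have h3 : HasDerivAt (fun s : ℂ => u + s * w) w (s : ℂ) := by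
        simpa using ((hasDerivAt_id (s : ℂ)).mul_const w).const_add u
      exact (HasDerivAt.comp (s : ℂ) (hv s hs) h3).comp_ofReal
    refine (h1.mul h2).congr_deriv ?_
    ring
  have hdiff : ∀ S : ℝ, 0 ≤ S → ‖φ S - φ 0‖ ≤ H / c₀ * (1 - Real.exp (-c₀ * S)) := by
    intro S hS
    have hBd : ∀ x : ℝ, HasDerivAt (fun x => H / c₀ * (1 - Real.exp (-c₀ * x)))
        (H * Real.exp (-c₀ * x)) x := by
      intro x
      have := ((((hasDerivAt_id x).const_mul (-c₀)).exp).const_sub 1).const_mul (H / c₀)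
      refine this.congr_deriv ?_
      simp only [id]
      field_simp
    refine image_norm_le_of_norm_deriv_right_le_deriv_boundary (a := 0) (b := S)
      (f := fun s => φ s - φ 0) (f' := fun s => -Complex.exp (ν * w * s) * w * h (u + s * w))
      ?_ ?_ ?_ hBd ?_ ⟨hS, le_rfl⟩
    · exact fun s hs => ((hd s hs.1).continuousAt.sub continuousAt_const).continuousWithinAt
    · exact fun s hs => ((hd s hs.1).sub_const _).hasDerivWithinAt
    · simp
    · intro s hs
      rw [norm_mul, norm_mul, norm_neg, hw, mul_one, mul_comm]
      exact mul_le_mul (hH s hs.1) (hexp s hs.1) (norm_nonneg _) hH0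
  have hlim : Tendsto (fun S : ℝ => H / c₀ + Real.exp (-c₀ * S) * B) atTop
      (nhds (H / c₀ + 0 * B)) := by
    refine tendsto_const_nhds.add (Tendsto.mul_const _ ?_)
    refine Real.tendsto_exp_atBot.comp ?_
    exact (tendsto_id (α := ℝ)).const_mul_atTop_of_neg (by linarith)
  rw [zero_mul, add_zero] at hlim
  refine ge_of_tendsto hlim ?_
  filter_upwards [eventually_ge_atTop 0] with S hS
  have e0 : φ 0 = v u := by simp [hφ]
  have h1 := hdiff S hS
  rw [e0] at h1
  have h2 : ‖φ S‖ ≤ Real.exp (-c₀ * S) * B := by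
    rw [hφ, norm_mul]
    exact mul_le_mul (hexp S hS) (hB S hS) (norm_nonneg _) (Real.exp_pos _).le
  have h3 : ‖v u‖ ≤ ‖φ S - v u‖ + ‖φ S‖ := by
    have := norm_sub_norm_le (v u) (φ S)
    rw [norm_sub_rev] at this; linarith
  have h4 : H / c₀ * (1 - Real.exp (-c₀ * S)) ≤ H / c₀ := by
    have := (Real.exp_pos (-c₀ * S)).le
    have h5 : 0 ≤ H / c₀ := by positivity
    nlinarith
  linarith

/-- Bounded solutions of `y' = -ν y - f` on a region stable under translations along `w`. -/
theorem exists_bounded_solution {T : Set ℂ} (hT : IsOpen T) {w ν : ℂ} {c₀ M : ℝ} (hc : 0 < c₀)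
    (hre : (ν * w).re ≤ -c₀) (hw : ‖w‖ = 1)
    (hTw : ∀ u ∈ T, ∀ s : ℝ, 0 ≤ s → u + s * w ∈ T) {f : ℂ → ℂ} (hf : DifferentiableOn ℂ f T)
    (hM : ∀ u ∈ T, ‖f u‖ ≤ M) :
    ∃ y : ℂ → ℂ, (∀ u ∈ T, y u = ∫ s : ℝ in Set.Ioi 0, Complex.exp (ν * w * s) * f (u + s * w) * w) ∧
      (∀ u ∈ T, HasDerivAt y (-ν * y u - f u) u) ∧ ∀ u ∈ T, ‖y u‖ ≤ M / c₀ := by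
  have hexp : ∀ s : ℝ, 0 ≤ s → ‖Complex.exp (ν * w * s)‖ ≤ Real.exp (-c₀ * s) := by
    intro s hs
    rw [Complex.norm_exp, Complex.re_mul_ofReal]
    gcongr
  have hray : ∀ u, Continuous fun s : ℝ => u + s * w := fun u => by fun_prop
  have hfc : ∀ u ∈ T, ContinuousOn (fun s : ℝ => f (u + s * w)) (Set.Ici 0) := fun u hu =>
    hf.continuousOn.comp (hray u).continuousOn fun s hs => hTw u hu s hs
  have hf'c : ∀ u ∈ T, ContinuousOn (fun s : ℝ => deriv f (u + s * w)) (Set.Ici 0) := fun u hu =>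
    (hf.deriv hT).continuousOn.comp (hray u).continuousOn fun s hs => hTw u hu s hs
  have hec : Continuous fun s : ℝ => Complex.exp (ν * w * s) := by fun_prop
  have hint : IntegrableOn (fun s : ℝ => M * Real.exp (-c₀ * s)) (Set.Ioi 0) :=
    (integrableOn_exp_mul_Ioi (by linarith) 0).const_mul M
  have hint0 : IntegrableOn (fun s : ℝ => Real.exp (-c₀ * s)) (Set.Ioi 0) :=
    integrableOn_exp_mul_Ioi (by linarith) 0
  refine ⟨fun u => ∫ s : ℝ in Set.Ioi 0, Complex.exp (ν * w * s) * f (u + s * w) * w,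
    fun u _ => rfl, fun u hu => ?_, fun u hu => ?_⟩
  · obtain ⟨δ, hδ, hball⟩ := Metric.isOpen_iff.1 hT u hu
    have hbs : ∀ s : ℝ, 0 ≤ s → ∀ x ∈ ball u δ, ‖Complex.exp (ν * w * s) * f (x + s * w) * w‖ ≤
        M * Real.exp (-c₀ * s) := by
      intro s hs x hx
      rw [norm_mul, norm_mul, hw, mul_one, mul_comm]
      exact mul_le_mul (hM _ (hTw x (hball hx) s hs)) (hexp s hs) (norm_nonneg _)
        ((norm_nonneg _).trans (hM u hu))
    have hder : ∀ x ∈ T, ∀ s : ℝ, 0 ≤ s → HasDerivAt f (deriv f (x + s * w)) (x + s * w) :=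
      fun x hx s hs => (hf.differentiableAt (hT.mem_nhds (hTw x hx s hs))).hasDerivAt
    have hder' : ∀ x ∈ T, ∀ s : ℝ, 0 ≤ s →
        HasDerivAt (fun x => Complex.exp (ν * w * s) * f (x + s * w) * w)
          (Complex.exp (ν * w * s) * deriv f (x + s * w) * w) x := fun x hx s hs =>
      (((hder x hx s hs).comp_add_const x (s * w)).const_mul _).mul_const _
    have key := hasDerivAt_integral_of_differentiableOn (μ := volume.restrict (Set.Ioi 0)) hδ
      (F := fun x s => Complex.exp (ν * w * s) * f (x + s * w) * w)
      (F' := fun s => Complex.exp (ν * w * s) * deriv f (u + s * w) * w) hint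
      (fun x hx => ((hec.continuousOn.mul ((hfc x (hball hx)).mono Set.Ioi_subset_Ici_self)).mul
        continuousOn_const).aestronglyMeasurable measurableSet_Ioi)
      (((hec.continuousOn.mul ((hf'c u hu).mono Set.Ioi_subset_Ici_self)).mul
        continuousOn_const).aestronglyMeasurable measurableSet_Ioi)
      (by
        filter_upwards [ae_restrict_mem measurableSet_Ioi] with s hs
        exact hder' u hu s (le_of_lt hs))
      (by
        filter_upwards [ae_restrict_mem measurableSet_Ioi] with s hs x hx
        exact (hder' x (hball hx) s (le_of_lt hs)).differentiableAt.differentiableWithinAt)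
      (by
        filter_upwards [ae_restrict_mem measurableSet_Ioi] with s hs x hx
        exact hbs s (le_of_lt hs) x hx)
    have hyint : IntegrableOn (fun s : ℝ => Complex.exp (ν * w * s) * f (u + s * w) * w)
        (Set.Ioi 0) := by
      refine Integrable.mono' hint (((hec.continuousOn.mul ((hfc u hu).mono
        Set.Ioi_subset_Ici_self)).mul continuousOn_const).aestronglyMeasurable measurableSet_Ioi) ?_
      filter_upwards [ae_restrict_mem measurableSet_Ioi] with s hs
      exact hbs s (le_of_lt hs) u (mem_ball_self hδ)
    -- Integration of the derivative of `exp(ν w s) f(u + s w)` over the ray: this turns the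
    -- integral with `f'`, obtained by differentiating under the sign, into `-ν y - f`.
    have hftc : ∫ s in Set.Ioi (0 : ℝ), (ν * (Complex.exp (ν * w * s) * f (u + s * w) * w) +
        Complex.exp (ν * w * s) * deriv f (u + s * w) * w) = 0 - Complex.exp (ν * w * (0 : ℝ)) *
          f (u + (0 : ℝ) * w) := by
      refine integral_Ioi_of_hasDerivAt_of_tendsto'
        (f := fun s : ℝ => Complex.exp (ν * w * s) * f (u + s * w)) (fun s hs => ?_)
        ((hyint.const_mul ν).add key.1) ?_
      · have h1 : HasDerivAt (fun s : ℝ => Complex.exp (ν * w * s))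
            (Complex.exp (ν * w * s) * (ν * w)) s := by
          have := ((hasDerivAt_id (s : ℂ)).const_mul (ν * w)).cexp.comp_ofReal
          simpa using this
        have h2 : HasDerivAt (fun s : ℝ => f (u + s * w)) (deriv f (u + s * w) * w) s := by
          have h3 : HasDerivAt (fun s : ℂ => u + s * w) w (s : ℂ) := by
            simpa using ((hasDerivAt_id (s : ℂ)).mul_const w).const_add u
          exact (HasDerivAt.comp (s : ℂ) (hder u hu s hs) h3).comp_ofReal
        refine (h1.mul h2).congr_deriv ?_
        ring
      · refine squeeze_zero_norm' (a := fun s => M * Real.exp (-c₀ * s)) ?_ ?_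
        · filter_upwards [eventually_ge_atTop 0] with s hs
          rw [norm_mul, mul_comm]
          exact mul_le_mul (hM _ (hTw u hu s hs)) (hexp s hs) (norm_nonneg _)
            ((norm_nonneg _).trans (hM u hu))
        · rw [← mul_zero M]
          refine Tendsto.const_mul _ (Real.tendsto_exp_atBot.comp ?_)
          exact (tendsto_id (α := ℝ)).const_mul_atTop_of_neg (by linarith)
    rw [integral_add (hyint.const_mul ν) key.1, integral_const_mul] at hftc
    have e : -ν * (∫ s : ℝ in Set.Ioi 0, Complex.exp (ν * w * s) * f (u + s * w) * w) - f u =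
        ∫ s in Set.Ioi (0 : ℝ), Complex.exp (ν * w * s) * deriv f (u + s * w) * w := by
      simp only [Complex.ofReal_zero, mul_zero, Complex.exp_zero, zero_mul, add_zero, one_mul,
        zero_sub] at hftc
      linear_combination -hftc
    rw [e]
    exact key.2
  · have h1 : ∫ s in Set.Ioi (0 : ℝ), M * Real.exp (-c₀ * s) = M / c₀ := by
      rw [integral_const_mul, integral_exp_mul_Ioi (by linarith)]
      simp; field_simp
    rw [← h1]
    refine norm_integral_le_of_norm_le hint ?_
    filter_upwards [ae_restrict_mem measurableSet_Ioi] with s hs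
    rw [norm_mul, norm_mul, hw, mul_one, mul_comm]
    exact mul_le_mul (hM _ (hTw u hu s (le_of_lt hs))) (hexp s (le_of_lt hs)) (norm_nonneg _)
      ((norm_nonneg _).trans (hM u hu))

end Rays

/-! ### Gevrey bounds for solutions of the linear equation, and the contraction principle. -/

/-- The coefficients of the formal solution of `x ^ (γ + 1) y' = μ y + f`, up to normalization. -/
noncomputable def formalSolution (γ : ℕ) (η ν : ℂ) (a : ℕ → ℂ) : ℕ → ℂ
  | m => if _h : 0 < γ ∧ γ ≤ m then
      (η * ((m - γ : ℕ) : ℂ) * formalSolution γ η ν a (m - γ) - a m) / ν else -a m / ν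
decreasing_by omega

/-- This is the coefficient of `X^m` in `y' = -ν y - f`, since `X' = -η X^(γ+1)` sends `b X^m` to
`-η m b X^(m+γ)`. -/
theorem formalSolution_spec {γ : ℕ} (hγ : 0 < γ) {η ν : ℂ} (hν : ν ≠ 0) (a : ℕ → ℂ) (m : ℕ) :
    ν * formalSolution γ η ν a m + a m =
      if γ ≤ m then η * ((m - γ : ℕ) : ℂ) * formalSolution γ η ν a (m - γ) else 0 := by
  rw [formalSolution]
  by_cases h : γ ≤ m
  · rw [dif_pos ⟨hγ, h⟩, if_pos h, mul_div_cancel₀ _ hν]; ring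
  · rw [dif_neg (fun h' => h h'.2), if_neg h, mul_div_cancel₀ _ hν]; ring

/-- A direction `w` along which the equation `y' = -ν y - f` is solved by integration: the region
`T` is stable and the gauge `g` does not increase. -/
structure IsDecayDirection (T : Set ℂ) (g : ℂ → ℝ) (c₀ : ℝ) (ν w : ℂ) : Prop where
  pos : 0 < c₀
  re_le : (ν * w).re ≤ -c₀
  norm_eq : ‖w‖ = 1
  mem : ∀ u ∈ T, ∀ s : ℝ, 0 ≤ s → u + s * w ∈ T
  gauge_le : ∀ u ∈ T, ∀ s : ℝ, 0 ≤ s → g (u + s * w) ≤ g u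

theorem IsDecayDirection.le_norm {T : Set ℂ} {g : ℂ → ℝ} {c₀ : ℝ} {ν w : ℂ}
    (h : IsDecayDirection T g c₀ ν w) : c₀ ≤ ‖ν‖ := by
  have h1 := Complex.abs_re_le_norm (ν * w)
  rw [norm_mul, h.norm_eq, mul_one] at h1
  have := neg_abs_le (ν * w).re
  linarith [h.re_le]

namespace GevreyBound

variable {γ : ℕ} {T : Set ℂ} {X : ℂ → ℂ} {g : ℂ → ℝ} {e y : (ℂ → ℂ) × PowerSeries ℂ} {M : ℝ}

theorem hasDerivAt_partialSum {η : ℂ} {u : ℂ} (hX : HasDerivAt X (-η * X u ^ (γ + 1)) u)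
    (B : PowerSeries ℂ) (N : ℕ) :
    HasDerivAt (fun u => partialSum B (X u) N)
      (-η * ∑ m ∈ Finset.range N, m * PowerSeries.coeff m B * X u ^ (m + γ)) u := by
  have : ∀ m ∈ Finset.range N, HasDerivAt (fun u => PowerSeries.coeff m B * X u ^ m)
      (-η * (m * PowerSeries.coeff m B * X u ^ (m + γ))) u := by
    intro m _
    refine ((hX.pow m).const_mul (PowerSeries.coeff m B)).congr_deriv ?_
    rcases m with _ | m
    · simp
    · rw [Nat.add_sub_cancel, show m + 1 + γ = m + (γ + 1) by ring, pow_add]; ring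
  have h := HasDerivAt.fun_sum this
  rw [← Finset.mul_sum] at h
  exact h

/-- On the formal side, the recursion multiplies by at most `‖η‖ γ (m / γ)`; the integer `m / γ` is
absorbed by the factorial and `‖η‖ γ ≤ ‖ν‖ / 2` closes the induction. On the analytic side, `y`
minus its partial sum is a bounded solution of the same equation with source the remainder of `e`
minus a tail of `γ` terms. As the gauge does not increase along the ray, `ray_bound` bounds it by
the value of the gauge at `u`. -/
theorem of_solution (hG : IsGauge γ T X g) {η ν w : ℂ} {c₀ : ℝ}
    (hX : ∀ u ∈ T, HasDerivAt X (-η * X u ^ (γ + 1)) u) (hη : ‖η‖ * γ ≤ ‖ν‖ / 2)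
    (hw : IsDecayDirection T g c₀ ν w) (he : GevreyBound γ T X g e M)
    (hy : ∀ u ∈ T, HasDerivAt y.1 (-ν * y.1 u - e.1 u) u) (hyB : ∃ B, ∀ u ∈ T, ‖y.1 u‖ ≤ B)
    (hb : ∀ m, ν * PowerSeries.coeff m y.2 + PowerSeries.coeff m e.2 =
      if γ ≤ m then η * ((m - γ : ℕ) : ℂ) * PowerSeries.coeff (m - γ) y.2 else 0) :
    GevreyBound γ T X g y (2 * (1 + γ) / c₀ * M) := by
  have hγ := hG.pos
  have hM := he.nonneg
  have hc := hw.pos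
  have hν : 0 < ‖ν‖ := hc.trans_le hw.le_norm
  have hcoeff : ∀ m, ‖PowerSeries.coeff m y.2‖ ≤ 2 * M / ‖ν‖ * (m / γ).factorial := by
    intro m
    induction m using Nat.strong_induction_on with
    | _ m ih =>
      have h1 : ‖ν‖ * ‖PowerSeries.coeff m y.2‖ ≤ 2 * M * (m / γ).factorial := by
        rw [← norm_mul, eq_sub_of_add_eq (hb m)]
        split_ifs with hm
        · have h2 := ih (m - γ) (by omega)
          have hk : m / γ = (m - γ) / γ + 1 := by
            rw [← Nat.add_div_right _ hγ, Nat.sub_add_cancel hm]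
          have h3 : ((m - γ : ℕ) : ℝ) ≤ γ * ((m - γ) / γ + 1 : ℕ) := by
            exact_mod_cast (Nat.lt_mul_div_succ (m - γ) hγ).le
          calc _ ≤ ‖η * ((m - γ : ℕ) : ℂ) * PowerSeries.coeff (m - γ) y.2‖ +
                ‖PowerSeries.coeff m e.2‖ := norm_sub_le _ _
            _ ≤ ‖η‖ * (γ * ((m - γ) / γ + 1 : ℕ)) * (2 * M / ‖ν‖ * ((m - γ) / γ).factorial) +
                M * (m / γ).factorial := by
                rw [norm_mul, norm_mul, Complex.norm_natCast]
                gcongr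
                exact he.coeff m
            _ = ‖η‖ * γ * (2 * M / ‖ν‖) * (m / γ).factorial + M * (m / γ).factorial := by
                rw [hk, Nat.factorial_succ]; push_cast; ring
            _ ≤ ‖ν‖ / 2 * (2 * M / ‖ν‖) * (m / γ).factorial + M * (m / γ).factorial := by
                gcongr
            _ = _ := by field_simp; ring
        · rw [zero_sub, norm_neg]
          have := he.coeff m
          have h4 : 0 ≤ M * (m / γ).factorial := by positivity
          linarith
      rw [div_mul_eq_mul_div, le_div_iff₀ hν]
      linarith
  refine ⟨fun u hu => (hy u hu).differentiableAt.differentiableWithinAt, fun m => ?_,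
    fun K u hu => ?_⟩
  · refine (hcoeff m).trans ?_
    have h1 : 2 * M / ‖ν‖ ≤ 2 * M / c₀ := by
      have := hw.le_norm
      gcongr
    have h2 : 2 * M / c₀ ≤ 2 * (1 + γ) / c₀ * M := by
      rw [div_mul_eq_mul_div]
      gcongr
      nlinarith [(Nat.cast_nonneg γ : (0 : ℝ) ≤ γ)]
    gcongr
    exact h1.trans h2
  · obtain ⟨B, hB⟩ := hyB
    have hg := gauge_nonneg hG hu
    have hXd := fun s (hs : 0 ≤ s) => hasDerivAt_partialSum (hX _ (hw.mem u hu s hs)) y.2 (γ * K)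
    -- The derivative of the partial sum overshoots the order `γ K` by its last `γ` terms. For `K =
    -- 0` the truncated subtraction makes the interval empty, as it should be.
    set tail : ℂ → ℂ := fun z => η * ∑ m ∈ Finset.Ico (γ * (K - 1)) (γ * K),
      m * PowerSeries.coeff m y.2 * X z ^ (m + γ) with htail
    have hident : ∀ z : ℂ, ν * partialSum y.2 (X z) (γ * K) + partialSum e.2 (X z) (γ * K) =
        η * (∑ m ∈ Finset.range (γ * K), m * PowerSeries.coeff m y.2 * X z ^ (m + γ)) - tail z := by
      intro z
      rcases K with _ | K
      · simp [partialSum, htail]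
      have e1 : ν * partialSum y.2 (X z) (γ * (K + 1)) + partialSum e.2 (X z) (γ * (K + 1)) =
          ∑ m ∈ Finset.range (γ * (K + 1)), (if γ ≤ m then η * ((m - γ : ℕ) : ℂ) *
            PowerSeries.coeff (m - γ) y.2 else 0) * X z ^ m := by
        rw [partialSum, partialSum, Finset.mul_sum, ← Finset.sum_add_distrib]
        exact Finset.sum_congr rfl fun m _ => by rw [← hb m]; ring
      have e2 : γ * (K + 1) = γ + γ * K := by ring
      rw [e1, e2, Finset.sum_range_add, Finset.sum_eq_zero, zero_add, htail]
      · have e3 : γ + γ * K = γ * (K + 1) := by ring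
        simp only [Nat.add_sub_cancel]
        rw [e3, ← Finset.sum_range_add_sum_Ico _ (Nat.mul_le_mul_left γ (Nat.le_succ K)), mul_add,
          add_sub_cancel_right, Finset.mul_sum]
        refine Finset.sum_congr rfl fun m _ => ?_
        rw [if_pos (Nat.le_add_right γ m), Nat.add_sub_cancel_left, add_comm γ m]; ring
      · intro m hm
        rw [if_neg (by have := Finset.mem_range.1 hm; omega), zero_mul]
    have htailb : ∀ z ∈ T, ‖tail z‖ ≤ γ * M * K.factorial * g z ^ K := by
      intro z hz
      have hgz := gauge_nonneg hG hz
      rcases K with _ | K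
      · simp [htail]; positivity
      rw [htail, norm_mul]
      simp only [Nat.add_sub_cancel]
      have : ‖∑ m ∈ Finset.Ico (γ * K) (γ * (K + 1)), m * PowerSeries.coeff m y.2 *
          X z ^ (m + γ)‖ ≤ γ * (γ * (K + 1 : ℕ) * (2 * M / ‖ν‖ * K.factorial) * g z ^ (K + 1)) := by
        calc _ ≤ ∑ m ∈ Finset.Ico (γ * K) (γ * (K + 1)),
              (γ * (K + 1 : ℕ) * (2 * M / ‖ν‖ * K.factorial) * g z ^ (K + 1)) := by
              refine norm_sum_le_of_le _ fun m hm => ?_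
              obtain ⟨hm1, hm2⟩ := Finset.mem_Ico.1 hm
              have hd : m / γ = K := by
                rw [Nat.div_eq_iff hγ]; rw [mul_comm] at hm1
                constructor
                · exact hm1
                · have : γ * (K + 1) = K * γ + γ := by ring
                  omega
              have hm3 : (m : ℝ) ≤ γ * (K + 1 : ℕ) := by exact_mod_cast hm2.le
              have := hcoeff m
              rw [hd] at this
              rw [norm_mul, norm_mul, norm_pow, Complex.norm_natCast]
              gcongr
              exact norm_X_pow_le hG hz (by linarith [Nat.mul_succ γ K])
          _ = _ := by
              rw [Finset.sum_const, Nat.card_Ico, nsmul_eq_mul,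
                show γ * (K + 1) - γ * K = γ by rw [Nat.mul_succ]; omega]
      calc _ ≤ ‖η‖ * (γ * (γ * (K + 1 : ℕ) * (2 * M / ‖ν‖ * K.factorial) * g z ^ (K + 1))) := by
            gcongr
        _ = (‖η‖ * γ) * (γ * (2 * M / ‖ν‖) * (K + 1).factorial * g z ^ (K + 1)) := by
            rw [Nat.factorial_succ]; push_cast; ring
        _ ≤ (‖ν‖ / 2) * (γ * (2 * M / ‖ν‖) * (K + 1).factorial * g z ^ (K + 1)) := by
            gcongr
        _ = _ := by field_simp
    have hray := ray_bound (v := fun z => y.1 z - partialSum y.2 (X z) (γ * K))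
      (h := fun z => (e.1 z - partialSum e.2 (X z) (γ * K)) - tail z) (u := u) hc hw.re_le
      hw.norm_eq (B := B + ∑ m ∈ Finset.range (γ * K), ‖PowerSeries.coeff m y.2‖)
      (H := (1 + γ) * M * K.factorial * g u ^ K) ?_ ?_ ?_
    · refine hray.trans ?_
      have h0 : 0 ≤ (1 + γ) * M * K.factorial * g u ^ K := by positivity
      rw [div_mul_eq_mul_div, div_mul_eq_mul_div, div_mul_eq_mul_div]
      gcongr
      linarith
    · intro s hs
      refine ((hy _ (hw.mem u hu s hs)).sub (hXd s hs)).congr_deriv ?_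
      have := hident (u + s * w)
      linear_combination -this
    · intro s hs
      have hz := hw.mem u hu s hs
      refine norm_sub_le_of_le (hB _ hz) (norm_sum_le_of_le _ fun m _ => ?_)
      rw [norm_mul, norm_pow]
      exact mul_le_of_le_one_right (norm_nonneg _) (pow_le_one₀ (norm_nonneg _) (norm_X_le_one hG hz))
    · intro s hs
      have hz := hw.mem u hu s hs
      have hgz := gauge_nonneg hG hz
      have hgu := hw.gauge_le u hu s hs
      calc _ ≤ M * K.factorial * g (u + s * w) ^ K + γ * M * K.factorial * g (u + s * w) ^ K :=
            norm_sub_le_of_le (he.rem K _ hz) (htailb _ hz)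
        _ = (1 + γ) * M * K.factorial * g (u + s * w) ^ K := by ring
        _ ≤ _ := by gcongr

/-- A contraction for the Gevrey norms has a fixed point. -/
theorem exists_fixedPoint {ι : Type*} (hG : IsGauge γ T X g)
    (Φ : (ι → (ℂ → ℂ) × PowerSeries ℂ) → ι → (ℂ → ℂ) × PowerSeries ℂ)
    (h1 : ∀ q, (∀ i, GevreyBound γ T X g (q i) 1) → ∀ i, GevreyBound γ T X g (Φ q i) (1 / 2))
    (h2 : ∀ q q' M, (∀ i, GevreyBound γ T X g (q i) 1) → (∀ i, GevreyBound γ T X g (q' i) 1) →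
      (∀ i, GevreyBound γ T X g (q i - q' i) M) →
      ∀ i, GevreyBound γ T X g (Φ q i - Φ q' i) (M / 2)) :
    ∃ q, (∀ i, GevreyBound γ T X g (q i) 1) ∧
      ∀ i, ∀ M > 0, GevreyBound γ T X g (q i - Φ q i) M := by
  set F : ℕ → ι → (ℂ → ℂ) × PowerSeries ℂ := fun k => Φ^[k] 0 with hF
  have hF0 : F 0 = 0 := rfl
  have hFs : ∀ k, F (k + 1) = Φ (F k) := fun k => Function.iterate_succ_apply' Φ k 0
  have hF1 : ∀ k i, GevreyBound γ T X g (F k i) 1 := by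
    intro k
    induction k with
    | zero => exact fun i => by simpa [hF0] using zero hG zero_le_one
    | succ k ih =>
      intro i
      rw [hFs]
      exact (h1 _ ih i).mono_const hG (by norm_num)
  have hstep : ∀ k i, GevreyBound γ T X g (F (k + 1) i - F k i) (1 / 2 / 2 ^ k) := by
    intro k
    induction k with
    | zero =>
      intro i
      rw [hFs, hF0, Pi.zero_apply, sub_zero, pow_zero, div_one]
      exact h1 0 (hF1 0) i
    | succ k ih =>
      intro i
      rw [hFs (k + 1), hFs k]
      have := h2 (F (k + 1)) (F k) _ (hF1 _) (hF1 _) ih i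
      rw [hFs] at this
      convert this using 1
      rw [pow_succ]; field_simp
  have hs : Summable fun k : ℕ => (1 : ℝ) / 2 / 2 ^ k := summable_geometric_two' 1
  have hlim := fun i => exists_limit hG (F := fun k => F k i) ⟨1, hF1 0 i⟩ hs (fun k => hstep k i)
  choose q hq _ using hlim
  have hq1 : ∀ i, GevreyBound γ T X g (q i) 1 := by
    intro i
    have := (hq i 0).neg
    simp only [hF0, Pi.zero_apply, zero_sub, neg_neg, add_zero] at this
    rwa [tsum_geometric_two' 1] at this
  refine ⟨q, hq1, fun i M hM => ?_⟩
  have ht : Filter.Tendsto (fun k => ∑' i, (1 : ℝ) / 2 / 2 ^ (i + k)) Filter.atTop (nhds 0) :=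
    tendsto_sum_nat_add fun k : ℕ => (1 : ℝ) / 2 / 2 ^ k
  have ht' := (Filter.tendsto_add_atTop_iff_nat 1).2 ht
  obtain ⟨k, hk, hk'⟩ := ((ht.eventually (gt_mem_nhds (half_pos hM))).and
    (ht'.eventually (gt_mem_nhds (half_pos hM)))).exists
  have a1 := h2 (F k) q _ (hF1 k) hq1 (fun i => hq i k) i
  rw [← hFs] at a1
  have a2 := a1.sub (hq i (k + 1))
  have hnn := a1.nonneg
  refine GevreyBound.mono_const (M := _) ?_ hG (show (∑' i, (1 : ℝ) / 2 / 2 ^ (i + k)) / 2 +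
    ∑' i, (1 : ℝ) / 2 / 2 ^ (i + (k + 1)) ≤ M by linarith)
  convert a2 using 1
  abel

theorem mulVec {ι : Type*} [Fintype ι] (hG : IsGauge γ T X g) {A : Matrix ι ι ((ℂ → ℂ) × PowerSeries ℂ)} {σ M : ℝ}
    (hA : ∀ i k, GevreyBound γ T X g (A i k) σ) {q : ι → (ℂ → ℂ) × PowerSeries ℂ}
    (hq : ∀ i, GevreyBound γ T X g (q i) M) (i : ι) :
    GevreyBound γ T X g ((A *ᵥ q) i) (Fintype.card ι * (mulConst γ * σ * M)) := by
  have := sum hG Finset.univ (fun k _ => mul hG (hA i k) (hq k))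
  simpa [Matrix.mulVec, dotProduct] using this

theorem single_add {ι : Type*} [DecidableEq ι] (hG : IsGauge γ T X g) (j : ι) {q : ι → (ℂ → ℂ) × PowerSeries ℂ}
    (hq : ∀ i, GevreyBound γ T X g (q i) 1) (i : ι) :
    GevreyBound γ T X g ((Pi.single j 1 + q : ι → (ℂ → ℂ) × PowerSeries ℂ) i) 2 := by
  have h1 : GevreyBound γ T X g ((Pi.single j 1 : ι → (ℂ → ℂ) × PowerSeries ℂ) i) 1 := by
    by_cases h : i = j
    · subst h; simpa using one hG
    · simpa [h] using zero hG zero_le_one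
  exact (h1.add (hq i)).mono_const hG (by norm_num)

end GevreyBound

/-! ### The Riccati system: existence with Gevrey bounds, and uniqueness. -/

section Riccati

variable {ι : Type*} [Fintype ι] [DecidableEq ι]

/-- The nonlinear part of the Riccati system satisfied by the `j`-th column of the transformation,
normalized to have `j`-th entry `1`. -/
def riccati {R : Type*} [CommRing R] [Module ℂ R] (τ : ℂ) (A : Matrix ι ι R) (j : ι)
    (q : ι → R) (i : ι) : R :=
  τ • ((A *ᵥ (Pi.single j 1 + q)) i - (A *ᵥ (Pi.single j 1 + q)) j * q i)

theorem riccati_sub {R : Type*} [CommRing R] [Module ℂ R] (τ : ℂ) (A : Matrix ι ι R) (j : ι)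
    (q q' : ι → R) (i : ι) :
    riccati τ A j q i - riccati τ A j q' i =
      τ • ((A *ᵥ (q - q')) i -
        ((A *ᵥ (Pi.single j 1 + q)) j * (q i - q' i) + (A *ᵥ (q - q')) j * q' i)) := by
  rw [riccati, riccati, ← smul_sub]
  congr 1
  simp only [Matrix.mulVec_sub, Matrix.mulVec_add, Pi.add_apply, Pi.sub_apply]
  ring

theorem riccati_fst (τ : ℂ) (A : Matrix ι ι ((ℂ → ℂ) × PowerSeries ℂ)) (j : ι)
    (q : ι → (ℂ → ℂ) × PowerSeries ℂ) (i : ι) (u : ℂ) :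
    (riccati τ A j q i).1 u = riccati τ (A.map fun e => e.1 u) j (fun k => (q k).1 u) i := by
  have : ∀ i, ((A *ᵥ (Pi.single j 1 + q)) i).1 u =
      ((A.map fun e => e.1 u) *ᵥ (Pi.single j 1 + fun k => (q k).1 u)) i := by
    intro i
    simp only [Matrix.mulVec, dotProduct, Prod.fst_sum, Finset.sum_apply, Prod.fst_mul,
      Pi.mul_apply, Matrix.map_apply, Pi.add_apply, Prod.fst_add]
    refine Finset.sum_congr rfl fun k _ => ?_
    by_cases h : k = j
    · subst h; simp
    · simp [h]
  simp only [riccati, Prod.smul_fst, Pi.smul_apply, Prod.fst_sub, Pi.sub_apply, Prod.fst_mul,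
    Pi.mul_apply, this]

/-- In the recursion at `m = 0` this forces the constant terms of the solution to vanish. -/
theorem riccati_coeff_zero (τ : ℂ) {A : Matrix ι ι ((ℂ → ℂ) × PowerSeries ℂ)}
    (hA : ∀ i k, PowerSeries.coeff 0 (A i k).2 = 0) (j : ι)
    (q : ι → (ℂ → ℂ) × PowerSeries ℂ) (i : ι) :
    PowerSeries.coeff 0 (riccati τ A j q i).2 = 0 := by
  have h : ∀ (v : ι → (ℂ → ℂ) × PowerSeries ℂ) i, PowerSeries.coeff 0 ((A *ᵥ v) i).2 = 0 := by
    intro v i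
    simp only [PowerSeries.coeff_zero_eq_constantCoeff] at hA ⊢
    simp [Matrix.mulVec, dotProduct, Prod.snd_sum, hA]
  simp only [PowerSeries.coeff_zero_eq_constantCoeff] at h
  simp [riccati, h]

variable {γ : ℕ} {T : Set ℂ} {X : ℂ → ℂ} {g : ℂ → ℝ}

namespace GevreyBound

/-- A Lipschitz constant for the nonlinear part of the Riccati system. -/
noncomputable def riccatiConst (γ N : ℕ) (τ : ℂ) : ℝ := ‖τ‖ * (N * mulConst γ * (2 + 3 * mulConst γ))

/-- With `e_j + q` of norm at most `2`, the linear and quadratic terms give `2 + 2 κ` times `N κ σ`,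
where `κ = mulConst γ`. The larger coefficient `3` in `riccatiConst` is the one required by
`riccati_lipschitz`. -/
theorem riccati_bound (hG : IsGauge γ T X g) {A : Matrix ι ι ((ℂ → ℂ) × PowerSeries ℂ)} {σ : ℝ}
    (hA : ∀ i k, GevreyBound γ T X g (A i k) σ) (τ : ℂ) (j : ι)
    {q : ι → (ℂ → ℂ) × PowerSeries ℂ} (hq : ∀ i, GevreyBound γ T X g (q i) 1) (i : ι) :
    GevreyBound γ T X g (riccati τ A j q i) (riccatiConst γ (Fintype.card ι) τ * σ) := by
  have hσ := (hA j j).nonneg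
  have hκ := mulConst_nonneg γ
  have h1 := mulVec hG hA (single_add hG j hq)
  refine (((h1 i).sub (mul hG (h1 j) (hq i))).smul τ).mono_const hG ?_
  rw [riccatiConst, mul_assoc ‖τ‖]
  gcongr
  have : 0 ≤ Fintype.card ι * mulConst γ * mulConst γ * σ := by positivity
  nlinarith

theorem riccati_lipschitz (hG : IsGauge γ T X g) {A : Matrix ι ι ((ℂ → ℂ) × PowerSeries ℂ)}
    {σ M : ℝ} (hA : ∀ i k, GevreyBound γ T X g (A i k) σ) (τ : ℂ) (j : ι)
    {q q' : ι → (ℂ → ℂ) × PowerSeries ℂ} (hq : ∀ i, GevreyBound γ T X g (q i) 1)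
    (hq' : ∀ i, GevreyBound γ T X g (q' i) 1) (hM : ∀ i, GevreyBound γ T X g (q i - q' i) M)
    (i : ι) :
    GevreyBound γ T X g (riccati τ A j q i - riccati τ A j q' i)
      (riccatiConst γ (Fintype.card ι) τ * σ * M) := by
  have hσ := (hA j j).nonneg
  have hM0 := (hM j).nonneg
  have hκ := mulConst_nonneg γ
  have h1 := mulVec hG hA (single_add hG j hq)
  have h2 := mulVec hG hA (q := q - q') hM
  rw [riccati_sub]
  refine (((h2 i).sub ((mul hG (h1 j) (hM i)).add (mul hG (h2 j) (hq' i)))).smul τ).mono_const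
    hG ?_
  rw [riccatiConst, mul_assoc ‖τ‖, mul_assoc ‖τ‖]
  gcongr
  have : 0 ≤ Fintype.card ι * mulConst γ * σ * M := by positivity
  nlinarith

/-- Fixed point of the map that inserts `q` in the nonlinear part and solves the resulting linear
equations. Its Lipschitz constant is that of `riccati_lipschitz` times the factor of `of_solution`;
`hσ` makes the product at most `1 / 2`. -/
theorem exists_riccati_solution (hG : IsGauge γ T X g) {η τ : ℂ} {c₀ σ : ℝ} (j : ι) {ν w : ι → ℂ}
    (hc₀ : 0 < c₀)
    (hX : ∀ u ∈ T, HasDerivAt X (-η * X u ^ (γ + 1)) u)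
    (hη : ∀ i, i ≠ j → ‖η‖ * γ ≤ ‖ν i‖ / 2)
    (hw : ∀ i, i ≠ j → IsDecayDirection T g c₀ (ν i) (w i))
    {A : Matrix ι ι ((ℂ → ℂ) × PowerSeries ℂ)} (hA : ∀ i k, GevreyBound γ T X g (A i k) σ)
    (hA0 : ∀ i k, PowerSeries.coeff 0 (A i k).2 = 0)
    (hσ : 2 * (1 + γ) / c₀ * (riccatiConst γ (Fintype.card ι) τ * σ) ≤ 1 / 2) :
    ∃ q : ι → (ℂ → ℂ) × PowerSeries ℂ, (∀ u, (q j).1 u = 0) ∧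
      (∀ i, PowerSeries.coeff 0 (q i).2 = 0) ∧
      (∀ i, GevreyBound γ T X g (q i) 1) ∧
      ∀ i, i ≠ j → ∀ u ∈ T, HasDerivAt (q i).1 (-ν i * (q i).1 u -
        riccati τ (A.map fun e => e.1 u) j (fun k => (q k).1 u) i) u := by
  classical
  -- The solver is made total, with value `0` on pairs without a Gevrey bound, so that it can be
  -- iterated as a plain function.
  have hsol : ∀ (e : (ℂ → ℂ) × PowerSeries ℂ) (i : ι), ∃ y : (ℂ → ℂ) × PowerSeries ℂ,
      (∃ M, GevreyBound γ T X g e M) → i ≠ j →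
      (∀ u ∈ T, HasDerivAt y.1 (-ν i * y.1 u - e.1 u) u) ∧ (∃ B, ∀ u ∈ T, ‖y.1 u‖ ≤ B) ∧
      ∀ m, ν i * PowerSeries.coeff m y.2 + PowerSeries.coeff m e.2 =
        if γ ≤ m then η * ((m - γ : ℕ) : ℂ) * PowerSeries.coeff (m - γ) y.2 else 0 := by
    intro e i
    by_cases h : (∃ M, GevreyBound γ T X g e M) ∧ i ≠ j
    · obtain ⟨⟨M, hM⟩, hi⟩ := h
      have hwi := hw i hi
      obtain ⟨y, _, hy1, hy2⟩ := exists_bounded_solution hG.isOpen hwi.pos hwi.re_le hwi.norm_eq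
        hwi.mem hM.diff fun u hu => hM.bound hu
      have hν : ν i ≠ 0 := norm_pos_iff.1 (hwi.pos.trans_le hwi.le_norm)
      refine ⟨(y, PowerSeries.mk (formalSolution γ η (ν i) fun m => PowerSeries.coeff m e.2)),
        fun _ _ => ⟨hy1, ⟨_, hy2⟩, fun m => ?_⟩⟩
      simp only [PowerSeries.coeff_mk]
      exact formalSolution_spec hG.pos hν _ m
    · exact ⟨0, fun h1 h2 => absurd ⟨h1, h2⟩ h⟩
  choose S hS using hsol
  set Φ : (ι → (ℂ → ℂ) × PowerSeries ℂ) → ι → (ℂ → ℂ) × PowerSeries ℂ :=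
    fun q i => if i = j then 0 else S (riccati τ A j q i) i with hΦ
  have hΦi : ∀ q i, i ≠ j → Φ q i = S (riccati τ A j q i) i := fun q i h => if_neg h
  have hC : 0 ≤ 2 * (1 + γ) / c₀ := by positivity
  obtain ⟨q, hq1, hq⟩ := exists_fixedPoint hG Φ (fun q hq i => by
      by_cases h : i = j
      · simpa [hΦ, h] using zero hG (by norm_num : (0 : ℝ) ≤ 2⁻¹)
      · rw [hΦi q i h]
        have hb := riccati_bound hG hA τ j hq i
        obtain ⟨s1, s2, s3⟩ := hS (riccati τ A j q i) i ⟨_, hb⟩ h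
        exact (of_solution hG hX (hη i h) (hw i h) hb s1 s2 s3).mono_const hG hσ)
    (fun q q' M hq hq' hM i => by
      have hM0 := (hM i).nonneg
      by_cases h : i = j
      · simpa [hΦ, h] using zero hG (by positivity : (0 : ℝ) ≤ M / 2)
      · rw [hΦi q i h, hΦi q' i h]
        have hb := riccati_bound hG hA τ j hq i
        have hb' := riccati_bound hG hA τ j hq' i
        obtain ⟨s1, s2, s3⟩ := hS (riccati τ A j q i) i ⟨_, hb⟩ h
        obtain ⟨s1', s2', s3'⟩ := hS (riccati τ A j q' i) i ⟨_, hb'⟩ h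
        refine (of_solution hG hX (hη i h) (hw i h) (riccati_lipschitz hG hA τ j hq hq' hM i)
          (y := S (riccati τ A j q i) i - S (riccati τ A j q' i) i) (fun u hu => ?_) ?_
          fun m => ?_).mono_const hG ?_
        · refine ((s1 u hu).sub (s1' u hu)).congr_deriv ?_
          simp only [Prod.fst_sub, Pi.sub_apply]
          ring
        · obtain ⟨B, hB⟩ := s2
          obtain ⟨B', hB'⟩ := s2'
          exact ⟨B + B', fun u hu => norm_sub_le_of_le (hB u hu) (hB' u hu)⟩
        · have e1 := s3 m
          have e2 := s3' m
          simp only [Prod.snd_sub, map_sub]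
          split_ifs at e1 e2 ⊢ <;> linear_combination e1 - e2
        · rw [← mul_assoc]
          have := mul_le_mul_of_nonneg_right hσ hM0
          linarith)
  have heq := fun i => eq_of_forall_pos (hq i)
  have hval : ∀ u ∈ T, ∀ i, (Φ q i).1 u = (q i).1 u := fun u hu i => by
    have := (heq i).1 u hu
    simp only [Prod.fst_sub, Pi.sub_apply] at this
    exact (sub_eq_zero.1 this).symm
  -- The norms do not see values outside `T`, so `q` and `Φ q` need only agree on `T`. Returning `Φ
  -- q` gives the vanishing of the `j`-th entry everywhere and the differential equation directly
  -- from the solver.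
  refine ⟨Φ q, fun u => by simp [hΦ], fun i => ?_, fun i => ⟨?_, fun m => ?_, fun K u hu => ?_⟩,
    fun i h u hu => ?_⟩
  · by_cases h : i = j
    · simp [hΦ, h]
    · have hb := riccati_bound hG hA τ j hq1 i
      have s3 := (hS (riccati τ A j q i) i ⟨_, hb⟩ h).2.2 0
      have hν : ν i ≠ 0 := norm_pos_iff.1 ((hw i h).pos.trans_le (hw i h).le_norm)
      rw [← hΦi q i h, riccati_coeff_zero τ hA0, if_neg (by have := hG.pos; omega), add_zero] at s3
      exact (mul_eq_zero.1 s3).resolve_left hν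
  · exact (hq1 i).diff.congr fun u hu => hval u hu i
  · rw [← sub_eq_zero.1 (heq i).2]
    exact (hq1 i).coeff m
  · rw [← sub_eq_zero.1 (heq i).2, hval u hu i]
    exact (hq1 i).rem K u hu
  · have hb := riccati_bound hG hA τ j hq1 i
    have s1 := (hS (riccati τ A j q i) i ⟨_, hb⟩ h).1 u hu
    rw [← hΦi q i h, riccati_fst] at s1
    simp only [hval u hu] at s1 ⊢
    exact s1

end GevreyBound

/-- Bounded solutions of the Riccati system with small coefficients are unique. -/
theorem riccati_unique {τ : ℂ} {c₀ σ : ℝ} (j : ι) {ν w : ι → ℂ} (hc₀ : 0 < c₀)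
    (hw : ∀ i, i ≠ j → IsDecayDirection T g c₀ (ν i) (w i))
    {A : ℂ → Matrix ι ι ℂ} (hA : ∀ u ∈ T, ∀ i k, ‖A u i k‖ ≤ σ)
    (hσ : ‖τ‖ * (Fintype.card ι * 4 * σ) / c₀ ≤ 1 / 2) {q q' : ℂ → ι → ℂ}
    (hqj : ∀ u ∈ T, q u j = 0) (hqj' : ∀ u ∈ T, q' u j = 0)
    (hq1 : ∀ u ∈ T, ∀ i, ‖q u i‖ ≤ 1) (hq1' : ∀ u ∈ T, ∀ i, ‖q' u i‖ ≤ 1)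
    (hq : ∀ i, i ≠ j → ∀ u ∈ T, HasDerivAt (fun u => q u i)
      (-ν i * q u i - riccati τ (A u) j (q u) i) u)
    (hq' : ∀ i, i ≠ j → ∀ u ∈ T, HasDerivAt (fun u => q' u i)
      (-ν i * q' u i - riccati τ (A u) j (q' u) i) u) :
    ∀ u ∈ T, ∀ i, q u i = q' u i := by
  have hmv : ∀ u ∈ T, ∀ (v : ι → ℂ) (V : ℝ), (∀ k, ‖v k‖ ≤ V) → ∀ i,
      ‖(A u *ᵥ v) i‖ ≤ Fintype.card ι * (σ * V) := by
    intro u hu v V hv i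
    have hσ0 : 0 ≤ σ := (norm_nonneg _).trans (hA u hu i i)
    calc _ ≤ ∑ k : ι, σ * V := by
          refine norm_sum_le_of_le _ fun k _ => ?_
          rw [norm_mul]
          exact mul_le_mul (hA u hu i k) (hv k) (norm_nonneg _) hσ0
      _ = _ := by simp
  -- The unit bounds give the distance `2`, and every application of `ray_bound` halves it.
  have main : ∀ k : ℕ, ∀ u ∈ T, ∀ i, ‖q u i - q' u i‖ ≤ 2 / 2 ^ k := by
    intro k
    induction k with
    | zero =>
      intro u hu i
      have := norm_sub_le_of_le (hq1 u hu i) (hq1' u hu i)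
      norm_num at this ⊢
      exact this
    | succ k ih =>
      intro u hu i
      by_cases hi : i = j
      · rw [hi, hqj u hu, hqj' u hu, sub_zero, norm_zero]; positivity
      have hwi := hw i hi
      have hσ0 : 0 ≤ σ := (norm_nonneg _).trans (hA u hu i i)
      -- The factor `4` is `1 + 2 + 1`, from the three terms of `riccati_sub`.
      have hb : ∀ z ∈ T, ‖riccati τ (A z) j (q z) i - riccati τ (A z) j (q' z) i‖ ≤
          ‖τ‖ * (Fintype.card ι * 4 * σ) * (2 / 2 ^ k) := by
        intro z hz
        have hp : ∀ k, ‖(Pi.single j (1 : ℂ) + q z : ι → ℂ) k‖ ≤ 2 := by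
          intro k
          have : ‖(Pi.single j (1 : ℂ) : ι → ℂ) k‖ ≤ 1 := by
            by_cases h : k = j
            · subst h; simp
            · simp [h]
          have := norm_add_le_of_le this (hq1 z hz k)
          rw [Pi.add_apply]; linarith
        have b1 := hmv z hz _ _ (ih z hz)
        have b2 := hmv z hz _ _ hp j
        rw [riccati_sub, norm_smul, mul_assoc]
        gcongr
        refine (norm_sub_le_of_le (b1 i) (norm_add_le_of_le
          ((norm_mul _ _).le.trans (mul_le_mul b2 (ih z hz i) (norm_nonneg _) (by positivity)))
          ((norm_mul _ _).le.trans (mul_le_mul (b1 j) (hq1' z hz i) (norm_nonneg _)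
            (by positivity))))).trans (le_of_eq ?_)
        ring
      have := ray_bound (v := fun z => q z i - q' z i)
        (h := fun z => riccati τ (A z) j (q z) i - riccati τ (A z) j (q' z) i) (u := u) hc₀
        hwi.re_le hwi.norm_eq (B := 2 / 2 ^ k)
        (fun s hs => ((hq i hi _ (hwi.mem u hu s hs)).sub
          (hq' i hi _ (hwi.mem u hu s hs))).congr_deriv (by ring))
        (fun s hs => ih _ (hwi.mem u hu s hs) i) (fun s hs => hb _ (hwi.mem u hu s hs))
      refine this.trans ?_
      rw [mul_div_right_comm, pow_succ]
      calc _ ≤ 1 / 2 * (2 / 2 ^ k : ℝ) := by gcongr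
        _ = _ := by field_simp
  intro u hu i
  rw [← sub_eq_zero, ← norm_le_zero_iff]
  have : Filter.Tendsto (fun k : ℕ => (2 : ℝ) / 2 ^ k) Filter.atTop (nhds 0) := by
    have := (tendsto_pow_atTop_nhds_zero_of_lt_one (r := (1 / 2 : ℝ)) (by norm_num)
      (by norm_num)).const_mul 2
    simp only [mul_zero, one_div, inv_pow, ← div_eq_mul_inv] at this
    exact this
  exact ge_of_tendsto' this fun k => main k u hu i

end Riccati

/-! ### Sectors, local Gevrey expansions and their uniqueness. -/

section Sectors

open Filter

theorem mem_sector_iff {α β r : ℝ} {x : ℂ} :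
    x ∈ sector α β (fun _ => r) ↔
      ∃ t ∈ Set.Ioo α β, 0 < ‖x‖ ∧ ‖x‖ < r ∧ x = ‖x‖ * Complex.exp (t * Complex.I) := by
  constructor
  · rintro ⟨t, ht, s, hs, hsr, rfl⟩
    have : ‖(s : ℂ) * Complex.exp (t * Complex.I)‖ = s := by
      rw [norm_mul, Complex.norm_exp_ofReal_mul_I, mul_one, Complex.norm_real,
        Real.norm_of_nonneg hs.le]
    exact ⟨t, ht, by rwa [this], by rwa [this], by rw [this]⟩
  · rintro ⟨t, ht, h0, hr, hx⟩
    exact ⟨t, ht, ‖x‖, h0, hr, hx⟩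

theorem sector_mono {α β α' β' r r' : ℝ} (hα : α' ≤ α) (hβ : β ≤ β') (hr : r ≤ r') :
    sector α β (fun _ => r) ⊆ sector α' β' (fun _ => r') := by
  rintro x ⟨t, ht, s, hs, hsr, rfl⟩
  exact ⟨t, ⟨hα.trans_lt ht.1, ht.2.trans_le hβ⟩, s, hs, hsr.trans_le hr, rfl⟩

theorem norm_pos_of_mem_sector {α β r : ℝ} {x : ℂ} (hx : x ∈ sector α β (fun _ => r)) :
    0 < ‖x‖ := by
  obtain ⟨_, _, h, _⟩ := mem_sector_iff.1 hx
  exact h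

theorem norm_lt_of_mem_sector {α β r : ℝ} {x : ℂ} (hx : x ∈ sector α β (fun _ => r)) :
    ‖x‖ < r := by
  obtain ⟨_, _, _, h, _⟩ := mem_sector_iff.1 hx
  exact h

/-- A sector is the image of a half strip under the open map `exp`. No branch of the argument
enters, so openings larger than `2π` are allowed. -/
theorem isOpen_sector (α β r : ℝ) : IsOpen (sector α β (fun _ => r)) := by
  rcases le_or_gt r 0 with hr | hr
  · have : sector α β (fun _ => r) = ∅ := by
      ext x
      simp only [Set.mem_empty_iff_false, iff_false]
      exact fun hx => by linarith [norm_pos_of_mem_sector hx, norm_lt_of_mem_sector hx]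
    rw [this]
    exact isOpen_empty
  have : sector α β (fun _ => r) =
      Complex.exp '' {z | z.re < Real.log r ∧ α < z.im ∧ z.im < β} := by
    ext x
    constructor
    · rintro ⟨t, ht, s, hs, hsr, rfl⟩
      refine ⟨Real.log s + t * Complex.I, ⟨?_, ?_, ?_⟩, ?_⟩
      · simpa using Real.log_lt_log hs hsr
      · simpa using ht.1
      · simpa using ht.2
      · rw [Complex.exp_add, ← Complex.ofReal_exp, Real.exp_log hs]
    · rintro ⟨z, ⟨h1, h2, h3⟩, rfl⟩
      refine ⟨z.im, ⟨h2, h3⟩, Real.exp z.re, Real.exp_pos _, ?_, ?_⟩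
      · exact (Real.lt_log_iff_exp_lt hr).1 h1
      · rw [Complex.ofReal_exp, ← Complex.exp_add, Complex.re_add_im]
  rw [this]
  refine Complex.isOpenMap_exp _ ?_
  exact (isOpen_lt Complex.continuous_re continuous_const).inter
    ((isOpen_lt continuous_const Complex.continuous_im).inter
      (isOpen_lt Complex.continuous_im continuous_const))

theorem smul_mem_sector {α β r : ℝ} {x : ℂ} (hx : x ∈ sector α β (fun _ => r)) {t : ℝ}
    (ht : 0 < t) (ht1 : t ≤ 1) : (t : ℂ) * x ∈ sector α β (fun _ => r) := by
  obtain ⟨a, ha, s, hs, hsr, rfl⟩ := hx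
  refine ⟨a, ha, t * s, by positivity, by nlinarith, by push_cast; ring⟩

theorem isGauge_sector {γ : ℕ} (hγ : 0 < γ) (α β : ℝ) {c : ℝ} (hc : 0 < c) :
    IsGauge γ (sector α β (fun _ => 1 / c)) (fun x => c * x) (fun x => (c * ‖x‖) ^ γ) where
  pos := hγ
  isOpen := isOpen_sector _ _ _
  pow_le u _ := by rw [norm_mul, Complex.norm_real, Real.norm_of_nonneg hc.le]
  le_one u hu := by
    refine pow_le_one₀ (by positivity) ?_
    have := norm_lt_of_mem_sector hu
    rw [lt_div_iff₀ hc] at this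
    linarith

/-- `f x` tends to `l` when `x` tends to `0` in the closed subsectors of the sector `(α, β)`. -/
def SectorTendsto (α β : ℝ) (f : ℂ → ℂ) (l : ℂ) : Prop :=
  ∀ α' β', α < α' → β' < β → ∀ η > 0, ∃ r > 0,
    ∀ x ∈ sector α' β' (fun _ => r), ‖f x - l‖ ≤ η

/-- The Gevrey estimates hold on the closed subsectors of the sector `(α, β)`, at all scales
that are small enough. -/
def LocalGevrey (γ : ℕ) (α β : ℝ) (f : ℂ → ℂ) : Prop :=
  ∀ α' β', α < α' → β' < β → ∀ᶠ c : ℝ in atTop, ∃ A M,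
    GevreyBound γ (sector α' β' (fun _ => 1 / c)) (fun x => c * x) (fun x => (c * ‖x‖) ^ γ)
      (f, A) M

namespace LocalGevrey

variable {γ : ℕ} {α β : ℝ} {f h : ℂ → ℂ}

theorem mul (hγ : 0 < γ) (hf : LocalGevrey γ α β f) (hh : LocalGevrey γ α β h) :
    LocalGevrey γ α β (f * h) := by
  intro α' β' hα hβ
  filter_upwards [hf α' β' hα hβ, hh α' β' hα hβ, eventually_gt_atTop 0]
    with c ⟨A, M, h1⟩ ⟨B, M', h2⟩ hc
  exact ⟨A * B, _, GevreyBound.mul (isGauge_sector hγ _ _ hc) h1 h2⟩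

theorem add (hf : LocalGevrey γ α β f) (hh : LocalGevrey γ α β h) :
    LocalGevrey γ α β (f + h) := by
  intro α' β' hα hβ
  filter_upwards [hf α' β' hα hβ, hh α' β' hα hβ] with c ⟨A, M, h1⟩ ⟨B, M', h2⟩
  exact ⟨A + B, _, h1.add h2⟩

theorem const (hγ : 0 < γ) (a : ℂ) : LocalGevrey γ α β (fun _ => a) := by
  intro α' β' hα hβ
  filter_upwards [eventually_gt_atTop 0] with c hc
  refine ⟨a • 1, ‖a‖ * 1, ?_⟩
  have := (GevreyBound.one (isGauge_sector hγ α' β' hc)).smul a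
  convert this using 2
  · ext x
    simp
  · rfl

theorem sum (hγ : 0 < γ) {ι : Type*} (s : Finset ι) {F : ι → ℂ → ℂ}
    (hF : ∀ i ∈ s, LocalGevrey γ α β (F i)) : LocalGevrey γ α β (∑ i ∈ s, F i) := by
  classical
  induction s using Finset.induction_on with
  | empty => rw [Finset.sum_empty]; exact const hγ 0
  | insert i s hi ih =>
    rw [Finset.sum_insert hi]
    exact (hF i (by simp)).add (ih fun j hj => hF j (by simp [hj]))

theorem exp (hγ : 0 < γ) (hf : LocalGevrey γ α β f) :
    LocalGevrey γ α β (fun x => Complex.exp (f x)) := by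
  intro α' β' hα hβ
  filter_upwards [hf α' β' hα hβ, eventually_gt_atTop 0] with c ⟨A, M, h1⟩ hc
  exact GevreyBound.exp (isGauge_sector hγ _ _ hc) h1

theorem mono {α' β' : ℝ} (hf : LocalGevrey γ α β f) (hα : α ≤ α') (hβ : β' ≤ β) :
    LocalGevrey γ α' β' f :=
  fun a b ha hb => hf a b (hα.trans_lt ha) (hb.trans_le hβ)

/-- Functions that agree near the origin have the Gevrey property simultaneously. -/
theorem of_eqOn {α' β' : ℝ} {f : ℂ → ℂ}
    (hf : ∀ a b, α' < a → b < β' → ∃ F, (∃ r > 0, ∀ x ∈ sector a b (fun _ => r), f x = F x) ∧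
      ∀ᶠ c : ℝ in atTop, ∃ A M, GevreyBound γ (sector a b (fun _ => 1 / c))
        (fun x => c * x) (fun x => (c * ‖x‖) ^ γ) (F, A) M) : LocalGevrey γ α' β' f := by
  intro a b ha hb
  obtain ⟨F, ⟨r, hr, hFr⟩, hF⟩ := hf a b ha hb
  filter_upwards [hF, eventually_ge_atTop (1 / r), eventually_gt_atTop 0] with c ⟨A, M, h1⟩ hc hc0
  have hle : 1 / c ≤ r := by rw [one_div_le hc0 hr]; exact hc
  have heq : ∀ x ∈ sector a b (fun _ => 1 / c), f x = F x := fun x hx =>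
    hFr x (sector_mono le_rfl le_rfl hle hx)
  exact ⟨A, M, h1.diff.congr heq, h1.coeff, fun K u hu => by
    simpa only [heq u hu] using h1.rem K u hu⟩

end LocalGevrey

/-- Uniqueness of asymptotic expansions. -/
theorem eq_of_isBigO_partialSum {γ : ℕ} (hγ : 0 < γ) {f : ℂ → ℂ} {t : ℝ} {A B : PowerSeries ℂ}
    (hA : ∀ K, ∃ C, ∀ᶠ s : ℝ in nhdsWithin 0 (Set.Ioi 0),
      ‖f (s * Complex.exp (t * Complex.I)) -
        partialSum A (s * Complex.exp (t * Complex.I)) (γ * K)‖ ≤ C * s ^ (γ * K))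
    (hB : ∀ K, ∃ C, ∀ᶠ s : ℝ in nhdsWithin 0 (Set.Ioi 0),
      ‖f (s * Complex.exp (t * Complex.I)) -
        partialSum B (s * Complex.exp (t * Complex.I)) (γ * K)‖ ≤ C * s ^ (γ * K)) : A = B := by
  ext m
  induction m using Nat.strong_induction_on with
  | _ m ih =>
    -- Only orders `γ K` are available; `K = m + 1` is always enough because `γ (m + 1) > m`.
    obtain ⟨C1, h1⟩ := hA (m + 1)
    obtain ⟨C2, h2⟩ := hB (m + 1)
    have hmK : m + 1 ≤ γ * (m + 1) := Nat.le_mul_of_pos_left _ hγ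
    set N := γ * (m + 1)
    set D := fun l => PowerSeries.coeff l A - PowerSeries.coeff l B with hD
    set C := |C1| + |C2| + ∑ l ∈ Finset.Ico (m + 1) N, ‖D l‖ with hCdef
    have hC0 : 0 ≤ C := by positivity
    have key : ∀ᶠ s : ℝ in nhdsWithin 0 (Set.Ioi 0), ‖D m‖ ≤ C * s := by
      filter_upwards [h1, h2, self_mem_nhdsWithin,
        mem_nhdsWithin_of_mem_nhds (Iio_mem_nhds (zero_lt_one (α := ℝ)))] with s hs1 hs2 hs0 hs3
      have hs0 : 0 < s := hs0
      have hs3 : s < 1 := hs3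
      set z : ℂ := s * Complex.exp (t * Complex.I) with hz
      have hzn : ‖z‖ = s := by
        rw [hz, norm_mul, Complex.norm_exp_ofReal_mul_I, mul_one, Complex.norm_real,
          Real.norm_of_nonneg hs0.le]
      have hsub : partialSum A z N - partialSum B z N =
          D m * z ^ m + ∑ l ∈ Finset.Ico (m + 1) N, D l * z ^ l := by
        rw [partialSum, partialSum, ← Finset.sum_sub_distrib,
          ← Finset.sum_range_add_sum_Ico _ hmK, Finset.sum_range_succ, Finset.sum_eq_zero, zero_add]
        · simp only [hD, sub_mul]
        · intro l hl
          rw [ih l (Finset.mem_range.1 hl), sub_self]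
      have hsN : s ^ N ≤ s ^ (m + 1) := pow_le_pow_of_le_one hs0.le hs3.le hmK
      have hb1 : ‖partialSum A z N - partialSum B z N‖ ≤ (|C1| + |C2|) * s ^ (m + 1) := by
        have e : partialSum A z N - partialSum B z N =
            (f z - partialSum B z N) - (f z - partialSum A z N) := by ring
        rw [e]
        calc _ ≤ C2 * s ^ N + C1 * s ^ N := norm_sub_le_of_le hs2 hs1
          _ ≤ |C2| * s ^ N + |C1| * s ^ N := by
              gcongr
              · exact le_abs_self _
              · exact le_abs_self _
          _ = (|C1| + |C2|) * s ^ N := by ring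
          _ ≤ _ := by gcongr
      have hb2 : ‖∑ l ∈ Finset.Ico (m + 1) N, D l * z ^ l‖ ≤
          (∑ l ∈ Finset.Ico (m + 1) N, ‖D l‖) * s ^ (m + 1) := by
        rw [Finset.sum_mul]
        refine norm_sum_le_of_le _ fun l hl => ?_
        rw [norm_mul, norm_pow, hzn]
        gcongr ?_ * ?_
        exact pow_le_pow_of_le_one hs0.le hs3.le (Finset.mem_Ico.1 hl).1
      have hb3 : ‖D m * z ^ m‖ ≤ C * s ^ (m + 1) := by
        have e : D m * z ^ m = (partialSum A z N - partialSum B z N) -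
            ∑ l ∈ Finset.Ico (m + 1) N, D l * z ^ l := by rw [hsub]; ring
        rw [e, hCdef, add_mul]
        exact norm_sub_le_of_le hb1 hb2
      rw [norm_mul, norm_pow, hzn, pow_succ, ← mul_assoc, mul_right_comm] at hb3
      exact le_of_mul_le_mul_right hb3 (by positivity)
    have hlim : Tendsto (fun s : ℝ => C * s) (nhdsWithin 0 (Set.Ioi 0)) (nhds (C * 0)) :=
      (tendsto_id.const_mul C).mono_left nhdsWithin_le_nhds
    rw [mul_zero] at hlim
    have := ge_of_tendsto hlim key
    exact sub_eq_zero.1 (norm_le_zero_iff.1 this)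

theorem GevreyBound.eventually_ray {γ : ℕ} {α β c M : ℝ} {f : ℂ → ℂ} {A : PowerSeries ℂ}
    (hc : 0 < c) {t : ℝ} (ht : t ∈ Set.Ioo α β)
    (h : GevreyBound γ (sector α β (fun _ => 1 / c)) (fun x => c * x) (fun x => (c * ‖x‖) ^ γ)
      (f, PowerSeries.rescale ((c : ℂ)⁻¹) A) M) (K : ℕ) :
    ∃ C, ∀ᶠ s : ℝ in nhdsWithin 0 (Set.Ioi 0),
      ‖f (s * Complex.exp (t * Complex.I)) -
        partialSum A (s * Complex.exp (t * Complex.I)) (γ * K)‖ ≤ C * s ^ (γ * K) := by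
  refine ⟨M * K.factorial * c ^ (γ * K), ?_⟩
  filter_upwards [self_mem_nhdsWithin,
    mem_nhdsWithin_of_mem_nhds (Iio_mem_nhds (show (0 : ℝ) < 1 / c by positivity))] with s hs hs1
  have hs0 : 0 < s := hs
  have := h.rem K (s * Complex.exp (t * Complex.I)) ⟨t, ht, s, hs, hs1, rfl⟩
  have hc' : (c : ℂ) ≠ 0 := by exact_mod_cast hc.ne'
  rw [partialSum_rescale, inv_mul_cancel_left₀ hc'] at this
  refine this.trans (le_of_eq ?_)
  rw [norm_mul, Complex.norm_exp_ofReal_mul_I, mul_one, Complex.norm_real,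
    Real.norm_of_nonneg hs0.le, ← pow_mul, mul_pow]
  ring

/-- Undoing the scale `c` gives an expansion in `x` itself. Every subsector can be enlarged to
contain the bisecting ray, on which expansions are unique, so one series serves all subsectors and
scales. This is the source of the independence of `ε` in the theorem. -/
theorem LocalGevrey.exists_series {γ : ℕ} (hγ : 0 < γ) {α β : ℝ} (hαβ : α < β) {f : ℂ → ℂ}
    (hf : LocalGevrey γ α β f) :
    ∃ A : PowerSeries ℂ, ∀ α' β', α < α' → β' < β → ∀ᶠ c : ℝ in atTop, ∃ M,
      GevreyBound γ (sector α' β' (fun _ => 1 / c)) (fun x => c * x) (fun x => (c * ‖x‖) ^ γ)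
        (f, PowerSeries.rescale ((c : ℂ)⁻¹) A) M := by
  have hunscale : ∀ α' β', α < α' → β' < β → ∀ᶠ c : ℝ in atTop, ∃ A M, 0 < c ∧
      GevreyBound γ (sector α' β' (fun _ => 1 / c)) (fun x => c * x) (fun x => (c * ‖x‖) ^ γ)
        (f, PowerSeries.rescale ((c : ℂ)⁻¹) A) M := by
    intro α' β' hα hβ
    filter_upwards [hf α' β' hα hβ, eventually_gt_atTop 0] with c ⟨A, M, h⟩ hc
    refine ⟨PowerSeries.rescale (c : ℂ) A, M, hc, ?_⟩
    have hc' : (c : ℂ) ≠ 0 := by exact_mod_cast hc.ne'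
    rwa [PowerSeries.rescale_rescale, mul_inv_cancel₀ hc', PowerSeries.rescale_one]
  set t := (α + β) / 2 with ht
  have e1 : α < (α + t) / 2 := by linarith
  have e2 : (t + β) / 2 < β := by linarith
  have ht1 : (α + t) / 2 < t := by linarith
  have ht2 : t < (t + β) / 2 := by linarith
  obtain ⟨c₀, A, M₀, hc₀, h₀⟩ := (hunscale _ _ e1 e2).exists
  refine ⟨A, fun α' β' hα hβ => ?_⟩
  have hmin : α < min α' ((α + t) / 2) := lt_min hα e1
  have hmax : max β' ((t + β) / 2) < β := max_lt hβ e2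
  filter_upwards [hunscale _ _ hmin hmax] with c ⟨B, M, hc, h⟩
  have hAB : A = B := eq_of_isBigO_partialSum hγ
    (fun K => h₀.eventually_ray hc₀ ⟨ht1, ht2⟩ K)
    (fun K => h.eventually_ray hc ⟨(min_le_right _ _).trans_lt ht1,
      ht2.trans_le (le_max_right _ _)⟩ K)
  refine ⟨M, ?_⟩
  rw [hAB]
  exact h.mono_set (sector_mono (min_le_left _ _) (le_max_left _ _) le_rfl)

theorem GevreyBound.exists_radius {γ : ℕ} (hγ : 0 < γ) {α β c M : ℝ} {f : ℂ → ℂ}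
    {A : PowerSeries ℂ} (hc : 0 < c)
    (h : GevreyBound γ (sector α β (fun _ => 1 / c)) (fun x => c * x) (fun x => (c * ‖x‖) ^ γ)
      (f, A) M) {η : ℝ} (hη : 0 < η) :
    ∃ r > 0, ∀ x ∈ sector α β (fun _ => r), ‖f x - PowerSeries.coeff 0 A‖ ≤ η := by
  have hM := h.nonneg
  set L := (1 + γ) * M * c + 1 with hL
  have hL0 : 0 < L := by positivity
  refine ⟨min (1 / c) (η / L), by positivity, fun x hx => ?_⟩
  have hx1 := sector_mono (le_refl α) (le_refl β) (min_le_left _ _) hx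
  have hx2 := (norm_lt_of_mem_sector hx).trans_le (min_le_right _ _)
  have hcx : c * ‖x‖ ≤ 1 := by
    have := norm_lt_of_mem_sector hx1
    rw [lt_div_iff₀ hc] at this; linarith
  have h1 := norm_sub_coeff_zero_le (isGauge_sector hγ α β hc) h hx1
  have h2 : (c * ‖x‖) ^ γ ≤ c * ‖x‖ := by
    calc _ ≤ (c * ‖x‖) ^ 1 := pow_le_pow_of_le_one (by positivity) hcx hγ
      _ = _ := pow_one _
  rw [norm_mul, Complex.norm_real, Real.norm_of_nonneg hc.le] at h1
  have h3 : M * (c * ‖x‖) ^ γ ≤ M * (c * ‖x‖) := by gcongr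
  rw [lt_div_iff₀ hL0] at hx2
  calc _ ≤ M * (c * ‖x‖) ^ γ + γ * M * (c * ‖x‖) := h1
    _ ≤ M * (c * ‖x‖) + γ * M * (c * ‖x‖) := by linarith
    _ ≤ ‖x‖ * L := by rw [hL]; nlinarith [norm_nonneg x]
    _ ≤ η := hx2.le

theorem sectorTendsto_of_series {γ : ℕ} (hγ : 0 < γ) {α β : ℝ} {f : ℂ → ℂ} {A : PowerSeries ℂ}
    (h : ∀ α' β', α < α' → β' < β → ∀ᶠ c : ℝ in atTop, ∃ M,
      GevreyBound γ (sector α' β' (fun _ => 1 / c)) (fun x => c * x) (fun x => (c * ‖x‖) ^ γ)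
        (f, PowerSeries.rescale ((c : ℂ)⁻¹) A) M) :
    SectorTendsto α β f (PowerSeries.coeff 0 A) := by
  intro α' β' hα hβ η hη
  obtain ⟨c, ⟨M, h1⟩, hc⟩ := ((h α' β' hα hβ).and (eventually_gt_atTop 0)).exists
  have := h1.exists_radius hγ hc hη
  simpa [PowerSeries.coeff_rescale] using this

theorem SectorTendsto.unique {α β : ℝ} (hαβ : α < β) {f : ℂ → ℂ} {l l' : ℂ}
    (h : SectorTendsto α β f l) (h' : SectorTendsto α β f l') : l = l' := by
  by_contra hne
  have hpos : 0 < ‖l - l'‖ := norm_pos_iff.2 (sub_ne_zero.2 hne)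
  set t := (α + β) / 2 with ht
  obtain ⟨r, hr, h1⟩ := h ((α + t) / 2) ((t + β) / 2) (by linarith) (by linarith)
    (‖l - l'‖ / 4) (by positivity)
  obtain ⟨r', hr', h2⟩ := h' ((α + t) / 2) ((t + β) / 2) (by linarith) (by linarith)
    (‖l - l'‖ / 4) (by positivity)
  have hmem : ∀ ρ, min r r' ≤ ρ → ((min r r' / 2 : ℝ) : ℂ) * Complex.exp (t * Complex.I) ∈
      sector ((α + t) / 2) ((t + β) / 2) (fun _ => ρ) := fun ρ hρ =>
    ⟨t, ⟨by linarith, by linarith⟩, _, by positivity,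
      (half_lt_self (lt_min hr hr')).trans_le hρ, rfl⟩
  have a1 := h1 _ (hmem r (min_le_left _ _))
  have a2 := h2 _ (hmem r' (min_le_right _ _))
  have := norm_sub_le_of_le a2 a1
  rw [sub_sub_sub_cancel_left] at this
  linarith

end Sectors

/-! ### Unions of two half planes and their boundary directions. -/

section HalfPlanes

/-- The gauge of the union of the half planes `Re (u exp (± i ω)) > 0`. -/
noncomputable def planeGauge (ω : ℝ) (u : ℂ) : ℝ := u.re * Real.cos ω + |u.im| * Real.sin ω

/-- The union of the half planes `Re (u exp (± i ω)) > R`. -/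
def halfPlanes (ω R : ℝ) : Set ℂ := {u | R < planeGauge ω u}

variable {ω R : ℝ}

theorem isOpen_halfPlanes (ω R : ℝ) : IsOpen (halfPlanes ω R) := by
  refine isOpen_lt continuous_const ?_
  unfold planeGauge
  fun_prop

theorem planeGauge_le_norm (ω : ℝ) (u : ℂ) : planeGauge ω u ≤ ‖u‖ := by
  refine le_of_sq_le_sq ?_ (norm_nonneg u)
  rw [planeGauge, ← Complex.normSq_eq_norm_sq, Complex.normSq_apply]
  have h1 := Real.sin_sq_add_cos_sq ω
  have h2 := sq_abs u.im
  nlinarith [sq_nonneg (u.re * Real.sin ω - |u.im| * Real.cos ω)]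

/-- The gain `s sin ω cos ω` from the real part compensates the loss from `|Im|`, at most `s cos ω
sin ω`: the direction is parallel to one boundary line and does not leave the other half plane. -/
theorem planeGauge_add_le (hω : 0 ≤ Real.cos ω) (hω' : 0 ≤ Real.sin ω) {σ : ℝ} (hσ : |σ| = 1)
    (u : ℂ) {s : ℝ} (hs : 0 ≤ s) :
    planeGauge ω u ≤ planeGauge ω (u + s * ⟨Real.sin ω, σ * Real.cos ω⟩) := by
  simp only [planeGauge, Complex.add_re, Complex.mul_re, Complex.ofReal_re, Complex.ofReal_im,
    zero_mul, sub_zero, Complex.add_im, Complex.mul_im, add_zero]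
  have h1 : |u.im| - s * Real.cos ω ≤ |u.im + s * (σ * Real.cos ω)| := by
    have h2 := abs_sub_abs_le_abs_sub u.im (-(s * (σ * Real.cos ω)))
    rw [sub_neg_eq_add, abs_neg, abs_mul, abs_mul, hσ, one_mul, abs_of_nonneg hs,
      abs_of_nonneg hω] at h2
    exact h2
  nlinarith [mul_le_mul_of_nonneg_right h1 hω']

theorem norm_direction {σ : ℝ} (hσ : |σ| = 1) (ω : ℝ) :
    ‖(⟨Real.sin ω, σ * Real.cos ω⟩ : ℂ)‖ = 1 := by
  have h : ‖(⟨Real.sin ω, σ * Real.cos ω⟩ : ℂ)‖ ^ 2 = 1 := by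
    rw [← Complex.normSq_eq_norm_sq, Complex.normSq_apply]
    have h1 := Real.sin_sq_add_cos_sq ω
    have h2 := sq_abs σ
    rw [hσ] at h2
    simp only
    nlinarith
  exact (pow_eq_one_iff_of_nonneg (norm_nonneg _) two_ne_zero).1 h

theorem planeGauge_polar (ω : ℝ) {ρ φ : ℝ} (hρ : 0 ≤ ρ) (hφ : |φ| ≤ Real.pi) :
    planeGauge ω (ρ * Complex.exp (φ * Complex.I)) = ρ * Real.cos (|φ| - ω) := by
  have h1 : |Real.sin φ| = Real.sin |φ| := by
    rcases le_total 0 φ with h | h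
    · rw [abs_of_nonneg h] at hφ ⊢
      exact abs_of_nonneg (Real.sin_nonneg_of_nonneg_of_le_pi h hφ)
    · rw [abs_of_nonpos h] at hφ ⊢
      rw [Real.sin_neg]
      exact abs_of_nonpos (Real.sin_nonpos_of_nonpos_of_neg_pi_le h (by linarith))
  rw [planeGauge, Complex.exp_mul_I, ← Complex.ofReal_cos, ← Complex.ofReal_sin]
  simp only [Complex.mul_re, Complex.ofReal_re, Complex.ofReal_im, Complex.add_re, Complex.I_re,
    Complex.I_im, Complex.mul_im, Complex.add_im]
  simp only [mul_zero, mul_one, zero_mul, sub_zero, add_zero, zero_add]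
  rw [abs_mul, abs_of_nonneg hρ, h1, Real.cos_sub, Real.cos_abs]
  ring

theorem mem_slitPlane_of_planeGauge_pos (hω : 0 ≤ Real.cos ω) {u : ℂ} (h : 0 < planeGauge ω u) :
    u ∈ Complex.slitPlane := by
  rw [Complex.mem_slitPlane_iff]
  by_contra hcon
  push Not at hcon
  rw [planeGauge, hcon.2, abs_zero, zero_mul, add_zero] at h
  nlinarith [hcon.1]

theorem abs_arg_lt_of_planeGauge_pos (hω : 0 ≤ ω) (hω' : ω ≤ Real.pi / 2) {u : ℂ}
    (h : 0 < planeGauge ω u) : |Complex.arg u| < Real.pi / 2 + ω := by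
  by_contra hcon
  push Not at hcon
  have hπ : |Complex.arg u| ≤ Real.pi := Complex.abs_arg_le_pi u
  rw [← Complex.norm_mul_exp_arg_mul_I u, planeGauge_polar ω (norm_nonneg u) hπ] at h
  have : Real.cos (|Complex.arg u| - ω) ≤ 0 :=
    Real.cos_nonpos_of_pi_div_two_le_of_le (by linarith) (by linarith [Real.pi_pos])
  nlinarith [norm_nonneg u]

/-- On a smaller sector the gauge is comparable with the modulus. -/
theorem exists_le_planeGauge {ω' : ℝ} (hω' : ω' < ω) (h0 : 0 < ω) (hω : ω < Real.pi / 2) :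
    ∃ s₀ > 0, ∀ ρ φ : ℝ, 0 ≤ ρ → |φ| ≤ Real.pi / 2 + ω' →
      ρ * s₀ ≤ planeGauge ω (ρ * Complex.exp (φ * Complex.I)) := by
  have hπ := Real.pi_pos
  rcases lt_or_ge ω' (-(Real.pi / 2)) with hneg | hneg
  · exact ⟨1, one_pos, fun ρ φ _ h => by linarith [abs_nonneg φ]⟩
  -- The difference `|φ| - ω` lies between `-ω` and `π/2 - (ω - ω')`, and the cosine is smallest at
  -- the ends. The maximum with `0` keeps the second angle in the range where the cosine is
  -- monotone.
  refine ⟨min (Real.cos ω) (Real.cos (max 0 (Real.pi / 2 - (ω - ω')))), lt_min ?_ ?_,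
    fun ρ φ hρ hφ => ?_⟩
  · exact Real.cos_pos_of_mem_Ioo ⟨by linarith, hω⟩
  · exact Real.cos_pos_of_mem_Ioo ⟨(by linarith : -(Real.pi / 2) < 0).trans_le (le_max_left _ _),
      max_lt (by linarith) (by linarith)⟩
  · rw [planeGauge_polar ω hρ (by linarith)]
    refine mul_le_mul_of_nonneg_left ?_ hρ
    rcases le_total (|φ| - ω) 0 with h | h
    · refine (min_le_left _ _).trans ?_
      rw [← Real.cos_neg (|φ| - ω)]
      exact Real.cos_le_cos_of_nonneg_of_le_pi (by linarith) (by linarith)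
        (by linarith [abs_nonneg φ])
    · refine (min_le_right _ _).trans ?_
      exact Real.cos_le_cos_of_nonneg_of_le_pi h (max_le (by linarith) (by linarith))
        (le_max_of_le_right (by linarith))

/-- One of the two directions along the boundary is a direction of decay. -/
theorem exists_direction {ν : ℂ} (hν : ν ≠ 0) (hω' : ω < |Complex.arg ν|)
    (hω'' : 0 < ω) : ∃ σ : ℝ, |σ| = 1 ∧ (ν * ⟨Real.sin ω, σ * Real.cos ω⟩).re < 0 := by
  have hn : 0 < ‖ν‖ := norm_pos_iff.2 hν
  have hre : ν.re = ‖ν‖ * Real.cos (Complex.arg ν) := (Complex.norm_mul_cos_arg ν).symm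
  have him : ν.im = ‖ν‖ * Real.sin (Complex.arg ν) := (Complex.norm_mul_sin_arg ν).symm
  -- With the sign `σ` chosen as that of `arg ν`, the real part equals `-‖ν‖ sin(|arg ν| - ω)`.
  rcases le_total 0 (Complex.arg ν) with h | h
  · refine ⟨1, abs_one, ?_⟩
    rw [abs_of_nonneg h] at hω'
    have : 0 < Real.sin (Complex.arg ν - ω) :=
      Real.sin_pos_of_pos_of_lt_pi (by linarith) (by linarith [Complex.arg_le_pi ν])
    rw [Complex.mul_re, hre, him]
    rw [Real.sin_sub] at this
    simp only
    nlinarith [mul_pos hn this]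
  · refine ⟨-1, by simp, ?_⟩
    rw [abs_of_nonpos h] at hω'
    have : 0 < Real.sin (-Complex.arg ν - ω) :=
      Real.sin_pos_of_pos_of_lt_pi (by linarith) (by linarith [Complex.neg_pi_lt_arg ν])
    rw [Complex.mul_re, hre, him]
    rw [Real.sin_sub, Real.sin_neg, Real.cos_neg] at this
    simp only
    nlinarith [mul_pos hn this]

end HalfPlanes

/-! ### The change of variable `u = exp(iγθ) / x^γ`. -/

section Variable

variable {γ : ℕ} {θ : ℝ}

/-- The variable `x` as a function of `u = exp (i γ θ) / x ^ γ`. -/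
noncomputable def rootVariable (γ : ℕ) (θ : ℝ) (u : ℂ) : ℂ :=
  Complex.exp (θ * Complex.I) * u ^ (-(1 / γ : ℂ))

/-- The variable `u = exp (i γ θ) / x ^ γ`. -/
noncomputable def powerVariable (γ : ℕ) (θ : ℝ) (x : ℂ) : ℂ :=
  Complex.exp (γ * θ * Complex.I) / x ^ γ

theorem rootVariable_pow (hγ : 0 < γ) (u : ℂ) :
    rootVariable γ θ u ^ γ = Complex.exp (γ * θ * Complex.I) / u := by
  have hγ' : (γ : ℂ) ≠ 0 := by exact_mod_cast hγ.ne'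
  rw [rootVariable, mul_pow, ← Complex.exp_nat_mul, ← Complex.cpow_nat_mul, ← mul_assoc]
  have : (γ : ℂ) * -(1 / γ : ℂ) = -1 := by field_simp
  rw [this, Complex.cpow_neg_one, div_eq_mul_inv]

theorem norm_rootVariable_pow (hγ : 0 < γ) (u : ℂ) :
    ‖rootVariable γ θ u‖ ^ γ = 1 / ‖u‖ := by
  rw [← norm_pow, rootVariable_pow hγ, norm_div]
  have : ‖Complex.exp (γ * θ * Complex.I)‖ = 1 := by
    have := Complex.norm_exp_ofReal_mul_I (γ * θ)
    push_cast at this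
    exact this
  rw [this]

/-- Thus `x^(γ+1) d/dx` becomes `-γ exp(iγθ) d/du`: the irregular singularity at `0` is sent to
infinity, with constant leading coefficients. -/
theorem hasDerivAt_rootVariable (hγ : 0 < γ) {u : ℂ} (hu : u ∈ Complex.slitPlane) :
    HasDerivAt (rootVariable γ θ)
      (-(1 / (γ * Complex.exp (γ * θ * Complex.I))) * rootVariable γ θ u ^ (γ + 1)) u := by
  have hγ' : (γ : ℂ) ≠ 0 := by exact_mod_cast hγ.ne'
  have hu0 : u ≠ 0 := Complex.slitPlane_ne_zero hu
  have h := ((hasDerivAt_id u).cpow_const (c := -(1 / γ : ℂ)) hu).const_mul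
    (Complex.exp (θ * Complex.I))
  refine h.congr_deriv ?_
  rw [pow_succ, rootVariable_pow hγ, rootVariable, id, Complex.cpow_sub _ _ hu0,
    Complex.cpow_one]
  have := Complex.exp_ne_zero (γ * θ * Complex.I)
  field_simp

theorem rootVariable_mem_sector (hγ : 0 < γ) {ω : ℝ} (hω : 0 ≤ ω) (hω' : ω ≤ Real.pi / 2)
    {c : ℝ} (hc : 0 < c) {u : ℂ} (hu : u ∈ halfPlanes ω (c ^ γ)) :
    rootVariable γ θ u ∈ sector (θ - (Real.pi / (2 * γ) + ω / γ)) (θ + (Real.pi / (2 * γ) + ω / γ))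
      (fun _ => 1 / c) := by
  have hγ' : (0 : ℝ) < γ := by exact_mod_cast hγ
  have hcos : 0 ≤ Real.cos ω := Real.cos_nonneg_of_mem_Icc ⟨by linarith, hω'⟩
  have hd : c ^ γ < planeGauge ω u := hu
  have hd0 : 0 < planeGauge ω u := (pow_pos hc γ).trans hd
  have hu0 : u ≠ 0 := Complex.slitPlane_ne_zero (mem_slitPlane_of_planeGauge_pos hcos hd0)
  have harg := abs_lt.1 (abs_arg_lt_of_planeGauge_pos hω hω' hd0)
  have hn : 0 < ‖u‖ := norm_pos_iff.2 hu0
  have hX : rootVariable γ θ u = (‖u‖ ^ (-(1 / γ : ℝ)) : ℝ) *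
      Complex.exp ((θ - Complex.arg u / γ : ℝ) * Complex.I) := by
    rw [rootVariable, Complex.cpow_def_of_ne_zero hu0, Real.rpow_def_of_pos hn, Complex.ofReal_exp,
      ← Complex.exp_add, ← Complex.exp_add, Complex.log]
    congr 1
    push_cast
    ring
  refine ⟨θ - Complex.arg u / γ, ⟨?_, ?_⟩, ‖u‖ ^ (-(1 / γ : ℝ)), Real.rpow_pos_of_pos hn _, ?_, hX⟩
  · have : Complex.arg u / γ < Real.pi / (2 * γ) + ω / γ := by
      have e : Real.pi / (2 * γ) + ω / γ = (Real.pi / 2 + ω) / γ := by field_simp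
      rw [e]
      exact div_lt_div_of_pos_right harg.2 hγ'
    linarith
  · have : -(Real.pi / (2 * γ) + ω / γ) < Complex.arg u / γ := by
      have e : -(Real.pi / (2 * γ) + ω / γ) = -(Real.pi / 2 + ω) / γ := by field_simp
      rw [e]
      exact div_lt_div_of_pos_right harg.1 hγ'
    linarith
  · have h1 : ‖rootVariable γ θ u‖ = ‖u‖ ^ (-(1 / γ : ℝ)) := by
      rw [hX, norm_mul, Complex.norm_exp_ofReal_mul_I, mul_one, Complex.norm_real,
        Real.norm_of_nonneg (Real.rpow_nonneg hn.le _)]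
    rw [← h1]
    have h2 := norm_rootVariable_pow (θ := θ) hγ u
    have h3 : ‖rootVariable γ θ u‖ ^ γ < (1 / c) ^ γ := by
      rw [h2, _root_.one_div_pow]
      exact one_div_lt_one_div_of_lt (pow_pos hc γ) (hd.trans_le (planeGauge_le_norm ω u))
    exact lt_of_pow_lt_pow_left₀ γ (by positivity) h3

/-- The assumption `ω' < π / 2` keeps the argument `γ (θ - t)` of `u` in `(-π, π)`, where the
principal power inverts `x ↦ u`. -/
theorem rootVariable_powerVariable (hγ : 0 < γ) {ω' r : ℝ} (hω' : ω' < Real.pi / 2) {x : ℂ}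
    (hx : x ∈ sector (θ - (Real.pi / (2 * γ) + ω' / γ)) (θ + (Real.pi / (2 * γ) + ω' / γ))
      (fun _ => r)) :
    rootVariable γ θ (powerVariable γ θ x) = x ∧ ∃ φ : ℝ, |φ| ≤ Real.pi / 2 + ω' ∧
      powerVariable γ θ x = ((1 / ‖x‖ ^ γ : ℝ) : ℂ) * Complex.exp (φ * Complex.I) := by
  have hγ' : (0 : ℝ) < γ := by exact_mod_cast hγ
  have hγc : (γ : ℂ) ≠ 0 := by exact_mod_cast hγ.ne'
  obtain ⟨t, ht, hx0, -, hxe⟩ := mem_sector_iff.1 hx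
  have hxc : (‖x‖ : ℂ) ≠ 0 := by exact_mod_cast hx0.ne'
  have hφ : |γ * (θ - t)| < Real.pi / 2 + ω' := by
    have e : Real.pi / (2 * γ) + ω' / γ = (Real.pi / 2 + ω') / γ := by field_simp
    rw [e] at ht
    have h1 : |θ - t| < (Real.pi / 2 + ω') / γ := by
      rw [abs_lt]; constructor <;> linarith [ht.1, ht.2]
    rw [abs_mul, abs_of_pos hγ']
    rw [lt_div_iff₀ hγ'] at h1
    linarith
  have hu : powerVariable γ θ x =
      ((1 / ‖x‖ ^ γ : ℝ) : ℂ) * Complex.exp ((γ * (θ - t) : ℝ) * Complex.I) := by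
    rw [powerVariable]
    nth_rw 1 [hxe]
    rw [mul_pow, ← Complex.exp_nat_mul]
    have he : Complex.exp (γ * θ * Complex.I) = Complex.exp ((γ * (θ - t) : ℝ) * Complex.I) *
        Complex.exp (γ * (t * Complex.I)) := by
      rw [← Complex.exp_add]
      congr 1
      push_cast
      ring
    rw [he]
    have := Complex.exp_ne_zero (γ * (t * Complex.I))
    push_cast
    field_simp
  refine ⟨?_, γ * (θ - t), hφ.le, hu⟩
  have hpos : (0 : ℝ) < 1 / ‖x‖ ^ γ := by positivity
  have hlog : Complex.log (powerVariable γ θ x) =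
      Real.log (1 / ‖x‖ ^ γ) + (γ * (θ - t) : ℝ) * Complex.I := by
    rw [hu, Complex.log_ofReal_mul hpos (Complex.exp_ne_zero _), Complex.log_exp]
    · have := (abs_lt.1 hφ).1
      rw [Complex.im_ofReal_mul, Complex.I_im, mul_one]
      linarith
    · have := (abs_lt.1 hφ).2
      rw [Complex.im_ofReal_mul, Complex.I_im, mul_one]
      linarith
  have hu0 : powerVariable γ θ x ≠ 0 := by
    rw [powerVariable]
    exact div_ne_zero (Complex.exp_ne_zero _) (pow_ne_zero _ (norm_pos_iff.1 hx0))
  rw [rootVariable, Complex.cpow_def_of_ne_zero hu0, hlog, ← Complex.exp_add, one_div, Real.log_inv,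
    Real.log_pow]
  have e : θ * Complex.I + (((-(γ * Real.log ‖x‖) : ℝ) : ℂ) + (γ * (θ - t) : ℝ) * Complex.I) *
      -(1 / γ : ℂ) = Real.log ‖x‖ + t * Complex.I := by
    push_cast
    field_simp
    ring
  rw [e, Complex.exp_add, ← Complex.ofReal_exp, Real.exp_log hx0]
  exact hxe.symm

theorem hasDerivAt_powerVariable {x : ℂ} (hx : x ≠ 0) :
    HasDerivAt (powerVariable γ θ) (-(γ * Complex.exp (γ * θ * Complex.I)) / x ^ (γ + 1)) x := by
  have h := ((hasDerivAt_pow γ x).inv (pow_ne_zero _ hx)).const_mul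
    (Complex.exp (γ * θ * Complex.I))
  refine (h.congr_of_eventuallyEq (Filter.Eventually.of_forall fun y => ?_)).congr_deriv ?_
  · simp [powerVariable, div_eq_mul_inv]
  · rcases γ with _ | k
    · simp
    · rw [Nat.add_sub_cancel]
      field_simp
      ring

end Variable

/-! ### One column of the transformation on a fixed sector. -/

section Column

open Filter

variable {n γ : ℕ} {θ ε₀ : ℝ} {lam : Fin n → ℂ}

/-- The coefficient `ν` of the equation in the variable `u`. -/
noncomputable def rotatedCoeff (γ : ℕ) (θ : ℝ) (μ : ℂ) : ℂ :=
  1 / (γ * Complex.exp (γ * θ * Complex.I)) * μ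

theorem norm_exp_gamma_theta (γ : ℕ) (θ : ℝ) : ‖Complex.exp (γ * θ * Complex.I)‖ = 1 := by
  have := Complex.norm_exp_ofReal_mul_I (γ * θ)
  push_cast at this
  exact this

/-- Modulo `2π`, `arg(λ_i - λ_j)` is `γ θ + arg ν`, so `θ + arg ν / γ` is a singular direction. It
cannot be within `ε₀` of `θ`. -/
theorem le_abs_arg_rotatedCoeff (hγ : 0 < γ) (hlam : Function.Injective lam)
    (hdisj : Disjoint (Set.Ioo (θ - ε₀) (θ + ε₀)) (singularDirections γ lam)) {i j : Fin n}
    (hij : i ≠ j) : γ * ε₀ ≤ |Complex.arg (rotatedCoeff γ θ (lam i - lam j))| := by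
  by_contra hcon
  push Not at hcon
  have hγ' : (0 : ℝ) < γ := by exact_mod_cast hγ
  have hγc : (γ : ℂ) ≠ 0 := by exact_mod_cast hγ.ne'
  set μ := lam i - lam j with hμ
  have hμ0 : μ ≠ 0 := sub_ne_zero.2 fun h => hij (hlam h)
  set ν := rotatedCoeff γ θ μ with hν
  set a := Complex.arg ν with ha
  have hmem : θ + a / γ ∈ Set.Ioo (θ - ε₀) (θ + ε₀) := by
    have h1 : |a / γ| < ε₀ := by
      rw [abs_div, abs_of_pos hγ', div_lt_iff₀ hγ']; linarith
    have := abs_lt.1 h1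
    constructor <;> linarith
  refine Set.disjoint_left.1 hdisj hmem ⟨i, j, hij, ?_⟩
  have hμe : μ = γ * Complex.exp (γ * θ * Complex.I) * ν := by
    have := Complex.exp_ne_zero (γ * θ * Complex.I)
    rw [hν, rotatedCoeff]
    field_simp
  have hnorm : ‖μ‖ = γ * ‖ν‖ := by
    rw [hμe, norm_mul, norm_mul, norm_exp_gamma_theta, Complex.norm_natCast, mul_one]
  have hn0 : (‖μ‖ : ℂ) ≠ 0 := by exact_mod_cast (norm_pos_iff.2 hμ0).ne'
  have hexp : Complex.exp (Complex.arg μ * Complex.I) =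
      Complex.exp ((γ * θ + a) * Complex.I) := by
    apply mul_left_cancel₀ hn0
    rw [Complex.norm_mul_exp_arg_mul_I, hnorm, add_mul, Complex.exp_add, hμe]
    conv_lhs => rw [← Complex.norm_mul_exp_arg_mul_I ν]
    push_cast
    ring
  obtain ⟨k, hk⟩ := Complex.exp_eq_exp_iff_exists_int.1 hexp
  have hk' : Complex.arg μ = γ * θ + a + k * (2 * Real.pi) := by
    have := congrArg Complex.im hk
    simpa using this
  refine ⟨-k, ?_⟩
  rw [hk']
  push_cast
  field_simp
  ring

/-- The rotated coefficients of `(i, j)` and `(j, i)` are opposite, hence cannot both have negative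
real part. This keeps the arguments of `u` within `(-π, π)` as soon as there are two eigenvalues. -/
theorem mul_le_pi_div_two (hγ : 0 < γ) (hlam : Function.Injective lam)
    (hdisj : Disjoint (Set.Ioo (θ - ε₀) (θ + ε₀)) (singularDirections γ lam)) {i j : Fin n}
    (hij : i ≠ j) : γ * ε₀ ≤ Real.pi / 2 := by
  by_contra hcon
  push Not at hcon
  have h1 := hcon.trans_le (le_abs_arg_rotatedCoeff hγ hlam hdisj hij)
  have h2 := hcon.trans_le (le_abs_arg_rotatedCoeff hγ hlam hdisj hij.symm)
  rw [← not_le, Complex.abs_arg_le_pi_div_two_iff, not_le] at h1 h2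
  have : rotatedCoeff γ θ (lam j - lam i) = -rotatedCoeff γ θ (lam i - lam j) := by
    rw [rotatedCoeff, rotatedCoeff]; ring
  rw [this, Complex.neg_re] at h2
  linarith

/-- The directions and `c₀` do not depend on `R` and `C`, so the scale may be chosen afterwards in
terms of `c₀`. -/
theorem exists_decayDirections (hγ : 0 < γ) (hlam : Function.Injective lam)
    (hdisj : Disjoint (Set.Ioo (θ - ε₀) (θ + ε₀)) (singularDirections γ lam)) {ω : ℝ}
    (hω : 0 < ω) (hω' : ω < γ * ε₀) (j : Fin n) :
    ∃ (w : Fin n → ℂ) (c₀ : ℝ), 0 < c₀ ∧ ∀ i, i ≠ j → ∀ R C : ℝ, 0 < R → 0 ≤ C →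
      IsDecayDirection (halfPlanes ω R) (fun u => C / planeGauge ω u) c₀
        (rotatedCoeff γ θ (lam i - lam j)) (w i) := by
  have hex : ∀ i, ∃ σ : ℝ, i ≠ j → |σ| = 1 ∧
      (rotatedCoeff γ θ (lam i - lam j) * ⟨Real.sin ω, σ * Real.cos ω⟩).re < 0 := by
    intro i
    by_cases hij : i = j
    · exact ⟨0, fun h => absurd hij h⟩
    have hγc : (γ : ℂ) ≠ 0 := by exact_mod_cast hγ.ne'
    have hν : rotatedCoeff γ θ (lam i - lam j) ≠ 0 := by
      rw [rotatedCoeff]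
      exact mul_ne_zero (one_div_ne_zero (mul_ne_zero hγc (Complex.exp_ne_zero _)))
        (sub_ne_zero.2 fun h => hij (hlam h))
    obtain ⟨σ, h1, h2⟩ := exists_direction hν
      (hω'.trans_le (le_abs_arg_rotatedCoeff hγ hlam hdisj hij)) hω
    exact ⟨σ, fun _ => ⟨h1, h2⟩⟩
  choose σ hσ using hex
  have hev : ∀ᶠ c : ℝ in nhdsWithin 0 (Set.Ioi 0), ∀ i, i ≠ j →
      (rotatedCoeff γ θ (lam i - lam j) * ⟨Real.sin ω, σ i * Real.cos ω⟩).re ≤ -c := by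
    refine eventually_all.2 fun i => ?_
    by_cases hij : i = j
    · exact Eventually.of_forall fun _ h => absurd hij h
    have := (hσ i hij).2
    filter_upwards [mem_nhdsWithin_of_mem_nhds (Iio_mem_nhds (neg_pos.2 this))] with c hc _
    have hc : c < _ := hc
    linarith
  obtain ⟨c₀, hc, hc0⟩ := (hev.and self_mem_nhdsWithin).exists
  refine ⟨fun i => ⟨Real.sin ω, σ i * Real.cos ω⟩, c₀, hc0, fun i hij R C hR hC => ?_⟩
  have hω2 : ω ≤ Real.pi / 2 := hω'.le.trans (mul_le_pi_div_two hγ hlam hdisj hij)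
  have hcos : 0 ≤ Real.cos ω := Real.cos_nonneg_of_mem_Icc ⟨by linarith, hω2⟩
  have hsin : 0 ≤ Real.sin ω := Real.sin_nonneg_of_nonneg_of_le_pi hω.le (by linarith)
  exact ⟨hc0, hc i hij, norm_direction (hσ i hij).1 ω,
    fun u hu s hs => lt_of_lt_of_le hu (planeGauge_add_le hcos hsin (hσ i hij).1 u hs),
    fun u hu s hs => div_le_div_of_nonneg_left hC (hR.trans hu)
      (planeGauge_add_le hcos hsin (hσ i hij).1 u hs)⟩

/-- The exact value `|X|^γ = c^γ / ‖u‖` need not decrease along the directions of integration. The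
larger `c^γ / planeGauge` never increases there, which is why gauges are kept apart from `|X|^γ`. -/
theorem isGauge_halfPlanes (hγ : 0 < γ) {ω c : ℝ} (hc : 0 < c) :
    IsGauge γ (halfPlanes ω (c ^ γ)) (fun u => c * rootVariable γ θ u)
      (fun u => c ^ γ / planeGauge ω u) where
  pos := hγ
  isOpen := isOpen_halfPlanes _ _
  pow_le u hu := by
    have hd : 0 < planeGauge ω u := (pow_pos hc γ).trans hu
    rw [norm_mul, mul_pow, norm_rootVariable_pow hγ, Complex.norm_real, Real.norm_of_nonneg hc.le,
      mul_one_div]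
    exact div_le_div_of_nonneg_left (by positivity) hd (planeGauge_le_norm ω u)
  le_one u hu := by
    have hd : 0 < planeGauge ω u := (pow_pos hc γ).trans hu
    exact (div_le_one hd).2 (le_of_lt hu)

/-- Functions tending to zero have small norm at small scales. -/
theorem LocalGevrey.eventually_small {α β : ℝ} (hγ : 0 < γ) (hαβ : α < β) {f : ℂ → ℂ}
    (hf : LocalGevrey γ α β f) (h0 : SectorTendsto α β f 0) {α' β' : ℝ} (hα : α < α')
    (hβ : β' < β) {σ : ℝ} (hσ : 0 < σ) :
    ∀ᶠ c : ℝ in atTop, ∃ A, PowerSeries.coeff 0 A = 0 ∧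
      GevreyBound γ (sector α' β' (fun _ => 1 / c)) (fun x => c * x) (fun x => (c * ‖x‖) ^ γ)
        (f, A) σ := by
  obtain ⟨A, hA⟩ := hf.exists_series hγ hαβ
  have hA0 : PowerSeries.coeff 0 A = 0 := (sectorTendsto_of_series hγ hA).unique hαβ h0
  obtain ⟨c, ⟨M, hM⟩, hc⟩ := ((hA α' β' hα hβ).and (eventually_gt_atTop 0)).exists
  have hM0 := hM.nonneg
  -- Passing from the scale `c` to a finer scale `C` is a rescaling by `s = c / C`, which brings the
  -- norm down to `(1 + γ) M c / C`.
  filter_upwards [eventually_ge_atTop c, eventually_ge_atTop ((1 + γ) * M * c / σ)] with C h1 h2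
  have hC : 0 < C := hc.trans_le h1
  refine ⟨_, ?_, (hM.rescale_small hγ (s := c / C) ?_ (by positivity) ((div_le_one hC).2 h1)
    (sector_mono le_rfl le_rfl (one_div_le_one_div_of_le hc h1)) (isGauge_sector hγ _ _ hC)
    (fun u _ => ?_) (fun u _ => ?_)).mono_const (isGauge_sector hγ _ _ hC) ?_⟩
  · rw [PowerSeries.coeff_rescale, PowerSeries.coeff_rescale, hA0]; simp
  · rw [PowerSeries.coeff_rescale, hA0]; simp
  · have : (C : ℂ) ≠ 0 := by exact_mod_cast hC.ne'
    push_cast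
    field_simp
  · rw [← mul_pow]
    congr 1
    field_simp
  · rw [← mul_div_assoc, div_le_iff₀ hC]
    rw [div_le_iff₀ hσ] at h2
    linarith

/-- The vector `q` completes the `j`-th vector of the standard basis to the `j`-th column of a
transformation that diagonalizes the system, on the sector `(α, β)`. -/
structure IsColumn (γ : ℕ) (A : ℂ → Matrix (Fin n) (Fin n) ℂ) (lam : Fin n → ℂ) (j : Fin n)
    (α β : ℝ) (q : ℂ → Fin n → ℂ) : Prop where
  self : ∀ x, q x j = 0
  gevrey : ∀ i, LocalGevrey γ α β (fun x => q x i)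
  tendsto : ∀ i, SectorTendsto α β (fun x => q x i) 0
  ode : ∀ α' β', α < α' → β' < β → ∃ r > 0, ∀ x ∈ sector α' β' (fun _ => r), ∀ i, i ≠ j →
    HasDerivAt (fun x => q x i) (((lam i - lam j) * q x i +
      riccati 1 (A x - Matrix.diagonal lam) j (q x) i) / x ^ (γ + 1)) x

theorem IsColumn.mono {A : ℂ → Matrix (Fin n) (Fin n) ℂ} {j : Fin n} {α β α' β' : ℝ}
    {q : ℂ → Fin n → ℂ} (h : IsColumn γ A lam j α β q) (hα : α ≤ α') (hβ : β' ≤ β) :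
    IsColumn γ A lam j α' β' q where
  self := h.self
  gevrey i := (h.gevrey i).mono hα hβ
  tendsto i := fun a b ha hb => h.tendsto i a b (hα.trans_lt ha) (hb.trans_le hβ)
  ode := fun a b ha hb => h.ode a b (hα.trans_lt ha) (hb.trans_le hβ)

theorem riccati_eq_mul {ι : Type*} [Fintype ι] [DecidableEq ι] (τ : ℂ) (A : Matrix ι ι ℂ) (j : ι)
    (q : ι → ℂ) (i : ι) : riccati τ A j q i = τ * riccati 1 A j q i := by
  simp [riccati]

variable {A : ℂ → Matrix (Fin n) (Fin n) ℂ}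

/-- A closed subsector of the sector of half opening `π / (2 γ) + ε` lies in a smaller one. -/
theorem exists_lt_of_subsector {ε α' β' : ℝ} (hα : θ - (Real.pi / (2 * γ) + ε) < α')
    (hβ : β' < θ + (Real.pi / (2 * γ) + ε)) :
    ∃ ε' < ε, θ - (Real.pi / (2 * γ) + ε') ≤ α' ∧ β' ≤ θ + (Real.pi / (2 * γ) + ε') := by
  refine ⟨max (θ - α') (β' - θ) - Real.pi / (2 * γ), ?_, ?_, ?_⟩
  · have : max (θ - α') (β' - θ) < Real.pi / (2 * γ) + ε := max_lt (by linarith) (by linarith)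
    linarith
  · linarith [le_max_left (θ - α') (β' - θ)]
  · linarith [le_max_right (θ - α') (β' - θ)]

theorem powerVariable_mem_halfPlanes (hγ : 0 < γ) {ε ε' : ℝ} (hε' : ε' < ε) (hε : 0 < ε)
    (hεπ : γ * ε < Real.pi / 2) :
    ∃ s₀ > 0, ∀ r x, x ∈ sector (θ - (Real.pi / (2 * γ) + ε')) (θ + (Real.pi / (2 * γ) + ε'))
      (fun _ => r) → rootVariable γ θ (powerVariable γ θ x) = x ∧
        s₀ / ‖x‖ ^ γ ≤ planeGauge (γ * ε) (powerVariable γ θ x) := by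
  have hγ' : (0 : ℝ) < γ := by exact_mod_cast hγ
  obtain ⟨s₀, hs, h⟩ := exists_le_planeGauge (ω := γ * ε) (ω' := γ * ε')
    (by gcongr) (by positivity) hεπ
  refine ⟨s₀, hs, fun r x hx => ?_⟩
  have hx' : x ∈ sector (θ - (Real.pi / (2 * γ) + γ * ε' / γ))
      (θ + (Real.pi / (2 * γ) + γ * ε' / γ)) (fun _ => r) := by
    rwa [mul_div_cancel_left₀ _ hγ'.ne']
  have hlt : γ * ε' < Real.pi / 2 := lt_trans (by gcongr) hεπ
  obtain ⟨h1, φ, hφ, h2⟩ := rootVariable_powerVariable hγ hlt hx'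
  refine ⟨h1, ?_⟩
  rw [h2]
  refine le_trans (le_of_eq ?_) (h _ φ (by positivity) hφ)
  rw [one_div_mul_eq_div]

/-- The coefficients are pulled back to the half planes with `ω = γ ε`, where the contraction
applies. The solution is pushed back to smaller subsectors, on which the gauge is comparable with
`‖x‖^γ`. -/
theorem exists_column_of_lt (hγ : 0 < γ) (hlam : Function.Injective lam)
    (hdisj : Disjoint (Set.Ioo (θ - ε₀) (θ + ε₀)) (singularDirections γ lam))
    (hε₀ : γ * ε₀ ≤ Real.pi / 2)
    (hA : ∀ i k, LocalGevrey γ (θ - (Real.pi / (2 * γ) + ε₀)) (θ + (Real.pi / (2 * γ) + ε₀))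
      (fun x => (A x - Matrix.diagonal lam) i k))
    (hA0 : ∀ i k, SectorTendsto (θ - (Real.pi / (2 * γ) + ε₀)) (θ + (Real.pi / (2 * γ) + ε₀))
      (fun x => (A x - Matrix.diagonal lam) i k) 0) (j : Fin n) {ε : ℝ} (hε : 0 < ε)
    (hεε₀ : ε < ε₀) :
    ∃ q, IsColumn γ A lam j (θ - (Real.pi / (2 * γ) + ε)) (θ + (Real.pi / (2 * γ) + ε)) q := by
  have hγ' : (0 : ℝ) < γ := by exact_mod_cast hγ
  have hγc : (γ : ℂ) ≠ 0 := by exact_mod_cast hγ.ne'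
  have hπ : 0 < Real.pi / (2 * γ) := by positivity
  have hω : 0 < γ * ε := by positivity
  have hω' : γ * ε < γ * ε₀ := by gcongr
  have hω2 : γ * ε < Real.pi / 2 := hω'.trans_le hε₀
  have hcos : 0 ≤ Real.cos (γ * ε) := Real.cos_nonneg_of_mem_Icc ⟨by linarith, hω2.le⟩
  set κ := Complex.exp (γ * θ * Complex.I) with hκ
  have hκ0 : κ ≠ 0 := Complex.exp_ne_zero _
  have hκ1 : ‖κ‖ = 1 := norm_exp_gamma_theta γ θ
  set τ : ℂ := 1 / (γ * κ) with hτ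
  obtain ⟨w, c₀, hc₀, hw⟩ := exists_decayDirections hγ hlam hdisj hω hω' j
  set L := 2 * (1 + γ) / c₀ * GevreyBound.riccatiConst γ n τ with hL
  have hL0 : 0 ≤ L := by
    have := GevreyBound.mulConst_nonneg γ
    rw [hL, GevreyBound.riccatiConst]; positivity
  set σ := 1 / (2 * (L + 1)) with hσ
  have hσ0 : 0 < σ := by positivity
  have hev : ∀ᶠ c : ℝ in atTop, ∀ i k, ∃ B, PowerSeries.coeff 0 B = 0 ∧
      GevreyBound γ (sector (θ - (Real.pi / (2 * γ) + ε)) (θ + (Real.pi / (2 * γ) + ε))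
        (fun _ => 1 / c)) (fun x => c * x) (fun x => (c * ‖x‖) ^ γ)
        (fun x => (A x - Matrix.diagonal lam) i k, B) σ :=
    eventually_all.2 fun i => eventually_all.2 fun k =>
      (hA i k).eventually_small hγ (by linarith) (hA0 i k) (by linarith) (by linarith) hσ0
  have hpowlim : Tendsto (fun c : ℝ => c ^ γ) atTop atTop := tendsto_pow_atTop hγ.ne'
  -- A large `c` serves two purposes: coefficients of norm at most `σ`, and `‖η‖ γ = 1 / c^γ ≤ c₀ /
  -- 2`, needed for the formal recursion.
  obtain ⟨c, hB, hc, hcc₀⟩ := (hev.and ((eventually_gt_atTop 0).and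
    (hpowlim.eventually_ge_atTop (2 / c₀)))).exists
  choose B hB0 hB using hB
  have hG := isGauge_halfPlanes (θ := θ) (ω := γ * ε) hγ hc
  set T := halfPlanes (γ * ε) (c ^ γ) with hT
  have hroot : ∀ u ∈ T, rootVariable γ θ u ∈ sector (θ - (Real.pi / (2 * γ) + ε))
      (θ + (Real.pi / (2 * γ) + ε)) (fun _ => 1 / c) := by
    intro u hu
    have := rootVariable_mem_sector (θ := θ) hγ hω.le hω2.le hc hu
    rwa [mul_div_cancel_left₀ _ hγ'.ne'] at this
  have hslit : ∀ u ∈ T, u ∈ Complex.slitPlane := fun u hu =>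
    mem_slitPlane_of_planeGauge_pos hcos ((pow_pos hc γ).trans hu)
  have hrootd : ∀ u ∈ T, HasDerivAt (rootVariable γ θ)
      (-(1 / (γ * κ)) * rootVariable γ θ u ^ (γ + 1)) u := fun u hu =>
    hasDerivAt_rootVariable hγ (hslit u hu)
  have hpull : ∀ i k, GevreyBound γ T (fun u => c * rootVariable γ θ u)
      (fun u => c ^ γ / planeGauge (γ * ε) u)
      ((fun u => (A (rootVariable γ θ u) - Matrix.diagonal lam) i k),
        PowerSeries.rescale ((1 : ℝ) : ℂ) (B i k)) σ := by
    intro i k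
    refine (hB i k).comp one_pos le_rfl
      (fun u hu => (hrootd u hu).differentiableAt.differentiableWithinAt) hroot
      (fun u _ => by simp) (fun u _ => by positivity) fun u hu => ?_
    rw [mul_pow, norm_rootVariable_pow hγ, mul_one_div]
    exact div_le_div_of_nonneg_left (by positivity) ((pow_pos hc γ).trans hu)
      (planeGauge_le_norm _ u)
  set η : ℂ := 1 / (γ * κ * c ^ γ) with hη
  have hcc : (c : ℂ) ≠ 0 := by exact_mod_cast hc.ne'
  have hηn : ‖η‖ * γ = 1 / c ^ γ := by
    rw [hη, norm_div, norm_mul, norm_mul, hκ1, norm_pow, Complex.norm_real,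
      Real.norm_of_nonneg hc.le, Complex.norm_natCast, norm_one]
    field_simp
  have hν : ∀ i, i ≠ j → c₀ ≤ ‖rotatedCoeff γ θ (lam i - lam j)‖ := fun i hi =>
    (hw i hi 1 1 one_pos zero_le_one).le_norm
  obtain ⟨Q, hQj, hQ0, hQ1, hQode⟩ := GevreyBound.exists_riccati_solution hG (η := η) (τ := τ) j
    (ν := fun i => rotatedCoeff γ θ (lam i - lam j)) (w := w) hc₀ (σ := σ)
    (fun u hu => by
      refine ((hrootd u hu).const_mul (c : ℂ)).congr_deriv ?_
      rw [mul_pow, hη, pow_succ (c : ℂ)]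
      field_simp)
    (fun i hi => by
      rw [hηn]
      have h1 := hν i hi
      have h2 : 1 / c ^ γ ≤ c₀ / 2 := by
        rw [div_le_iff₀ (pow_pos hc γ)]
        rw [div_le_iff₀ hc₀] at hcc₀
        linarith
      linarith)
    (fun i hi => hw i hi _ _ (pow_pos hc γ) (by positivity))
    (A := Matrix.of fun i k => ((fun u => (A (rootVariable γ θ u) - Matrix.diagonal lam) i k),
        PowerSeries.rescale ((1 : ℝ) : ℂ) (B i k))) hpull
    (fun i k => by simp only [Matrix.of_apply, PowerSeries.coeff_rescale, hB0, mul_zero])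
    (by
      rw [Fintype.card_fin, ← mul_assoc, ← hL, hσ]
      rw [mul_one_div, div_le_div_iff₀ (by positivity) two_pos]
      linarith)
  have hsub : ∀ α' β', θ - (Real.pi / (2 * γ) + ε) < α' → β' < θ + (Real.pi / (2 * γ) + ε) →
      ∀ᶠ C : ℝ in atTop, 0 < C ∧ (∀ x ∈ sector α' β' (fun _ => 1 / C),
        powerVariable γ θ x ∈ T ∧ rootVariable γ θ (powerVariable γ θ x) = x) ∧
        ∀ i, GevreyBound γ (sector α' β' (fun _ => 1 / C)) (fun x => C * x)
          (fun x => (C * ‖x‖) ^ γ) ((fun x => (Q i).1 (powerVariable γ θ x)),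
            PowerSeries.rescale ((c / C : ℝ) : ℂ) (Q i).2) 1 := by
    intro α' β' hα hβ
    obtain ⟨ε', hε', hα', hβ'⟩ := exists_lt_of_subsector hα hβ
    obtain ⟨s₀, hs₀, hs⟩ := powerVariable_mem_halfPlanes (θ := θ) hγ hε' hε hω2
    -- The condition `c^γ ≤ s₀ C^γ` ensures both that `u` lies in `T` and that the gauge at scale
    -- `c` is at most `(C ‖x‖)^γ`.
    filter_upwards [eventually_ge_atTop c, hpowlim.eventually_ge_atTop (c ^ γ / s₀)] with C hC1 hC2
    have hC : 0 < C := hc.trans_le hC1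
    rw [div_le_iff₀ hs₀] at hC2
    have hx : ∀ x ∈ sector α' β' (fun _ => 1 / C), 0 < ‖x‖ ∧ C * ‖x‖ < 1 ∧
        rootVariable γ θ (powerVariable γ θ x) = x ∧
        s₀ / ‖x‖ ^ γ ≤ planeGauge (γ * ε) (powerVariable γ θ x) := by
      intro x hx
      obtain ⟨h1, h2⟩ := hs _ x (sector_mono hα' hβ' le_rfl hx)
      refine ⟨norm_pos_of_mem_sector hx, ?_, h1, h2⟩
      have := norm_lt_of_mem_sector hx
      rw [lt_div_iff₀ hC] at this
      linarith
    have hmem : ∀ x ∈ sector α' β' (fun _ => 1 / C), powerVariable γ θ x ∈ T := by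
      intro x hxm
      obtain ⟨h0, h1, -, h2⟩ := hx x hxm
      refine lt_of_lt_of_le ?_ h2
      rw [lt_div_iff₀ (by positivity)]
      calc c ^ γ * ‖x‖ ^ γ ≤ C ^ γ * s₀ * ‖x‖ ^ γ := by gcongr
        _ = s₀ * (C * ‖x‖) ^ γ := by rw [mul_pow]; ring
        _ < s₀ * 1 := by
            gcongr
            exact pow_lt_one₀ (by positivity) h1 hγ.ne'
        _ = s₀ := mul_one _
    refine ⟨hC, fun x hxm => ⟨hmem x hxm, (hx x hxm).2.2.1⟩, fun i => ?_⟩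
    refine (hQ1 i).comp (s := c / C) (by positivity) ((div_le_one hC).2 hC1) (fun x hxm => ?_) hmem
      (fun x hxm => ?_) (fun x hxm => ?_) fun x hxm => ?_
    · exact (hasDerivAt_powerVariable (norm_pos_iff.1
        (hx x hxm).1)).differentiableAt.differentiableWithinAt
    · rw [(hx x hxm).2.2.1]
      have : (C : ℂ) ≠ 0 := by exact_mod_cast hC.ne'
      push_cast
      field_simp
    · exact GevreyBound.gauge_nonneg hG (hmem x hxm)
    · obtain ⟨h0, h1, -, h2⟩ := hx x hxm
      have hd : 0 < planeGauge (γ * ε) (powerVariable γ θ x) :=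
        (pow_pos hc γ).trans (hmem x hxm)
      rw [div_le_iff₀ hd, mul_pow]
      calc c ^ γ ≤ C ^ γ * ‖x‖ ^ γ * (s₀ / ‖x‖ ^ γ) := by
            have : C ^ γ * ‖x‖ ^ γ * (s₀ / ‖x‖ ^ γ) = C ^ γ * s₀ := by field_simp
            rw [this]
            exact hC2
        _ ≤ _ := by gcongr
  refine ⟨fun x i => (Q i).1 (powerVariable γ θ x), fun x => hQj _, fun i α' β' hα hβ => ?_,
    fun i α' β' hα hβ ρ hρ => ?_, fun α' β' hα hβ => ?_⟩
  · filter_upwards [hsub α' β' hα hβ] with C hC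
    exact ⟨_, _, hC.2.2 i⟩
  · obtain ⟨C, hC, -, h⟩ := (hsub α' β' hα hβ).exists
    have := (h i).exists_radius hγ hC hρ
    rwa [PowerSeries.coeff_rescale, hQ0, mul_zero] at this
  · obtain ⟨C, hC, hx, -⟩ := (hsub α' β' hα hβ).exists
    refine ⟨1 / C, by positivity, fun x hxm i hi => ?_⟩
    obtain ⟨h1, h2⟩ := hx x hxm
    have hx0 : x ≠ 0 := norm_pos_iff.1 (norm_pos_of_mem_sector hxm)
    have hd := HasDerivAt.comp x (hQode i hi _ h1) (hasDerivAt_powerVariable (γ := γ) (θ := θ) hx0)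
    refine hd.congr_deriv ?_
    have hmap : (Matrix.of fun i k => ((fun u => (A (rootVariable γ θ u) - Matrix.diagonal lam) i k,
        PowerSeries.rescale ((1 : ℝ) : ℂ) (B i k)) : (ℂ → ℂ) × PowerSeries ℂ)).map
        (fun e => e.1 (powerVariable γ θ x)) = A x - Matrix.diagonal lam := by
      ext i k
      simp [h2]
    rw [hmap, riccati_eq_mul τ, rotatedCoeff, hτ]
    field_simp
    ring

/-- Only the limit `0` and the equation are used: near the origin both columns are bounded by `1`,
and `riccati_unique` applies in the variable `u` on a sector of intermediate opening. -/
theorem IsColumn.eq_of_lt (hγ : 0 < γ) (hlam : Function.Injective lam)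
    (hdisj : Disjoint (Set.Ioo (θ - ε₀) (θ + ε₀)) (singularDirections γ lam))
    (hε₀ : γ * ε₀ ≤ Real.pi / 2)
    (hA0 : ∀ i k, SectorTendsto (θ - (Real.pi / (2 * γ) + ε₀)) (θ + (Real.pi / (2 * γ) + ε₀))
      (fun x => (A x - Matrix.diagonal lam) i k) 0) {j : Fin n} {ε ε' : ℝ} (hε : 0 < ε)
    (hεε₀ : ε ≤ ε₀) (hε' : ε' < ε) {q q' : ℂ → Fin n → ℂ}
    (hq : IsColumn γ A lam j (θ - (Real.pi / (2 * γ) + ε)) (θ + (Real.pi / (2 * γ) + ε)) q)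
    (hq' : IsColumn γ A lam j (θ - (Real.pi / (2 * γ) + ε)) (θ + (Real.pi / (2 * γ) + ε)) q') :
    ∃ r > 0, ∀ x ∈ sector (θ - (Real.pi / (2 * γ) + ε')) (θ + (Real.pi / (2 * γ) + ε'))
      (fun _ => r), q x = q' x := by
  have hγ' : (0 : ℝ) < γ := by exact_mod_cast hγ
  have hγc : (γ : ℂ) ≠ 0 := by exact_mod_cast hγ.ne'
  obtain ⟨δ, hδ1, hδ2⟩ := exists_between (max_lt hε' hε)
  have hδε' : ε' < δ := (le_max_left _ _).trans_lt hδ1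
  have hδ0 : 0 < δ := (le_max_right _ _).trans_lt hδ1
  have hω : 0 < γ * δ := by positivity
  have hω' : γ * δ < γ * ε₀ := by gcongr; linarith
  have hω2 : γ * δ < Real.pi / 2 := hω'.trans_le hε₀
  have hcos : 0 ≤ Real.cos (γ * δ) := Real.cos_nonneg_of_mem_Icc ⟨by linarith, hω2.le⟩
  set κ := Complex.exp (γ * θ * Complex.I) with hκ
  have hκ0 : κ ≠ 0 := Complex.exp_ne_zero _
  set τ : ℂ := 1 / (γ * κ) with hτ
  obtain ⟨w, c₀, hc₀, hw⟩ := exists_decayDirections hγ hlam hdisj hω hω' j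
  set L := ‖τ‖ * (n * 4) / c₀ with hL
  have hL0 : 0 ≤ L := by positivity
  set σ := 1 / (2 * (L + 1)) with hσ
  have hσ0 : 0 < σ := by positivity
  have hα : θ - (Real.pi / (2 * γ) + ε) < θ - (Real.pi / (2 * γ) + δ) := by linarith
  have hβ : θ + (Real.pi / (2 * γ) + δ) < θ + (Real.pi / (2 * γ) + ε) := by linarith
  set S : ℝ → Set ℂ := fun r => sector (θ - (Real.pi / (2 * γ) + δ)) (θ + (Real.pi / (2 * γ) + δ))
    (fun _ => r) with hS
  have hSm : ∀ r r', r ≤ r' → S r ⊆ S r' := fun r r' h => sector_mono le_rfl le_rfl h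
  have hcombine : ∀ P : ℂ → Prop, (∃ r > 0, ∀ x ∈ S r, P x) →
      ∀ᶠ c : ℝ in atTop, ∀ x ∈ S (1 / c), P x := by
    rintro P ⟨r, hr, h⟩
    filter_upwards [eventually_ge_atTop (1 / r), eventually_gt_atTop 0] with c h1 h2 x hx
    exact h x (hSm _ _ (by rw [one_div_le h2 hr]; exact h1) hx)
  have h1 : ∀ᶠ c : ℝ in atTop, ∀ i, ∀ x ∈ S (1 / c), ‖q x i - 0‖ ≤ 1 :=
    eventually_all.2 fun i => hcombine _ (hq.tendsto i _ _ hα hβ 1 one_pos)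
  have h2 : ∀ᶠ c : ℝ in atTop, ∀ i, ∀ x ∈ S (1 / c), ‖q' x i - 0‖ ≤ 1 :=
    eventually_all.2 fun i => hcombine _ (hq'.tendsto i _ _ hα hβ 1 one_pos)
  have h3 : ∀ᶠ c : ℝ in atTop, ∀ i k, ∀ x ∈ S (1 / c),
      ‖(A x - Matrix.diagonal lam) i k - 0‖ ≤ σ :=
    eventually_all.2 fun i => eventually_all.2 fun k =>
      hcombine _ (hA0 i k _ _ (by linarith) (by linarith) σ hσ0)
  obtain ⟨c, h1, h2, h3, h4, h5, hc⟩ := (h1.and (h2.and (h3.and ((hcombine _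
    (hq.ode _ _ hα hβ)).and ((hcombine _ (hq'.ode _ _ hα hβ)).and
      (eventually_gt_atTop 0)))))).exists
  simp only [sub_zero] at h1 h2 h3
  set T := halfPlanes (γ * δ) (c ^ γ) with hT
  have hroot : ∀ u ∈ T, rootVariable γ θ u ∈ S (1 / c) := by
    intro u hu
    have := rootVariable_mem_sector (θ := θ) hγ hω.le hω2.le hc hu
    rwa [mul_div_cancel_left₀ _ hγ'.ne'] at this
  have hrootd : ∀ u ∈ T, HasDerivAt (rootVariable γ θ)
      (-(1 / (γ * κ)) * rootVariable γ θ u ^ (γ + 1)) u := fun u hu =>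
    hasDerivAt_rootVariable hγ
      (mem_slitPlane_of_planeGauge_pos hcos ((pow_pos hc γ).trans hu))
  have hode : ∀ q : ℂ → Fin n → ℂ, (∀ x ∈ S (1 / c), ∀ i, i ≠ j →
      HasDerivAt (fun x => q x i) (((lam i - lam j) * q x i +
        riccati 1 (A x - Matrix.diagonal lam) j (q x) i) / x ^ (γ + 1)) x) →
      ∀ i, i ≠ j → ∀ u ∈ T, HasDerivAt (fun u => q (rootVariable γ θ u) i)
        (-rotatedCoeff γ θ (lam i - lam j) * q (rootVariable γ θ u) i -
          riccati τ (A (rootVariable γ θ u) - Matrix.diagonal lam) j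
            (q (rootVariable γ θ u)) i) u := by
    intro q h i hi u hu
    have hx := hroot u hu
    have hx0 : rootVariable γ θ u ≠ 0 := norm_pos_iff.1 (norm_pos_of_mem_sector hx)
    refine (HasDerivAt.comp u (h _ hx i hi) (hrootd u hu)).congr_deriv ?_
    rw [riccati_eq_mul τ, rotatedCoeff, hτ]
    field_simp
    ring
  have hT1 : ∀ u ∈ T, ∀ i, q (rootVariable γ θ u) i = q' (rootVariable γ θ u) i :=
    riccati_unique (g := fun u => 1 / planeGauge (γ * δ) u) j hc₀ (τ := τ) (σ := σ)
      (ν := fun i => rotatedCoeff γ θ (lam i - lam j)) (w := w)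
      (fun i hi => hw i hi _ 1 (pow_pos hc γ) zero_le_one)
      (A := fun u => A (rootVariable γ θ u) - Matrix.diagonal lam)
      (q := fun u => q (rootVariable γ θ u)) (q' := fun u => q' (rootVariable γ θ u))
      (fun u hu i k => h3 i k _ (hroot u hu))
      (by
        have : ‖τ‖ * (Fintype.card (Fin n) * 4 * σ) / c₀ = L * σ := by
          rw [hL, Fintype.card_fin]; ring
        rw [this, hσ, mul_one_div, div_le_div_iff₀ (by positivity) two_pos]
        linarith)
      (fun u _ => hq.self _) (fun u _ => hq'.self _)
      (fun u hu i => h1 i _ (hroot u hu)) (fun u hu i => h2 i _ (hroot u hu))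
      (hode q h4) (hode q' h5)
  obtain ⟨s₀, hs₀, hs⟩ := powerVariable_mem_halfPlanes (θ := θ) hγ hδε' hδ0 hω2
  have hlim : Tendsto (fun C : ℝ => C ^ γ) atTop atTop := tendsto_pow_atTop hγ.ne'
  obtain ⟨C, hC1, hC2⟩ := ((hlim.eventually_ge_atTop (c ^ γ / s₀)).and
    (eventually_gt_atTop 0)).exists
  refine ⟨1 / C, by positivity, fun x hx => ?_⟩
  obtain ⟨e1, e2⟩ := hs _ x hx
  have hx0 := norm_pos_of_mem_sector hx
  have hx1 := norm_lt_of_mem_sector hx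
  rw [lt_div_iff₀ hC2] at hx1
  rw [div_le_iff₀ hs₀] at hC1
  have hmem : powerVariable γ θ x ∈ T := by
    refine lt_of_lt_of_le ?_ e2
    rw [lt_div_iff₀ (by positivity)]
    calc c ^ γ * ‖x‖ ^ γ ≤ C ^ γ * s₀ * ‖x‖ ^ γ := by gcongr
      _ = s₀ * (‖x‖ * C) ^ γ := by rw [mul_pow]; ring
      _ < s₀ * 1 := by
          gcongr
          exact pow_lt_one₀ (by positivity) hx1 hγ.ne'
      _ = s₀ := mul_one _
  funext i
  have := hT1 _ hmem i
  rwa [e1] at this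

end Column

/-! ### Gluing the columns as `ε` tends to `ε₀`. -/

section Gluing

open Filter

/-- At `x` the function of least index whose angular sector contains `x` is used. On the `k`-th
sector only the indices `m ≤ k` can occur, so finitely many radii of agreement are intersected. -/
theorem exists_glue {V : Type*} {α β : ℕ → ℝ} (f : ℕ → ℂ → V) (h : ∀ k l, k ≤ l → ∃ r > 0, ∀ x ∈ sector (α k) (β k) (fun _ => r),
      f k x = f l x) :
    ∃ F : ℂ → V, (∀ x, ∃ k, F x = f k x) ∧
      ∀ k, ∃ r > 0, ∀ x ∈ sector (α k) (β k) (fun _ => r), F x = f k x := by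
  classical
  have hF : ∀ x, ∃ y : V, (∃ k, y = f k x) ∧ ∀ k r, x ∈ sector (α k) (β k) (fun _ => r) →
      ∃ m ≤ k, x ∈ sector (α m) (β m) (fun _ => r) ∧ y = f m x := by
    intro x
    by_cases hx : ∃ k r, x ∈ sector (α k) (β k) (fun _ => r)
    · refine ⟨f (Nat.find hx) x, ⟨_, rfl⟩, fun k r hk => ⟨Nat.find hx, Nat.find_min' hx ⟨r, hk⟩,
        ?_, rfl⟩⟩
      obtain ⟨r', hr'⟩ := Nat.find_spec hx
      obtain ⟨t, ht, h0, -, he⟩ := mem_sector_iff.1 hr'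
      exact mem_sector_iff.2 ⟨t, ht, h0, norm_lt_of_mem_sector hk, he⟩
    · exact ⟨f 0 x, ⟨0, rfl⟩, fun k r hk => absurd ⟨k, r, hk⟩ hx⟩
  choose F hF1 hF2 using hF
  refine ⟨F, hF1, fun k => ?_⟩
  have hev : ∀ᶠ r : ℝ in nhdsWithin 0 (Set.Ioi 0), ∀ m ∈ Finset.range (k + 1),
      ∀ x ∈ sector (α m) (β m) (fun _ => r), f m x = f k x := by
    refine (Finset.eventually_all _).2 fun m hm => ?_
    obtain ⟨r, hr, hx⟩ := h m k (by have := Finset.mem_range.1 hm; omega)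
    filter_upwards [mem_nhdsWithin_of_mem_nhds (Iio_mem_nhds hr)] with s hs x hxs
    exact hx x (sector_mono le_rfl le_rfl (le_of_lt hs) hxs)
  obtain ⟨r, hr, hr0⟩ := (hev.and self_mem_nhdsWithin).exists
  refine ⟨r, hr0, fun x hx => ?_⟩
  obtain ⟨m, hm, hmx, he⟩ := hF2 x k r hx
  rw [he]
  exact hr m (Finset.mem_range.2 (by omega)) x hmx

/-- A set that contains all the closed subsectors near the origin contains a sectorial region. -/
theorem exists_radius_function {α β : ℝ} {U : Set ℂ}
    (hU : ∀ α' β', α < α' → β' < β → ∃ r > 0, sector α' β' (fun _ => r) ⊆ U) :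
    ∃ ρ, IsRadius α β ρ ∧ sector α β ρ ⊆ U := by
  classical
  set good : Set.Ioo α β → Set ℝ := fun t => {r | 0 < r ∧ ∀ s, 0 < s → s < r →
    (s : ℂ) * Complex.exp ((t : ℝ) * Complex.I) ∈ U} with hgood
  have hconv : ∀ t, Convex ℝ (good t) := by
    intro t
    refine Set.OrdConnected.convex ⟨fun a ha b hb c hc => ⟨ha.1.trans_le hc.1, fun s hs hsc =>
      hb.2 s hs (hsc.trans_le hc.2)⟩⟩
  -- The admissible radii at each angle form a convex set, and locally a constant one works; a
  -- partition of unity yields a continuous choice.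
  obtain ⟨g, hg⟩ := exists_continuous_forall_mem_convex_of_local_const hconv (fun t => by
    obtain ⟨a, ha1, ha2⟩ := exists_between t.2.1
    obtain ⟨b, hb1, hb2⟩ := exists_between t.2.2
    obtain ⟨r, hr, hsub⟩ := hU a b ha1 hb2
    refine ⟨r, ?_⟩
    have : ∀ᶠ y : Set.Ioo α β in nhds t, (y : ℝ) ∈ Set.Ioo a b :=
      continuous_subtype_val.continuousAt.eventually (Ioo_mem_nhds ha2 hb1)
    filter_upwards [this] with y hy
    exact ⟨hr, fun s hs hsr => hsub ⟨y, hy, s, hs, hsr, rfl⟩⟩)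
  refine ⟨fun t => if h : t ∈ Set.Ioo α β then g ⟨t, h⟩ else 1, ⟨?_, fun t ht => ?_⟩, ?_⟩
  · rw [continuousOn_iff_continuous_domRestrict]
    convert g.continuous using 1
    ext t
    simp only [Set.domRestrict_apply, dif_pos t.2]
  · simp only [dif_pos ht]
    exact (hg ⟨t, ht⟩).1
  · rintro x ⟨t, ht, s, hs, hsr, rfl⟩
    simp only [dif_pos ht] at hsr
    exact (hg ⟨t, ht⟩).2 s hs hsr

variable {n γ : ℕ} {θ ε₀ : ℝ} {lam : Fin n → ℂ} {A : ℂ → Matrix (Fin n) (Fin n) ℂ}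

theorem exists_column (hγ : 0 < γ) (hlam : Function.Injective lam) (hε₀ : 0 < ε₀)
    (hdisj : Disjoint (Set.Ioo (θ - ε₀) (θ + ε₀)) (singularDirections γ lam))
    (hA : ∀ i k, LocalGevrey γ (θ - (Real.pi / (2 * γ) + ε₀)) (θ + (Real.pi / (2 * γ) + ε₀))
      (fun x => (A x - Matrix.diagonal lam) i k))
    (hA0 : ∀ i k, SectorTendsto (θ - (Real.pi / (2 * γ) + ε₀)) (θ + (Real.pi / (2 * γ) + ε₀))
      (fun x => (A x - Matrix.diagonal lam) i k) 0) (j : Fin n) :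
    ∃ q, IsColumn γ A lam j (θ - (Real.pi / (2 * γ) + ε₀)) (θ + (Real.pi / (2 * γ) + ε₀)) q := by
  by_cases hn : ∃ i, i ≠ j
  · obtain ⟨i, hij⟩ := hn
    have hπ := mul_le_pi_div_two hγ hlam hdisj hij
    set ε : ℕ → ℝ := fun k => ε₀ * (1 - 1 / (k + 2)) with hε
    have hε0 : ∀ k, 0 < ε k := fun k => by
      have : (1 : ℝ) / (k + 2) < 1 := by
        rw [div_lt_one (by positivity)]; linarith [(Nat.cast_nonneg k : (0 : ℝ) ≤ k)]
      exact mul_pos hε₀ (by linarith)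
    have hεlt : ∀ k, ε k < ε₀ := fun k => by
      have : (0 : ℝ) < 1 / (k + 2) := by positivity
      simp only [hε]
      nlinarith
    have hεmono : StrictMono ε := strictMono_nat_of_lt_succ fun k => by
      simp only [hε]
      have : (1 : ℝ) / ((k + 1 : ℕ) + 2) < 1 / (k + 2) := by
        apply one_div_lt_one_div_of_lt (by positivity)
        push_cast; linarith
      gcongr
    have hεlim : Tendsto ε atTop (nhds ε₀) := by
      have h1 : Tendsto (fun k : ℕ => (1 : ℝ) / ((k + 1 : ℕ) + 1)) atTop (nhds 0) :=
        (tendsto_add_atTop_iff_nat 1).2 (tendsto_one_div_add_atTop_nhds_zero_nat (𝕜 := ℝ))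
      have h2 := (h1.const_sub 1).const_mul ε₀
      simp only [sub_zero, mul_one] at h2
      refine h2.congr fun k => ?_
      simp only [hε]
      push_cast
      ring_nf
    have hcol := fun k => exists_column_of_lt hγ hlam hdisj hπ hA hA0 j (hε0 (k + 1))
      (hεlt (k + 1))
    choose q hq using hcol
    -- The column `q k` lives on the sector of `ε (k + 1)` but is glued on that of `ε k`: uniqueness
    -- costs a little opening.
    obtain ⟨F, hF, hFq⟩ := exists_glue (α := fun k => θ - (Real.pi / (2 * γ) + ε k))
      (β := fun k => θ + (Real.pi / (2 * γ) + ε k))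
      q
      (fun k l hkl => by
        have := hεmono.monotone (Nat.succ_le_succ hkl)
        exact (hq k).eq_of_lt hγ hlam hdisj hπ hA0 (hε0 _) (hεlt _).le (hεmono (Nat.lt_succ_self k))
          ((hq l).mono (by simp only [Nat.succ_eq_add_one] at this; linarith)
            (by simp only [Nat.succ_eq_add_one] at this; linarith)))
    have hsub : ∀ α' β', θ - (Real.pi / (2 * γ) + ε₀) < α' → β' < θ + (Real.pi / (2 * γ) + ε₀) →
        ∃ k, θ - (Real.pi / (2 * γ) + ε (k + 1)) < α' ∧ β' < θ + (Real.pi / (2 * γ) + ε (k + 1)) ∧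
          ∃ r > 0, ∀ x ∈ sector α' β' (fun _ => r), F x = q k x := by
      intro α' β' hα hβ
      obtain ⟨ε', hε', hα', hβ'⟩ := exists_lt_of_subsector hα hβ
      obtain ⟨k, hk⟩ := (hεlim.eventually (lt_mem_nhds hε')).exists
      obtain ⟨r, hr, hx⟩ := hFq k
      have := hεmono (Nat.lt_succ_self k)
      simp only [Nat.succ_eq_add_one] at this
      exact ⟨k, by linarith, by linarith, r, hr, fun x hxm =>
        hx x (sector_mono (by linarith) (by linarith) le_rfl hxm)⟩
    refine ⟨F, fun x => ?_, fun i => LocalGevrey.of_eqOn fun α' β' hα hβ => ?_,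
      fun i α' β' hα hβ η hη => ?_, fun α' β' hα hβ => ?_⟩
    · obtain ⟨k, hk⟩ := hF x
      rw [hk]
      exact (hq k).self x
    · obtain ⟨k, h1, h2, r, hr, hx⟩ := hsub α' β' hα hβ
      exact ⟨fun x => q k x i, ⟨r, hr, fun x hxm => by rw [hx x hxm]⟩, (hq k).gevrey i α' β' h1 h2⟩
    · obtain ⟨k, h1, h2, r, hr, hx⟩ := hsub α' β' hα hβ
      obtain ⟨r', hr', hx'⟩ := (hq k).tendsto i α' β' h1 h2 η hη
      refine ⟨min r r', lt_min hr hr', fun x hxm => ?_⟩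
      simp only [hx x (sector_mono le_rfl le_rfl (min_le_left _ _) hxm)]
      exact hx' x (sector_mono le_rfl le_rfl (min_le_right _ _) hxm)
    · obtain ⟨k, h1, h2, r, hr, hx⟩ := hsub α' β' hα hβ
      obtain ⟨r', hr', hx'⟩ := (hq k).ode α' β' h1 h2
      refine ⟨min r r', lt_min hr hr', fun x hxm i hi => ?_⟩
      have e := hx x (sector_mono le_rfl le_rfl (min_le_left _ _) hxm)
      have hd := hx' x (sector_mono le_rfl le_rfl (min_le_right _ _) hxm) i hi
      rw [← e] at hd
      refine hd.congr_of_eventuallyEq ?_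
      filter_upwards [(isOpen_sector _ _ _).mem_nhds hxm] with y hy
      rw [hx y (sector_mono le_rfl le_rfl (min_le_left _ _) hy)]
  -- With a single index there is no equation, and no bound on `ε₀` is available; the zero vector is
  -- a column.
  · push Not at hn
    exact ⟨fun _ _ => 0, fun _ => rfl, fun _ => LocalGevrey.const hγ 0,
      fun _ _ _ _ _ η hη => ⟨1, one_pos, fun _ _ => by simpa using hη.le⟩,
      fun _ _ _ _ => ⟨1, one_pos, fun _ _ i hi => absurd (hn i) hi⟩⟩

end Gluing

/-! ### Primitives with Gevrey expansions. -/

section Primitive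

open Filter MeasureTheory Metric

/-- The primitive, vanishing at the origin, of a bounded function on a sector. -/
theorem hasDerivAt_ray_integral {α β r M : ℝ} {c : ℂ → ℂ}
    (hc : DifferentiableOn ℂ c (sector α β (fun _ => r)))
    (hM : ∀ x ∈ sector α β (fun _ => r), ‖c x‖ ≤ M) {x : ℂ}
    (hx : x ∈ sector α β (fun _ => r)) :
    HasDerivAt (fun x => ∫ t in (0 : ℝ)..1, x * c (t * x)) (c x) x := by
  set S := sector α β (fun _ => r) with hS
  have hSo : IsOpen S := isOpen_sector _ _ _
  obtain ⟨δ, hδ, hball⟩ := Metric.isOpen_iff.1 hSo x hx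
  simp only [intervalIntegral.integral_of_le (zero_le_one (α := ℝ))]
  have hcont : ∀ y ∈ S, ∀ g : ℂ → ℂ, ContinuousOn g S →
      ContinuousOn (fun t : ℝ => g (t * y)) (Set.Ioc 0 1) := fun y hy g hg =>
    hg.comp (by fun_prop) fun t ht => smul_mem_sector hy ht.1 ht.2
  have hder : ∀ y ∈ S, ∀ t ∈ Set.Ioc (0 : ℝ) 1,
      HasDerivAt c (deriv c (t * y)) (t * y) := fun y hy t ht =>
    (hc.differentiableAt (hSo.mem_nhds (smul_mem_sector hy ht.1 ht.2))).hasDerivAt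
  have hder' : ∀ y ∈ S, ∀ t ∈ Set.Ioc (0 : ℝ) 1,
      HasDerivAt (fun y : ℂ => y * c (t * y)) (c (t * y) + y * (t * deriv c (t * y))) y := by
    intro y hy t ht
    have h1 : HasDerivAt (fun y : ℂ => (t : ℂ) * y) t y := by
      simpa using (hasDerivAt_id y).const_mul (t : ℂ)
    refine ((hasDerivAt_id y).mul (HasDerivAt.comp y (hder y hy t ht) h1)).congr_deriv ?_
    simp only [id, one_mul, Function.comp_apply]
    ring
  have key := hasDerivAt_integral_of_differentiableOn (μ := volume.restrict (Set.Ioc 0 1)) hδ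
    (F := fun y t => y * c (t * y)) (F' := fun t => c (t * x) + x * (t * deriv c (t * x)))
    (b := fun _ => (‖x‖ + δ) * M) (integrable_const _)
    (fun y hy => (continuousOn_const.mul (hcont y (hball hy) c
      hc.continuousOn)).aestronglyMeasurable measurableSet_Ioc)
    (((hcont x hx c hc.continuousOn).add (continuousOn_const.mul
      ((Complex.continuous_ofReal.continuousOn).mul (hcont x hx (deriv c)
        (hc.deriv hSo).continuousOn)))).aestronglyMeasurable measurableSet_Ioc)
    (by
      filter_upwards [ae_restrict_mem measurableSet_Ioc] with t ht
      exact hder' x hx t ht)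
    (by
      filter_upwards [ae_restrict_mem measurableSet_Ioc] with t ht y hy
      exact (hder' y (hball hy) t ht).differentiableAt.differentiableWithinAt)
    (by
      filter_upwards [ae_restrict_mem measurableSet_Ioc] with t ht y hy
      rw [norm_mul]
      have h1 : ‖y‖ ≤ ‖x‖ + δ := by
        have := norm_le_norm_add_norm_sub' y x
        rw [mem_ball, dist_eq_norm] at hy
        linarith
      exact mul_le_mul h1 (hM _ (smul_mem_sector (hball hy) ht.1 ht.2)) (norm_nonneg _)
        (by positivity))
  -- The integrand is the derivative of `t c(t x)` in `t`. Boundedness of `c` gives continuity at `t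
  -- = 0`, whatever the value `c 0`.
  have hftc : ∫ t in (0 : ℝ)..1, (c (t * x) + x * (t * deriv c (t * x))) =
      (1 : ℝ) * c ((1 : ℝ) * x) - (0 : ℝ) * c ((0 : ℝ) * x) := by
    refine intervalIntegral.integral_eq_sub_of_hasDerivAt_of_le zero_le_one
      (f := fun t : ℝ => (t : ℂ) * c (t * x)) ?_ (fun t ht => ?_) ?_
    · intro t ht
      rcases eq_or_lt_of_le ht.1 with h0 | h0
      · subst h0
        have hlim : Tendsto (fun t : ℝ => (t : ℂ) * c (t * x)) (nhdsWithin 0 (Set.Icc 0 1))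
            (nhds 0) := by
          refine squeeze_zero_norm' (a := fun t : ℝ => |t| * M) ?_ ?_
          · filter_upwards [self_mem_nhdsWithin] with t ht
            rcases eq_or_lt_of_le ht.1 with h0 | h0
            · simp [← h0]
            · rw [norm_mul, Complex.norm_real, Real.norm_eq_abs]
              gcongr
              exact hM _ (smul_mem_sector hx h0 ht.2)
          · have : Tendsto (fun t : ℝ => |t| * M) (nhds 0) (nhds (|(0 : ℝ)| * M)) :=
              (continuous_abs.tendsto 0).mul_const M
            rw [abs_zero, zero_mul] at this
            exact this.mono_left nhdsWithin_le_nhds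
        simpa [ContinuousWithinAt] using hlim
      · have hd := (hder x hx t ⟨h0, ht.2⟩).continuousAt
        have hc2 : ContinuousAt (fun t : ℝ => (t : ℂ) * x) t := by fun_prop
        exact (Complex.continuous_ofReal.continuousAt.mul
          (ContinuousAt.comp (f := fun t : ℝ => (t : ℂ) * x) hd hc2)).continuousWithinAt
    · have h1 : HasDerivAt (fun t : ℂ => t * x) x (t : ℂ) := by
        simpa using (hasDerivAt_id (t : ℂ)).mul_const x
      have h2 := ((hasDerivAt_id (t : ℂ)).mul (HasDerivAt.comp (t : ℂ)
        (hder x hx t ⟨ht.1, ht.2.le⟩) h1)).comp_ofReal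
      refine h2.congr_deriv ?_
      simp only [id, one_mul, Function.comp_apply]
      ring
    · rw [intervalIntegrable_iff_integrableOn_Ioc_of_le zero_le_one]
      exact key.1
  rw [intervalIntegral.integral_of_le zero_le_one] at hftc
  have h2 := key.2
  rw [hftc] at h2
  simpa using h2

end Primitive

section Primitive

open Filter MeasureTheory

theorem intervalIntegrable_ray {α β r M : ℝ} {c : ℂ → ℂ}
    (hc : DifferentiableOn ℂ c (sector α β (fun _ => r)))
    (hM : ∀ x ∈ sector α β (fun _ => r), ‖c x‖ ≤ M) {x : ℂ}
    (hx : x ∈ sector α β (fun _ => r)) :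
    IntervalIntegrable (fun t : ℝ => x * c (t * x)) volume 0 1 := by
  rw [intervalIntegrable_iff_integrableOn_Ioc_of_le zero_le_one]
  refine Integrable.mono' (g := fun _ => ‖x‖ * M) (integrable_const _)
    ((continuousOn_const.mul (hc.continuousOn.comp (by fun_prop) fun t ht =>
      smul_mem_sector hx ht.1 ht.2)).aestronglyMeasurable measurableSet_Ioc) ?_
  filter_upwards [ae_restrict_mem measurableSet_Ioc] with t ht
  rw [norm_mul]
  gcongr
  exact hM _ (smul_mem_sector hx ht.1 ht.2)

/-- A function `b` with Gevrey expansion is `Λ + x ^ (γ + 1) B'`, where `Λ` is a polynomial of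
degree at most `γ` and `B` has a Gevrey expansion. -/
theorem LocalGevrey.exists_primitive {γ : ℕ} (hγ : 0 < γ) {α β : ℝ} (hαβ : α < β) {b : ℂ → ℂ}
    (hb : LocalGevrey γ α β b) :
    ∃ (Λ : Polynomial ℂ) (B : ℂ → ℂ), Λ.natDegree ≤ γ ∧ SectorTendsto α β b (Λ.eval 0) ∧
      LocalGevrey γ α β B ∧ SectorTendsto α β B 0 ∧
      ∀ α' β', α < α' → β' < β → ∃ r > 0, ∀ x ∈ sector α' β' (fun _ => r),
        HasDerivAt B ((b x - Λ.eval x) / x ^ (γ + 1)) x := by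
  obtain ⟨A, hA⟩ := hb.exists_series hγ hαβ
  have hγ' : (1 : ℝ) ≤ γ := by exact_mod_cast hγ
  -- Removing the terms of degree at most `γ` leaves neither a pole nor a residue, hence no
  -- logarithm, in `(b - Λ) / x^(γ+1)`.
  set Λ := PowerSeries.trunc (γ + 1) A with hΛ
  have hdeg : Λ.natDegree < γ + 1 := PowerSeries.natDegree_trunc_lt A γ
  have heval : ∀ x, Λ.eval x = partialSum A x (γ + 1) := by
    intro x
    rw [Polynomial.eval_eq_sum_range' hdeg, partialSum]
    refine Finset.sum_congr rfl fun m hm => ?_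
    rw [hΛ, PowerSeries.coeff_trunc, if_pos (Finset.mem_range.1 hm)]
  set c : ℂ → ℂ := fun x => (b x - Λ.eval x) / x ^ (γ + 1) with hc
  set B : ℂ → ℂ := fun x => ∫ t in (0 : ℝ)..1, x * c (t * x) with hB
  -- For `m = 0` division by zero gives `0`, the right constant term.
  set AB : PowerSeries ℂ := PowerSeries.mk fun m => PowerSeries.coeff (m + γ) A / m with hAB
  have main : ∀ α' β' C M, 0 < C →
      GevreyBound γ (sector α' β' (fun _ => 1 / C)) (fun x => C * x) (fun x => (C * ‖x‖) ^ γ)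
        (b, PowerSeries.rescale ((C : ℂ)⁻¹) A) M →
      GevreyBound γ (sector α' β' (fun _ => 1 / C)) (fun x => C * x) (fun x => (C * ‖x‖) ^ γ)
        (B, PowerSeries.rescale ((C : ℂ)⁻¹) AB) ((2 + γ) * M * C ^ γ) ∧
      ∀ x ∈ sector α' β' (fun _ => 1 / C), HasDerivAt B (c x) x := by
    intro α' β' C M hC h
    have hCc : (C : ℂ) ≠ 0 := by exact_mod_cast hC.ne'
    have hM := h.nonneg
    set S := sector α' β' (fun _ => 1 / C) with hS
    have hS0 : ∀ y ∈ S, 0 < ‖y‖ := fun y hy => norm_pos_of_mem_sector hy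
    have hS1 : ∀ y ∈ S, C * ‖y‖ ≤ 1 := fun y hy => by
      have := norm_lt_of_mem_sector hy
      rw [lt_div_iff₀ hC] at this; linarith
    have hcoef : ∀ m, ‖PowerSeries.coeff m A‖ ≤ M * (m / γ).factorial * C ^ m := by
      intro m
      have := h.coeff m
      rw [PowerSeries.coeff_rescale, norm_mul, norm_pow, norm_inv, Complex.norm_real,
        Real.norm_of_nonneg hC.le, inv_pow, inv_mul_le_iff₀ (by positivity)] at this
      linarith
    have hrem : ∀ K, ∀ y ∈ S, ‖b y - partialSum A y (γ * K)‖ ≤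
        M * K.factorial * (C * ‖y‖) ^ (γ * K) := by
      intro K y hy
      have := h.rem K y hy
      rwa [GevreyBound.partialSum_rescale, inv_mul_cancel_left₀ hCc, ← pow_mul] at this
    have hcd : DifferentiableOn ℂ c S := by
      refine (h.diff.sub Λ.differentiable.differentiableOn).div (by fun_prop) fun y hy => ?_
      exact pow_ne_zero _ (norm_pos_iff.1 (hS0 y hy))
    -- The remainder of order `2 γ ≥ γ + 1` is used, plus the fewer than `γ` terms in between.
    have hcb : ∀ y ∈ S, ‖c y‖ ≤ (2 + γ) * M * C ^ (γ + 1) := by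
      intro y hy
      have hy0 := hS0 y hy
      have hy1 := hS1 y hy
      have hle : γ + 1 ≤ γ * 2 := by omega
      have e : b y - Λ.eval y = (b y - partialSum A y (γ * 2)) +
          ∑ m ∈ Finset.Ico (γ + 1) (γ * 2), PowerSeries.coeff m A * y ^ m := by
        rw [heval, partialSum, partialSum, ← Finset.sum_range_add_sum_Ico _ hle]
        ring
      have b1 : ‖b y - partialSum A y (γ * 2)‖ ≤ 2 * M * (C * ‖y‖) ^ (γ + 1) := by
        refine (hrem 2 y hy).trans ?_
        have := pow_le_pow_of_le_one (by positivity) hy1 hle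
        have h2 : ((2 : ℕ).factorial : ℝ) = 2 := by norm_num [Nat.factorial]
        rw [h2, mul_comm M 2]
        gcongr
      have b2 : ‖∑ m ∈ Finset.Ico (γ + 1) (γ * 2), PowerSeries.coeff m A * y ^ m‖ ≤
          γ * (M * (C * ‖y‖) ^ (γ + 1)) := by
        calc _ ≤ ∑ m ∈ Finset.Ico (γ + 1) (γ * 2), M * (C * ‖y‖) ^ (γ + 1) := by
              refine norm_sum_le_of_le _ fun m hm => ?_
              obtain ⟨hm1, hm2⟩ := Finset.mem_Ico.1 hm
              have hd : m / γ ≤ 1 := Nat.lt_succ_iff.1 ((Nat.div_lt_iff_lt_mul hγ).2 (by linarith))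
              have hf : ((m / γ).factorial : ℝ) = 1 := by
                rcases Nat.le_one_iff_eq_zero_or_eq_one.1 hd with h | h <;> simp [h]
              have := hcoef m
              rw [hf, mul_one] at this
              rw [norm_mul, norm_pow]
              calc _ ≤ M * C ^ m * ‖y‖ ^ m := by gcongr
                _ = M * (C * ‖y‖) ^ m := by rw [mul_pow]; ring
                _ ≤ _ := by
                    gcongr ?_ * ?_
                    exact pow_le_pow_of_le_one (by positivity) hy1 hm1
          _ ≤ _ := by
              rw [Finset.sum_const, Nat.card_Ico, nsmul_eq_mul]
              have : ((γ * 2 - (γ + 1) : ℕ) : ℝ) ≤ γ := by exact_mod_cast (by omega)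
              gcongr
      rw [hc, norm_div, norm_pow, div_le_iff₀ (by positivity), e]
      calc _ ≤ 2 * M * (C * ‖y‖) ^ (γ + 1) + γ * (M * (C * ‖y‖) ^ (γ + 1)) :=
            norm_add_le_of_le b1 b2
        _ = _ := by rw [mul_pow]; ring
    have hder : ∀ x ∈ S, HasDerivAt B (c x) x := fun x hx => hasDerivAt_ray_integral hcd hcb hx
    refine ⟨⟨fun x hx => (hder x hx).differentiableAt.differentiableWithinAt, fun m => ?_,
      fun K x hx => ?_⟩, hder⟩
    · rw [PowerSeries.coeff_rescale, hAB, PowerSeries.coeff_mk]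
      rcases Nat.eq_zero_or_pos m with rfl | hm
      · simp; positivity
      have hm' : (1 : ℝ) ≤ m := by exact_mod_cast hm
      have hk : (m + γ) / γ = m / γ + 1 := Nat.add_div_right m hγ
      have h1 := hcoef (m + γ)
      have hkm : ((m / γ : ℕ) : ℝ) + 1 ≤ (2 + γ) * m := by
        have : ((m / γ : ℕ) : ℝ) ≤ m := by exact_mod_cast Nat.div_le_self m γ
        nlinarith
      rw [norm_mul, norm_pow, norm_inv, norm_div, Complex.norm_real, Real.norm_of_nonneg hC.le,
        Complex.norm_natCast, inv_pow, inv_mul_le_iff₀ (by positivity),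
        div_le_iff₀ (by linarith)]
      rw [hk, Nat.factorial_succ] at h1
      push_cast at h1
      refine h1.trans ?_
      rw [pow_add]
      calc _ = (((m / γ : ℕ) : ℝ) + 1) * (M * (m / γ).factorial * C ^ m * C ^ γ) := by ring
        _ ≤ ((2 + γ) * m) * (M * (m / γ).factorial * C ^ m * C ^ γ) := by gcongr
        _ = _ := by ring
    · have hx0 := hS0 x hx
      have hx1 := hS1 x hx
      have hxc : x ≠ 0 := norm_pos_iff.1 hx0
      have hint := intervalIntegrable_ray hcd hcb hx
      rw [GevreyBound.partialSum_rescale, inv_mul_cancel_left₀ hCc, ← pow_mul]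
      rcases Nat.eq_zero_or_pos K with rfl | hK
      · have := intervalIntegral.norm_integral_le_of_norm_le_const (a := (0 : ℝ)) (b := 1)
          (f := fun t : ℝ => x * c (t * x)) (C := (2 + γ) * M * C ^ γ) (fun t ht => by
            rw [Set.uIoc_of_le zero_le_one] at ht
            rw [norm_mul]
            calc _ ≤ ‖x‖ * ((2 + γ) * M * C ^ (γ + 1)) := by
                  gcongr
                  exact hcb _ (smul_mem_sector hx ht.1 ht.2)
              _ = (C * ‖x‖) * ((2 + γ) * M * C ^ γ) := by ring
              _ ≤ 1 * ((2 + γ) * M * C ^ γ) := by gcongr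
              _ = _ := one_mul _)
        simpa [partialSum, hB] using this
      · have hN : 1 ≤ γ * K := Nat.mul_pos hγ hK
        have hpint : ∀ m ∈ Finset.Ico 1 (γ * K), IntervalIntegrable (fun t : ℝ =>
            PowerSeries.coeff (m + γ) A * x ^ m * (t : ℂ) ^ (m - 1)) volume 0 1 := fun m _ =>
          (by fun_prop : Continuous fun t : ℝ =>
            PowerSeries.coeff (m + γ) A * x ^ m * (t : ℂ) ^ (m - 1)).intervalIntegrable _ _
        have hpsum : partialSum AB x (γ * K) = ∫ t in (0 : ℝ)..1,
            ∑ m ∈ Finset.Ico 1 (γ * K), PowerSeries.coeff (m + γ) A * x ^ m * (t : ℂ) ^ (m - 1) := by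
          rw [intervalIntegral.integral_finsetSum hpint, partialSum,
            ← Finset.sum_range_add_sum_Ico _ hN]
          simp only [Finset.sum_range_one, hAB, PowerSeries.coeff_mk, Nat.cast_zero, div_zero,
            zero_mul, zero_add]
          refine Finset.sum_congr rfl fun m hm => ?_
          have hm1 := (Finset.mem_Ico.1 hm).1
          have hint : ∫ t in (0 : ℝ)..1, (t : ℂ) ^ (m - 1) = 1 / m := by
            have h1 : ∀ t : ℝ, (t : ℂ) ^ (m - 1) = ((t ^ (m - 1) : ℝ) : ℂ) := fun t => by
              push_cast; rfl
            simp only [h1]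
            rw [intervalIntegral.integral_ofReal, integral_pow]
            have : m - 1 + 1 = m := by omega
            have h3 : ((m - 1 : ℕ) : ℝ) + 1 = m := by exact_mod_cast this
            rw [this, h3]
            simp [show m ≠ 0 by omega]
          rw [intervalIntegral.integral_const_mul, hint]
          ring
        -- Order `γ K` for `B` comes from order `γ (K + 1)` for `b`. The resulting extra factor `K +
        -- 1` is compensated by the integral of `t^(γ K - 1)`, equal to `1 / (γ K)`.
        have hkey : ∀ t ∈ Set.Ioc (0 : ℝ) 1, ‖x * c (t * x) - ∑ m ∈ Finset.Ico 1 (γ * K),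
            PowerSeries.coeff (m + γ) A * x ^ m * (t : ℂ) ^ (m - 1)‖ ≤
            M * (K + 1).factorial * C ^ γ * (C * ‖x‖) ^ (γ * K) * t ^ (γ * K - 1) := by
          intro t ht
          have htc : (t : ℂ) ≠ 0 := by exact_mod_cast ht.1.ne'
          have hy := smul_mem_sector hx ht.1 ht.2
          have hyn : ‖(t : ℂ) * x‖ = t * ‖x‖ := by
            rw [norm_mul, Complex.norm_real, Real.norm_of_nonneg ht.1.le]
          have hle : γ + 1 ≤ γ * (K + 1) := by rw [Nat.mul_succ]; omega
          have e : x * c (t * x) - ∑ m ∈ Finset.Ico 1 (γ * K),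
              PowerSeries.coeff (m + γ) A * x ^ m * (t : ℂ) ^ (m - 1) =
              x * ((b (t * x) - partialSum A (t * x) (γ * (K + 1))) / (t * x) ^ (γ + 1)) := by
            have e1 : partialSum A (t * x) (γ * (K + 1)) = partialSum A (t * x) (γ + 1) +
                ∑ m ∈ Finset.Ico 1 (γ * K), PowerSeries.coeff (m + γ) A * (t * x) ^ (m + γ) := by
              rw [partialSum, ← Finset.sum_range_add_sum_Ico _ hle, ← partialSum,
                Finset.sum_Ico_add' (fun m => PowerSeries.coeff m A * (t * x) ^ m) 1 (γ * K) γ,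
                add_comm 1 γ, Nat.mul_succ]
            have e2 : ∀ m ∈ Finset.Ico 1 (γ * K), PowerSeries.coeff (m + γ) A * x ^ m *
                (t : ℂ) ^ (m - 1) = x * (PowerSeries.coeff (m + γ) A * (t * x) ^ (m + γ) /
                  (t * x) ^ (γ + 1)) := by
              intro m hm
              obtain ⟨l, rfl⟩ : ∃ l, m = l + 1 := ⟨m - 1, by
                have := (Finset.mem_Ico.1 hm).1; omega⟩
              rw [Nat.add_sub_cancel, show l + 1 + γ = l + (γ + 1) by ring, pow_add ((t : ℂ) * x),
                ← mul_assoc, mul_div_cancel_right₀ _ (pow_ne_zero _ (mul_ne_zero htc hxc)), mul_pow,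
                pow_succ x]
              ring
            rw [Finset.sum_congr rfl e2, ← Finset.mul_sum, ← Finset.sum_div, hc, e1]
            simp only [heval]
            ring
          rw [e, norm_mul, norm_div, norm_pow, hyn]
          have h1 := hrem (K + 1) _ hy
          rw [hyn] at h1
          have htx : 0 < t * ‖x‖ := mul_pos ht.1 hx0
          calc _ ≤ ‖x‖ * (M * (K + 1).factorial * (C * (t * ‖x‖)) ^ (γ * (K + 1)) /
                (t * ‖x‖) ^ (γ + 1)) := by gcongr
            _ = M * (K + 1).factorial * C ^ γ * (C * ‖x‖) ^ (γ * K) * t ^ (γ * K - 1) := by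
                obtain ⟨l, hl⟩ : ∃ l, γ * K = l + 1 := ⟨γ * K - 1, by omega⟩
                have ht0 := ht.1.ne'
                rw [Nat.mul_succ, hl, Nat.add_sub_cancel]
                simp only [mul_pow, pow_add, pow_one]
                field_simp
        have hdiff : B x - partialSum AB x (γ * K) = ∫ t in (0 : ℝ)..1, (x * c (t * x) -
            ∑ m ∈ Finset.Ico 1 (γ * K), PowerSeries.coeff (m + γ) A * x ^ m *
              (t : ℂ) ^ (m - 1)) := by
          rw [intervalIntegral.integral_sub hint (by
            refine Continuous.intervalIntegrable ?_ _ _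
            fun_prop), ← hpsum]
        have hbd := intervalIntegral.norm_integral_le_of_norm_le (a := (0 : ℝ)) (b := 1)
          (μ := volume) zero_le_one (f := fun t : ℝ => x * c (t * x) -
            ∑ m ∈ Finset.Ico 1 (γ * K), PowerSeries.coeff (m + γ) A * x ^ m * (t : ℂ) ^ (m - 1))
          (g := fun t => M * (K + 1).factorial * C ^ γ * (C * ‖x‖) ^ (γ * K) * t ^ (γ * K - 1))
          (Eventually.of_forall hkey) (by
            refine Continuous.intervalIntegrable ?_ _ _
            fun_prop)
        simp only [hdiff]
        refine hbd.trans ?_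
        have hN1 : γ * K - 1 + 1 = γ * K := by omega
        have hN2 : ((γ * K - 1 : ℕ) : ℝ) + 1 = γ * K := by exact_mod_cast hN1
        rw [intervalIntegral.integral_const_mul, integral_pow, hN1, hN2]
        have hK1 : (1 : ℝ) ≤ K := by exact_mod_cast hK
        have hfac : ((K : ℝ) + 1) * (1 / (γ * K)) ≤ 2 + γ := by
          rw [mul_one_div, div_le_iff₀ (by positivity)]
          nlinarith [mul_le_mul hγ' hK1 zero_le_one (by linarith)]
        rw [Nat.factorial_succ]
        push_cast
        simp only [one_pow, zero_pow (show γ * K ≠ 0 by omega), sub_zero]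
        calc _ = (((K : ℝ) + 1) * (1 / (γ * K))) * (M * K.factorial * C ^ γ *
              (C * ‖x‖) ^ (γ * K)) := by ring
          _ ≤ (2 + γ) * (M * K.factorial * C ^ γ * (C * ‖x‖) ^ (γ * K)) := by gcongr
          _ = _ := by ring
  have hseries : ∀ α' β', α < α' → β' < β → ∀ᶠ C : ℝ in atTop, ∃ M,
      GevreyBound γ (sector α' β' (fun _ => 1 / C)) (fun x => C * x) (fun x => (C * ‖x‖) ^ γ)
        (B, PowerSeries.rescale ((C : ℂ)⁻¹) AB) M := by
    intro α' β' hα hβ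
    filter_upwards [hA α' β' hα hβ, eventually_gt_atTop 0] with C ⟨M, h⟩ hC
    exact ⟨_, (main α' β' C M hC h).1⟩
  refine ⟨Λ, B, Nat.lt_succ_iff.1 hdeg, ?_, ?_, ?_, fun α' β' hα hβ => ?_⟩
  · have : Λ.eval 0 = PowerSeries.coeff 0 A := by
      rw [heval, partialSum, Finset.sum_range_succ']
      simp
    rw [this]
    exact sectorTendsto_of_series hγ hA
  · intro α' β' hα hβ
    filter_upwards [hseries α' β' hα hβ] with C ⟨M, h⟩
    exact ⟨_, M, h⟩
  · have := sectorTendsto_of_series hγ hseries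
    simpa [hAB] using this
  · obtain ⟨C, ⟨M, h⟩, hC⟩ := ((hA α' β' hα hβ).and (eventually_gt_atTop 0)).exists
    exact ⟨1 / C, by positivity, (main α' β' C M hC h).2⟩

end Primitive

/-! ### Translation between Borel summability and Gevrey bounds. -/

section BorelSummable

open Filter

/-- `Γ` is not monotone on `[1, 2]`; there convexity bounds it by its end values, both equal to `1`.
-/
theorem Gamma_le_factorial {s : ℝ} {k : ℕ} (h1 : 1 ≤ s) (h2 : s ≤ k + 2) :
    Real.Gamma s ≤ (k + 1).factorial := by
  rcases le_or_gt 2 s with h | h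
  · have := Real.Gamma_strictMonoOn_Ici.monotoneOn (Set.mem_Ici.2 h)
      (Set.mem_Ici.2 (h.trans h2)) h2
    have e : Real.Gamma (k + 2) = (k + 1).factorial := by
      have := Real.Gamma_nat_eq_factorial (k + 1)
      push_cast at this
      rw [← this]; congr 1; ring
    rwa [e] at this
  · have := Real.convexOn_Gamma.le_max_of_mem_Icc (x := 1) (y := 2) (z := s)
      (Set.mem_Ioi.2 one_pos) (Set.mem_Ioi.2 two_pos) ⟨h1, h.le⟩
    rw [Real.Gamma_one, Real.Gamma_two, max_self] at this
    exact this.trans (by exact_mod_cast Nat.factorial_pos _)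

/-- Monotonicity is applied at `s + 1 ≥ 2`: `(k + 1)! ≤ Γ(s + 1) = s Γ(s)`, and `k + 2 ≤ 2 (k + 1)`.
-/
theorem factorial_le_two_mul_Gamma {s : ℝ} {k : ℕ} (h1 : k + 1 ≤ s) (h2 : s ≤ k + 2) :
    (k.factorial : ℝ) ≤ 2 * Real.Gamma s := by
  have hk : (0 : ℝ) ≤ k := Nat.cast_nonneg k
  have hs : 0 < s := by linarith
  have e : Real.Gamma (k + 2) = (k + 1).factorial := by
    have := Real.Gamma_nat_eq_factorial (k + 1)
    push_cast at this
    rw [← this]; congr 1; ring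
  have h3 : Real.Gamma (k + 2) ≤ Real.Gamma (s + 1) :=
    Real.Gamma_strictMonoOn_Ici.monotoneOn (Set.mem_Ici.2 (by linarith))
      (Set.mem_Ici.2 (by linarith)) (by linarith)
  rw [e, Real.Gamma_add_one hs.ne', Nat.factorial_succ] at h3
  push_cast at h3
  have hΓ := Real.Gamma_pos_of_pos hs
  have hf : (0 : ℝ) < k.factorial := by exact_mod_cast Nat.factorial_pos k
  have h4 : s * Real.Gamma s ≤ (k + 2) * Real.Gamma s := by gcongr
  have h5 : (k + 2 : ℝ) * k.factorial ≤ (k + 2) * (2 * Real.Gamma s) := by nlinarith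
  exact le_of_mul_le_mul_left h5 (by linarith)

theorem succ_le_two_pow (k : ℕ) : ((k : ℝ) + 1) ≤ 2 ^ k := by
  exact_mod_cast Nat.lt_two_pow_self (n := k)

theorem exists_sector_subset {α β : ℝ} {ρ : ℝ → ℝ} (hρ : IsRadius α β ρ) {α' β' : ℝ}
    (hα : α < α') (hβ : β' < β) : ∃ r > 0, sector α' β' (fun _ => r) ⊆ sector α β ρ := by
  have hsub : Set.Icc α' β' ⊆ Set.Ioo α β := fun t ht => ⟨hα.trans_le ht.1, ht.2.trans_lt hβ⟩
  rcases (Set.Icc α' β').eq_empty_or_nonempty with he | hne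
  · refine ⟨1, one_pos, fun x hx => ?_⟩
    obtain ⟨t, ht, -⟩ := hx
    have : t ∈ Set.Icc α' β' := Set.Ioo_subset_Icc_self ht
    rw [he] at this
    exact absurd this (Set.notMem_empty t)
  · obtain ⟨t₀, ht₀, hmin⟩ := isCompact_Icc.exists_isMinOn hne (hρ.1.mono hsub)
    refine ⟨ρ t₀, hρ.2 t₀ (hsub ht₀), ?_⟩
    rintro x ⟨t, ht, s, hs, hsr, rfl⟩
    have htI := Set.Ioo_subset_Icc_self ht
    exact ⟨t, hsub htI, s, hs, hsr.trans_le (hmin htI), rfl⟩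

/-- The coefficient `a m` is estimated by the difference of two consecutive remainders at one fixed
point `z`. Replacing `Γ(m/γ + 1)` by `(m / γ)!` costs geometric factors, absorbed by taking the
scale `c ≥ 4 C`. -/
theorem IsBorelSummable.localGevrey {γ : ℕ} (hγ : 0 < γ) {α β : ℝ} {f : ℂ → ℂ} {a : ℕ → ℂ}
    (h : IsBorelSummable γ α β f a) : LocalGevrey γ α β f ∧ SectorTendsto α β f (a 0) := by
  obtain ⟨-, hop, ρ, hρ, hd, M, C, hM, hC, hb⟩ := h
  have hγ' : (0 : ℝ) < γ := by exact_mod_cast hγ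
  have hαβ : α < β := by
    have : 0 < Real.pi / γ := by positivity
    linarith
  obtain ⟨t, ht1, ht2⟩ := exists_between hαβ
  set s := ρ t / 2 with hs
  have hs0 : 0 < s := half_pos (hρ.2 t ⟨ht1, ht2⟩)
  set z : ℂ := s * Complex.exp (t * Complex.I) with hz
  have hzm : z ∈ sector α β ρ := ⟨t, ⟨ht1, ht2⟩, s, hs0, half_lt_self (hρ.2 t ⟨ht1, ht2⟩), rfl⟩
  have hzn : ‖z‖ = s := by
    rw [hz, norm_mul, Complex.norm_exp_ofReal_mul_I, mul_one, Complex.norm_real,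
      Real.norm_of_nonneg hs0.le]
  have hcoef : ∀ m, ‖a m‖ ≤ M * (1 + 2 * C * s) * (4 * C) ^ m * (m / γ).factorial := by
    intro m
    set k := m / γ with hk
    have hmk : (m : ℝ) / γ ≤ k + 1 := by
      rw [div_le_iff₀ hγ', mul_comm]
      exact_mod_cast (Nat.lt_mul_div_succ m hγ).le
    have hmk' : ((m + 1 : ℕ) : ℝ) / γ ≤ (k + 1 : ℕ) + 1 := by
      push_cast
      rw [add_div]
      have : 1 / (γ : ℝ) ≤ 1 := by
        rw [div_le_one hγ']; exact_mod_cast hγ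
      linarith
    have hkm : k ≤ m := Nat.div_le_self m γ
    have hkp : ((k : ℝ) + 1) ≤ 2 ^ m :=
      (succ_le_two_pow k).trans (pow_le_pow_right₀ one_le_two hkm)
    have g1 : Real.Gamma ((m : ℝ) / γ + 1) ≤ 2 ^ m * k.factorial := by
      refine (Gamma_le_factorial (k := k) (by linarith [show 0 ≤ (m : ℝ) / γ by positivity])
        (by linarith)).trans ?_
      rw [Nat.factorial_succ]
      push_cast
      gcongr
    have g2 : Real.Gamma (((m + 1 : ℕ) : ℝ) / γ + 1) ≤ 2 * 4 ^ m * k.factorial := by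
      refine (Gamma_le_factorial (k := k + 1)
        (by linarith [show 0 ≤ ((m + 1 : ℕ) : ℝ) / γ by positivity]) (by linarith)).trans ?_
      rw [Nat.factorial_succ, Nat.factorial_succ, ← mul_assoc]
      push_cast
      have : ((k : ℝ) + 1 + 1) * (k + 1) ≤ 2 * 4 ^ m := by
        have e : (4 : ℝ) ^ m = 2 ^ m * 2 ^ m := by rw [← mul_pow]; norm_num
        rw [e]
        have hk0 : (0 : ℝ) ≤ k := Nat.cast_nonneg k
        nlinarith [mul_le_mul hkp hkp (by linarith) (by positivity)]
      gcongr
    have h1 := hb m z hzm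
    have h2 := hb (m + 1) z hzm
    have e : a m * z ^ m = (f z - ∑ l ∈ Finset.range m, a l * z ^ l) -
        (f z - ∑ l ∈ Finset.range (m + 1), a l * z ^ l) := by
      rw [Finset.sum_range_succ]; ring
    have h3 := norm_sub_le_of_le h1 h2
    rw [← e, norm_mul, norm_pow, hzn] at h3
    have hsm : 0 < s ^ m := by positivity
    have h4 : ‖a m‖ * s ^ m ≤ (M * (1 + 2 * C * s) * (4 * C) ^ m * k.factorial) * s ^ m := by
      refine h3.trans ?_
      calc _ ≤ M * C ^ m * s ^ m * (2 ^ m * k.factorial) +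
            M * C ^ (m + 1) * s ^ (m + 1) * (2 * 4 ^ m * k.factorial) := by gcongr
        _ ≤ M * C ^ m * s ^ m * (4 ^ m * k.factorial) +
            M * C ^ (m + 1) * s ^ (m + 1) * (2 * 4 ^ m * k.factorial) := by
            gcongr
            norm_num
        _ = _ := by rw [mul_pow]; ring
    exact le_of_mul_le_mul_right h4 hsm
  have hseries : ∀ α' β', α < α' → β' < β → ∀ᶠ c : ℝ in atTop, ∃ M,
      GevreyBound γ (sector α' β' (fun _ => 1 / c)) (fun x => c * x) (fun x => (c * ‖x‖) ^ γ)
        (f, PowerSeries.rescale ((c : ℂ)⁻¹) (PowerSeries.mk a)) M := by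
    intro α' β' hα hβ
    obtain ⟨r, hr, hsub⟩ := exists_sector_subset hρ hα hβ
    filter_upwards [eventually_ge_atTop (1 / r), eventually_ge_atTop (4 * C),
      eventually_gt_atTop 0] with c h1 h2 hc
    have hcc : (c : ℂ) ≠ 0 := by exact_mod_cast hc.ne'
    have hsub' : sector α' β' (fun _ => 1 / c) ⊆ sector α β ρ :=
      (sector_mono le_rfl le_rfl (by rw [one_div_le hc hr]; exact h1)).trans hsub
    refine ⟨M * (1 + 2 * C * s), hd.mono hsub', fun m => ?_, fun K x hx => ?_⟩
    · rw [PowerSeries.coeff_rescale, PowerSeries.coeff_mk, norm_mul, norm_pow, norm_inv,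
        Complex.norm_real, Real.norm_of_nonneg hc.le, inv_pow, inv_mul_le_iff₀ (by positivity)]
      refine (hcoef m).trans ?_
      rw [← mul_assoc, mul_comm (c ^ m)]
      gcongr
    · rw [GevreyBound.partialSum_rescale, inv_mul_cancel_left₀ hcc, ← pow_mul, partialSum]
      simp only [PowerSeries.coeff_mk]
      have h3 := hb (γ * K) x (hsub' hx)
      have e : ((γ * K : ℕ) : ℝ) / γ + 1 = K + 1 := by push_cast; field_simp
      rw [e, Real.Gamma_nat_eq_factorial] at h3
      refine h3.trans ?_
      have hCc : C ≤ c := by linarith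
      calc _ = M * K.factorial * (C * ‖x‖) ^ (γ * K) := by rw [mul_pow]; ring
        _ ≤ M * (1 + 2 * C * s) * K.factorial * (c * ‖x‖) ^ (γ * K) := by
            gcongr
            nlinarith [mul_pos hM (mul_pos hC hs0)]
  refine ⟨fun α' β' hα hβ => ?_, ?_⟩
  · filter_upwards [hseries α' β' hα hβ] with c ⟨M, hM⟩
    exact ⟨_, M, hM⟩
  · simpa using sectorTendsto_of_series hγ hseries

/-- For a general order `N`, with `K = N / γ`, the remainder of order `γ (K + 1)` is used and at
most `γ` terms are put back. The loss `K + 1 ≤ 2^N` is why the geometric constant is `2 c`. -/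
theorem isBorelSummable_of_series {γ : ℕ} (hγ : 0 < γ) {α β α' β' : ℝ} {f : ℂ → ℂ}
    {A : PowerSeries ℂ}
    (hA : ∀ α' β', α < α' → β' < β → ∀ᶠ c : ℝ in atTop, ∃ M,
      GevreyBound γ (sector α' β' (fun _ => 1 / c)) (fun x => c * x) (fun x => (c * ‖x‖) ^ γ)
        (f, PowerSeries.rescale ((c : ℂ)⁻¹) A) M)
    (hα : α < α') (hβ : β' < β) (hop : Real.pi / γ < β' - α') :
    IsBorelSummable γ α' β' f (fun m => PowerSeries.coeff m A) := by
  have hγ' : (0 : ℝ) < γ := by exact_mod_cast hγ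
  obtain ⟨c, ⟨M, h⟩, hc⟩ := ((hA α' β' hα hβ).and (eventually_gt_atTop 0)).exists
  have hM := h.nonneg
  have hcc : (c : ℂ) ≠ 0 := by exact_mod_cast hc.ne'
  refine ⟨hγ', hop, fun _ => 1 / c, ⟨continuousOn_const, fun _ _ => by positivity⟩, h.diff,
    2 * (1 + γ) * M + 1, 2 * c, by positivity, by positivity, fun N x hx => ?_⟩
  have hx0 := norm_pos_of_mem_sector hx
  have hx1 : c * ‖x‖ ≤ 1 := by
    have := norm_lt_of_mem_sector hx
    rw [lt_div_iff₀ hc] at this; linarith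
  set K := N / γ with hK
  have hN1 : N < γ * (K + 1) := Nat.lt_mul_div_succ N hγ
  have hN2 : γ * K ≤ N := Nat.mul_div_le N γ
  have hpow : ∀ m, N ≤ m → (c * ‖x‖) ^ m ≤ (c * ‖x‖) ^ N := fun m hm =>
    pow_le_pow_of_le_one (by positivity) hx1 hm
  have b1 : ‖f x - partialSum A x (γ * (K + 1))‖ ≤
      M * (K + 1).factorial * (c * ‖x‖) ^ N := by
    have := h.rem (K + 1) x hx
    rw [GevreyBound.partialSum_rescale, inv_mul_cancel_left₀ hcc, ← pow_mul] at this
    refine this.trans ?_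
    gcongr ?_ * ?_
    exact hpow _ hN1.le
  have b2 : ‖∑ m ∈ Finset.Ico N (γ * (K + 1)), PowerSeries.coeff m A * x ^ m‖ ≤
      γ * (M * (K + 1).factorial * (c * ‖x‖) ^ N) := by
    calc _ ≤ ∑ m ∈ Finset.Ico N (γ * (K + 1)), M * (K + 1).factorial * (c * ‖x‖) ^ N := by
          refine norm_sum_le_of_le _ fun m hm => ?_
          obtain ⟨hm1, hm2⟩ := Finset.mem_Ico.1 hm
          have hd : m / γ ≤ K + 1 := Nat.div_le_of_le_mul hm2.le
          have hf : ((m / γ).factorial : ℝ) ≤ (K + 1).factorial := by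
            exact_mod_cast Nat.factorial_le hd
          have hcoef := h.coeff m
          rw [PowerSeries.coeff_rescale, norm_mul, norm_pow, norm_inv, Complex.norm_real,
            Real.norm_of_nonneg hc.le, inv_pow, inv_mul_le_iff₀ (by positivity)] at hcoef
          rw [norm_mul, norm_pow]
          calc _ ≤ c ^ m * (M * (m / γ).factorial) * ‖x‖ ^ m := by gcongr
            _ = M * (m / γ).factorial * (c * ‖x‖) ^ m := by rw [mul_pow]; ring
            _ ≤ _ := by
                gcongr ?_ * ?_ * ?_
                exact hpow m hm1
      _ ≤ _ := by
          rw [Finset.sum_const, Nat.card_Ico, nsmul_eq_mul]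
          have : ((γ * (K + 1) - N : ℕ) : ℝ) ≤ γ := by
            have : γ * (K + 1) - N ≤ γ := by rw [Nat.mul_succ]; omega
            exact_mod_cast this
          gcongr
  have e : f x - ∑ m ∈ Finset.range N, PowerSeries.coeff m A * x ^ m =
      (f x - partialSum A x (γ * (K + 1))) +
        ∑ m ∈ Finset.Ico N (γ * (K + 1)), PowerSeries.coeff m A * x ^ m := by
    rw [partialSum, ← Finset.sum_range_add_sum_Ico _ hN1.le]; ring
  have hΓ : (K.factorial : ℝ) ≤ 2 * Real.Gamma ((N : ℝ) / γ + 1) := by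
    refine factorial_le_two_mul_Gamma ?_ ?_
    · have : (K : ℝ) ≤ N / γ := by
        rw [le_div_iff₀ hγ', mul_comm]; exact_mod_cast hN2
      linarith
    · have : (N : ℝ) / γ ≤ K + 1 := by
        rw [div_le_iff₀ hγ', mul_comm]; exact_mod_cast hN1.le
      linarith
  have hΓ0 : 0 < Real.Gamma ((N : ℝ) / γ + 1) := Real.Gamma_pos_of_pos (by positivity)
  have hfac : ((K + 1).factorial : ℝ) ≤ 2 ^ N * (2 * Real.Gamma ((N : ℝ) / γ + 1)) := by
    rw [Nat.factorial_succ]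
    push_cast
    have := (succ_le_two_pow K).trans (pow_le_pow_right₀ one_le_two (Nat.div_le_self N γ))
    gcongr
  rw [e]
  calc _ ≤ M * (K + 1).factorial * (c * ‖x‖) ^ N +
        γ * (M * (K + 1).factorial * (c * ‖x‖) ^ N) := norm_add_le_of_le b1 b2
    _ = (1 + γ) * M * (c * ‖x‖) ^ N * (K + 1).factorial := by ring
    _ ≤ (1 + γ) * M * (c * ‖x‖) ^ N * (2 ^ N * (2 * Real.Gamma ((N : ℝ) / γ + 1))) := by gcongr
    _ = (2 * (1 + γ) * M) * (2 * c) ^ N * ‖x‖ ^ N * Real.Gamma ((N : ℝ) / γ + 1) := by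
        rw [mul_pow, mul_pow]; ring
    _ ≤ _ := by
        gcongr
        linarith

end BorelSummable

/-! ### Singular directions, gauge transformations and assembly of the theorem. -/

open Filter Topology

/-- A finite union of preimages of `ℤ` under affine maps. -/
theorem isClosed_singularDirections {n γ : ℕ} (hγ : 0 < γ) (lam : Fin n → ℂ) :
    IsClosed (singularDirections γ lam) := by
  have hγ' : (γ : ℝ) ≠ 0 := by exact_mod_cast hγ.ne'
  have hπ := Real.pi_ne_zero
  have heq : singularDirections γ lam = ⋃ i, ⋃ j, {θ : ℝ | i ≠ j} ∩
      (fun θ : ℝ => (θ * γ - Complex.arg (lam i - lam j)) / (2 * Real.pi)) ⁻¹'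
        Set.range ((↑) : ℤ → ℝ) := by
    ext θ
    simp only [singularDirections, Set.mem_ofPred_eq, Set.mem_iUnion, Set.mem_inter_iff,
      Set.mem_preimage, Set.mem_range]
    refine exists_congr fun i => exists_congr fun j => and_congr_right fun _ =>
      exists_congr fun l => ?_
    rw [eq_div_iff hγ', eq_div_iff (by positivity)]
    constructor <;> intro h <;> linarith
  rw [heq]
  refine isClosed_iUnion_of_finite fun i => isClosed_iUnion_of_finite fun j =>
    isClosed_const.inter (Int.isClosedEmbedding_coe_real.isClosed_range.preimage ?_)
  fun_prop

theorem exists_disjoint_singularDirections {n γ : ℕ} (hγ : 0 < γ) {lam : Fin n → ℂ} {θ η : ℝ}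
    (hη : 0 < η) (hθ : θ ∉ singularDirections γ lam) :
    ∃ ε₀, 0 < ε₀ ∧ ε₀ ≤ η ∧ Disjoint (Set.Ioo (θ - ε₀) (θ + ε₀)) (singularDirections γ lam) := by
  obtain ⟨ε, hε, hball⟩ := Metric.isOpen_iff.1 (isClosed_singularDirections hγ lam).isOpen_compl θ hθ
  refine ⟨min ε η, lt_min hε hη, min_le_right _ _, ?_⟩
  rw [← Real.ball_eq_Ioo]
  exact Set.disjoint_left.2 fun x hx => hball (Metric.ball_subset_ball (min_le_left _ _) hx)

theorem eventually_sector_iff {α β : ℝ} {p : ℂ → Prop} :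
    (∀ᶠ x in 𝓝[sector α β (fun _ => 1)] 0, p x) ↔ ∃ r > 0, ∀ x ∈ sector α β (fun _ => r), p x := by
  rw [eventually_nhdsWithin_iff, Metric.eventually_nhds_iff]
  constructor
  · rintro ⟨r, hr, h⟩
    refine ⟨min r 1, by positivity, fun x hx => h ?_ (sector_mono le_rfl le_rfl (min_le_right _ _) hx)⟩
    rw [dist_zero_right]
    exact (norm_lt_of_mem_sector hx).trans_le (min_le_left _ _)
  · rintro ⟨r, hr, h⟩
    refine ⟨r, hr, ?_⟩
    rintro _ hd ⟨t, ht, s, hs, -, rfl⟩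
    refine h _ ⟨t, ht, s, hs, ?_, rfl⟩
    rwa [dist_zero_right, norm_mul, Complex.norm_exp_ofReal_mul_I, mul_one, Complex.norm_real,
      Real.norm_of_nonneg hs.le] at hd

theorem sectorTendsto_iff {α β : ℝ} {f : ℂ → ℂ} {l : ℂ} :
    SectorTendsto α β f l ↔ ∀ α' β', α < α' → β' < β →
      Tendsto f (𝓝[sector α' β' (fun _ => 1)] 0) (𝓝 l) := by
  refine forall₄_congr fun α' β' _ _ => ?_
  simp only [← eventually_sector_iff, Metric.tendsto_nhds, dist_eq_norm]
  refine ⟨fun h η hη => ?_, fun h η hη => (h η hη).mono fun _ => le_of_lt⟩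
  exact (h (η / 2) (half_pos hη)).mono fun _ hx => hx.trans_lt (half_lt_self hη)

theorem differentiableAt_det {n : ℕ} {P : ℂ → Matrix (Fin n) (Fin n) ℂ} {x : ℂ}
    (hP : ∀ i j, DifferentiableAt ℂ (fun x => P x i j) x) :
    DifferentiableAt ℂ (fun x => (P x).det) x := by
  simp only [Matrix.det_apply]
  refine DifferentiableAt.fun_sum fun σ _ => DifferentiableAt.const_smul ?_ _
  exact DifferentiableAt.fun_finsetProd fun i _ => hP _ _

theorem differentiableAt_matrix_inv {n : ℕ} {P : ℂ → Matrix (Fin n) (Fin n) ℂ} {x : ℂ}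
    (hP : ∀ i j, DifferentiableAt ℂ (fun x => P x i j) x) (hu : IsUnit (P x)) (i j : Fin n) :
    DifferentiableAt ℂ (fun x => (P x)⁻¹ i j) x := by
  have hdet : (P x).det ≠ 0 := ((Matrix.isUnit_iff_isUnit_det _).1 hu).ne_zero
  simp only [Matrix.inv_def, Ring.inverse_eq_inv', Matrix.smul_apply, smul_eq_mul,
    Matrix.adjugate_apply]
  refine ((differentiableAt_det hP).inv hdet).mul (differentiableAt_det fun k l => ?_)
  simp only [Matrix.updateRow_apply]
  split_ifs
  · exact differentiableAt_const _
  · exact hP k l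

theorem HasDerivAt.matrix_mulVec {n : ℕ} {P : ℂ → Matrix (Fin n) (Fin n) ℂ}
    {P' : Matrix (Fin n) (Fin n) ℂ} {Z : ℂ → Fin n → ℂ} {Z' : Fin n → ℂ} {x : ℂ}
    (hP : ∀ i j, HasDerivAt (fun x => P x i j) (P' i j) x) (hZ : HasDerivAt Z Z' x) :
    HasDerivAt (fun x => P x *ᵥ Z x) (P' *ᵥ Z x + P x *ᵥ Z') x := by
  rw [hasDerivAt_pi] at hZ ⊢
  intro i
  simp only [Matrix.mulVec, dotProduct, Pi.add_apply, ← Finset.sum_add_distrib]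
  exact HasDerivAt.fun_sum fun k _ => (hP i k).mul (hZ k)

/-- A solution `P` of `x^(1+γ) P' = A P - P B` with invertible values transforms the system with
matrix `A` into the system with matrix `B`. -/
theorem transformsOn_of_hasDerivAt {n γ : ℕ} {A B P : ℂ → Matrix (Fin n) (Fin n) ℂ} {S : Set ℂ}
    (h0 : ∀ x ∈ S, x ≠ 0) (hu : ∀ x ∈ S, IsUnit (P x))
    (hP : ∀ x ∈ S, ∀ i j, HasDerivAt (fun x => P x i j)
      ((A x * P x - P x * B x) i j / x ^ (γ + 1)) x) : TransformsOn γ A B P S := by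
  refine ⟨hu, fun U hU hUS Z => ?_⟩
  have hP' : ∀ x ∈ U, ∀ i j, HasDerivAt (fun x => P x i j)
      (((x ^ (1 + γ))⁻¹ • (A x * P x - P x * B x)) i j) x := fun x hx i j => by
    convert hP x (hUS hx) i j using 1
    rw [Matrix.smul_apply, smul_eq_mul, div_eq_inv_mul, add_comm]
  have hx0 : ∀ x ∈ U, x ^ (1 + γ) ≠ 0 := fun x hx => pow_ne_zero _ (h0 x (hUS hx))
  constructor
  · intro h x hx
    obtain ⟨Y', hY, hYeq⟩ := h x hx
    -- Only `P Z` is known to be differentiable; `Z` is recovered as `P⁻¹ (P Z)`.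
    have hd : DifferentiableAt ℂ Z x := by
      have h1 : DifferentiableAt ℂ (fun y => (P y)⁻¹ *ᵥ (P y *ᵥ Z y)) x := by
        have hY2 := hasDerivAt_pi.1 hY
        rw [differentiableAt_pi]
        intro i
        simp only [Matrix.mulVec, dotProduct]
        exact DifferentiableAt.fun_sum fun k _ => (differentiableAt_matrix_inv
          (fun i j => (hP x (hUS hx) i j).differentiableAt) (hu x (hUS hx)) i k).mul
            (hY2 k).differentiableAt
      refine h1.congr_of_eventuallyEq ?_
      filter_upwards [hU.mem_nhds hx] with y hy
      rw [Matrix.mulVec_mulVec, Matrix.nonsing_inv_mul _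
        ((Matrix.isUnit_iff_isUnit_det _).1 (hu y (hUS hy))), Matrix.one_mulVec]
    have hZ := hd.hasDerivAt
    refine ⟨_, hZ, ?_⟩
    have := hY.unique (HasDerivAt.matrix_mulVec (hP' x hx) hZ)
    rw [this, smul_add, Matrix.smul_mulVec, smul_inv_smul₀ (hx0 x hx), Matrix.sub_mulVec,
      ← Matrix.mulVec_mulVec, ← Matrix.mulVec_mulVec, ← Matrix.mulVec_smul] at hYeq
    have hinj := Matrix.mulVec_injective_iff_isUnit.2 (hu x (hUS hx))
    refine hinj ?_
    rw [sub_add_eq_add_sub, sub_eq_iff_eq_add] at hYeq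
    exact add_left_cancel hYeq
  · intro h x hx
    obtain ⟨Z', hZ, hZeq⟩ := h x hx
    refine ⟨_, HasDerivAt.matrix_mulVec (hP' x hx) hZ, ?_⟩
    rw [smul_add, Matrix.smul_mulVec, smul_inv_smul₀ (hx0 x hx), Matrix.sub_mulVec,
      ← Matrix.mulVec_mulVec, ← Matrix.mulVec_mulVec, ← Matrix.mulVec_smul, hZeq, sub_add_cancel]

theorem LocalGevrey.sum_mul {γ : ℕ} (hγ : 0 < γ) {α β : ℝ} {ι : Type*} [Fintype ι]
    {F G : ι → ℂ → ℂ} (hF : ∀ i, LocalGevrey γ α β (F i)) (hG : ∀ i, LocalGevrey γ α β (G i)) :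
    LocalGevrey γ α β (fun x => ∑ i, F i x * G i x) := by
  convert LocalGevrey.sum hγ Finset.univ fun i _ => (hF i).mul hγ (hG i) using 1
  ext x
  simp

/-- The differential equation of the completed column `e_j + q`. -/
theorem IsColumn.hasDerivAt_add_single {n γ : ℕ} {A : ℂ → Matrix (Fin n) (Fin n) ℂ}
    {lam : Fin n → ℂ} {j : Fin n} {α β : ℝ} {q : ℂ → Fin n → ℂ}
    (hq : IsColumn γ A lam j α β q) {α' β' : ℝ} (hα : α < α') (hβ : β' < β) :
    ∃ r > 0, ∀ x ∈ sector α' β' (fun _ => r), ∀ i,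
      HasDerivAt (fun x => (Pi.single j 1 + q x : Fin n → ℂ) i)
        (((A x *ᵥ (Pi.single j 1 + q x)) i - (A x *ᵥ (Pi.single j 1 + q x)) j *
          (Pi.single j 1 + q x : Fin n → ℂ) i) / x ^ (γ + 1)) x := by
  obtain ⟨r, hr, h⟩ := hq.ode α' β' hα hβ
  refine ⟨r, hr, fun x hx i => ?_⟩
  by_cases hij : i = j
  · subst hij
    simp only [Pi.add_apply, Pi.single_eq_same, hq.self, add_zero, mul_one, sub_self, zero_div]
    exact hasDerivAt_const _ _
  · simp only [Pi.add_apply, Pi.single_eq_of_ne hij, zero_add]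
    convert h x hx i hij using 2
    simp only [riccati, one_smul, Matrix.sub_mulVec, Pi.sub_apply, Matrix.mulVec_diagonal,
      Pi.add_apply, Pi.single_eq_same, Pi.single_eq_of_ne hij, hq.self]
    ring

theorem mainTheorem2 (n γ : ℕ) (hγ : 0 < γ) (θ δ : ℝ) (hδ : Real.pi / (2 * (γ : ℝ)) < δ)
    (A : ℂ → Matrix (Fin n) (Fin n) ℂ) (a : ℕ → Matrix (Fin n) (Fin n) ℂ)
    (hA : ∀ i j : Fin n,
      IsBorelSummable (γ : ℝ) (θ - δ) (θ + δ) (fun x => A x i j) (fun m => a m i j))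
    (lam : Fin n → ℂ) (hlam : Function.Injective lam) (hA0 : a 0 = Matrix.diagonal lam)
    (hθ : θ ∉ singularDirections γ lam) :
    (∃ ε₀ : ℝ, 0 < ε₀ ∧ Real.pi / (2 * (γ : ℝ)) + ε₀ ≤ δ ∧
      Disjoint (Set.Ioo (θ - ε₀) (θ + ε₀)) (singularDirections γ lam)) ∧
    ∀ ε₀ : ℝ, 0 < ε₀ → Real.pi / (2 * (γ : ℝ)) + ε₀ ≤ δ →
      Disjoint (Set.Ioo (θ - ε₀) (θ + ε₀)) (singularDirections γ lam) →
      ∃ (P : ℂ → Matrix (Fin n) (Fin n) ℂ) (p : ℕ → Matrix (Fin n) (Fin n) ℂ)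
        (Λ : Fin n → Polynomial ℂ) (ρ : ℝ → ℝ),
        (∀ i : Fin n, (Λ i).natDegree ≤ γ ∧ (Λ i).eval 0 = lam i) ∧
        p 0 = 1 ∧
        (∀ ε : ℝ, 0 < ε → ε < ε₀ → ∀ i j : Fin n,
          IsBorelSummable (γ : ℝ) (θ - (Real.pi / (2 * (γ : ℝ)) + ε))
            (θ + (Real.pi / (2 * (γ : ℝ)) + ε)) (fun x => P x i j) (fun m => p m i j)) ∧
        IsRadius (θ - (Real.pi / (2 * (γ : ℝ)) + ε₀)) (θ + (Real.pi / (2 * (γ : ℝ)) + ε₀)) ρ ∧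
        (∀ i j : Fin n, DifferentiableOn ℂ (fun x => P x i j)
          (sector (θ - (Real.pi / (2 * (γ : ℝ)) + ε₀))
            (θ + (Real.pi / (2 * (γ : ℝ)) + ε₀)) ρ)) ∧
        TransformsOn γ A (fun x => Matrix.diagonal fun i => (Λ i).eval x) P
          (sector (θ - (Real.pi / (2 * (γ : ℝ)) + ε₀))
            (θ + (Real.pi / (2 * (γ : ℝ)) + ε₀)) ρ) := by
  refine ⟨?_, ?_⟩
  · obtain ⟨ε₀, h1, h2, h3⟩ := exists_disjoint_singularDirections hγ (sub_pos.2 hδ) hθ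
    exact ⟨ε₀, h1, by linarith, h3⟩
  intro ε₀ hε₀ hεδ hdisj
  have hγ' : (0 : ℝ) < γ := by exact_mod_cast hγ
  have hπ : 0 < Real.pi / (2 * (γ : ℝ)) := by positivity
  set α := θ - (Real.pi / (2 * (γ : ℝ)) + ε₀) with hα
  set β := θ + (Real.pi / (2 * (γ : ℝ)) + ε₀) with hβ
  have hαβ : α < β := by linarith
  have hAG : ∀ i j, LocalGevrey γ α β (fun x => A x i j) := fun i j =>
    ((hA i j).localGevrey hγ).1.mono (by linarith) (by linarith)
  have hAT : ∀ i j α' β', α < α' → β' < β →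
      Tendsto (fun x => A x i j) (𝓝[sector α' β' (fun _ => 1)] 0)
        (𝓝 (Matrix.diagonal lam i j)) := fun i j α' β' h h' => by
    rw [← hA0]
    exact sectorTendsto_iff.1 ((hA i j).localGevrey hγ).2 α' β' (by linarith) (by linarith)
  choose q hq using fun j => exists_column (A := A) hγ hlam hε₀ hdisj
    (fun i k => by
      convert (hAG i k).add (LocalGevrey.const hγ (-Matrix.diagonal lam i k)) using 1
      ext x
      simp [sub_eq_add_neg])
    (fun i k => sectorTendsto_iff.2 fun α' β' h h' => by
      simpa using (hAT i k α' β' h h').sub_const (Matrix.diagonal lam i k)) j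
  set Q : ℂ → Matrix (Fin n) (Fin n) ℂ := fun x i j => (Pi.single j 1 + q j x : Fin n → ℂ) i
    with hQ
  have hQG : ∀ i j, LocalGevrey γ α β (fun x => Q x i j) := fun i j =>
    (LocalGevrey.const hγ ((Pi.single j 1 : Fin n → ℂ) i)).add ((hq j).gevrey i)
  have hQT : ∀ i j α' β', α < α' → β' < β → Tendsto (fun x => Q x i j)
      (𝓝[sector α' β' (fun _ => 1)] 0) (𝓝 ((1 : Matrix (Fin n) (Fin n) ℂ) i j)) := by
    intro i j α' β' h h'
    have h1 : (1 : Matrix (Fin n) (Fin n) ℂ) i j = (Pi.single j 1 : Fin n → ℂ) i + 0 := by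
      rw [add_zero, Pi.single_apply, Matrix.one_apply]
    rw [h1]
    exact (sectorTendsto_iff.1 ((hq j).tendsto i) α' β' h h').const_add _
  have hbG : ∀ j, LocalGevrey γ α β (fun x => (A x * Q x) j j) := fun j => by
    simp only [Matrix.mul_apply]
    exact LocalGevrey.sum_mul hγ (fun k => hAG j k) (fun k => hQG k j)
  have hbT : ∀ j, SectorTendsto α β (fun x => (A x * Q x) j j) (lam j) := by
    refine fun j => sectorTendsto_iff.2 fun α' β' h h' => ?_
    have : lam j = (Matrix.diagonal lam * (1 : Matrix (Fin n) (Fin n) ℂ)) j j := by simp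
    rw [this]
    simp only [Matrix.mul_apply]
    exact tendsto_finsetSum _ fun k _ => (hAT j k α' β' h h').mul (hQT k j α' β' h h')
  choose Λ B hdeg hΛT hBG hBT hBd using fun j => (hbG j).exists_primitive hγ hαβ
  have hΛ0 : ∀ j, (Λ j).eval 0 = lam j := fun j => (hΛT j).unique hαβ (hbT j)
  -- The factor `exp (B j)` replaces the diagonal entry `(A Q)_jj` by its polynomial part `Λ j`.
  set P : ℂ → Matrix (Fin n) (Fin n) ℂ := fun x i j => Q x i j * Complex.exp (B j x) with hPdef
  have hPG : ∀ i j, LocalGevrey γ α β (fun x => P x i j) := fun i j =>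
    (hQG i j).mul hγ ((hBG j).exp hγ)
  have hPT : ∀ i j α' β', α < α' → β' < β → Tendsto (fun x => P x i j)
      (𝓝[sector α' β' (fun _ => 1)] 0) (𝓝 ((1 : Matrix (Fin n) (Fin n) ℂ) i j)) := by
    intro i j α' β' h h'
    have := (hQT i j α' β' h h').mul
      (Complex.continuous_exp.continuousAt.tendsto.comp (sectorTendsto_iff.1 (hBT j) α' β' h h'))
    simpa using this
  choose p hp using fun i j => (hPG i j).exists_series hγ hαβ
  have hU : ∀ α' β', α < α' → β' < β → ∃ r > 0, sector α' β' (fun _ => r) ⊆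
      {x | x ≠ 0 ∧ IsUnit (P x) ∧ ∀ i j, HasDerivAt (fun x => P x i j)
        ((A x * P x - P x * Matrix.diagonal fun i => (Λ i).eval x) i j / x ^ (γ + 1)) x} := by
    intro α' β' h h'
    refine eventually_sector_iff.1 ?_
    have hdet : Tendsto (fun x => (P x).det) (𝓝[sector α' β' (fun _ => 1)] 0) (𝓝 1) := by
      have : Tendsto P (𝓝[sector α' β' (fun _ => 1)] 0) (𝓝 1) :=
        tendsto_pi_nhds.2 fun i => tendsto_pi_nhds.2 fun j => hPT i j α' β' h h'
      simpa [Function.comp_def] using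
        (continuous_id.matrix_det.tendsto (1 : Matrix (Fin n) (Fin n) ℂ)).comp this
    have h1 := eventually_all.2 fun j => eventually_sector_iff.2 ((hq j).hasDerivAt_add_single h h')
    have h2 := eventually_all.2 fun j => eventually_sector_iff.2 (hBd j α' β' h h')
    have h3 : ∀ᶠ x in 𝓝[sector α' β' (fun _ => 1)] (0 : ℂ), x ≠ 0 :=
      eventually_sector_iff.2 ⟨1, one_pos, fun x hx => norm_pos_iff.1 (norm_pos_of_mem_sector hx)⟩
    filter_upwards [hdet.eventually_ne one_ne_zero, h1, h2, h3] with x hx1 hx2 hx3 hx4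
    refine ⟨hx4, (Matrix.isUnit_iff_isUnit_det _).2 hx1.isUnit, fun i j => ?_⟩
    have hmul : ∀ k, (A x * P x) k j = (A x * Q x) k j * Complex.exp (B j x) := fun k => by
      rw [Matrix.mul_apply, Matrix.mul_apply, Finset.sum_mul]
      exact Finset.sum_congr rfl fun l _ => (mul_assoc _ _ _).symm
    have hcol : ∀ k, (A x *ᵥ (Pi.single j 1 + q j x)) k = (A x * Q x) k j := fun _ => rfl
    -- In the product rule the term `-(A Q)_jj` from the column cancels against the one in the
    -- derivative of `B j`, leaving `-Λ j`.
    have hd := (hx2 j i).mul (hx3 j).cexp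
    refine hd.congr_deriv ?_
    rw [hcol, hcol, Matrix.sub_apply, Matrix.mul_diagonal, hmul]
    simp only [hPdef, hQ]
    ring
  obtain ⟨ρ, hρ, hρU⟩ := exists_radius_function hU
  refine ⟨P, fun m i j => PowerSeries.coeff m (p i j), Λ, ρ, fun i => ⟨hdeg i, hΛ0 i⟩, ?_, ?_, hρ,
    fun i j x hx => ((hρU hx).2.2 i j).differentiableAt.differentiableWithinAt,
    transformsOn_of_hasDerivAt (fun x hx => (hρU hx).1) (fun x hx => (hρU hx).2.1)
      fun x hx => (hρU hx).2.2⟩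
  · ext i j
    exact (sectorTendsto_of_series hγ (hp i j)).unique hαβ (sectorTendsto_iff.2 (hPT i j))
  · intro ε hε hεε i j
    refine isBorelSummable_of_series hγ (hp i j) (by linarith) (by linarith) ?_
    have : Real.pi / γ = 2 * (Real.pi / (2 * γ)) := by field_simp
    linarith
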